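/- Let $m>2$ and $n\ge 2$ be integers, $k_n=(-1)^{q+1}$ if $n=2q$ and $k_n\in\{1,-1\}$ if $n$ is odd. For $x\in\mathbb R$, $s>0$ let $$p_n(x,s)=\frac1{2\pi}\int_{-\infty}^{+\infty}e^{ixz+k_n s(iz)^n}\,dz$$ (a convergent improper integral) be the transition function of the pseudoprocess $\Psi_n$ driven by $\partial_t p=k_n\partial_x^n p$. Consider the problem $$\frac{\partial^{1/m}}{\partial t^{1/m}}u(x,t)=k_n\frac{\partial^n}{\partial x^n}u(x,t),\quad x\in\mathbb R,\ t>0,\qquad u(x,0)=\delta(x),$$ with the Caputo derivative $\frac{d^\alpha f}{dt^\alpha}(t)=\frac1{\Gamma(1-\alpha)}\int_0^t\frac{f'(z)}{(t-z)^\alpha}\,dz$, $\alpha=1/m$. By a solution we mean a function $u$, continuous in $x$ for each $t>0$, with $|u(x,t)|\le g(t)(1+|x|)^N$ on $\mathbb R\times(0,T]$ for every $T>0$ (with some $N\in\mathbb N$, $g\in L^1(0,T)$ depending on $T$), such that for every Schwartz function $\varphi$ the function $f_\varphi(t)=\int u(x,t)\varphi(x)\,dx$ is $C^1$ on $(0,\infty)$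 with $f_\varphi'\in L^1(0,T)$ for all $T>0$, $f_\varphi(t)\to\varphi(0)$ as $t\downarrow0$, and $\frac{d^\alpha}{dt^\alpha} f_\varphi(t)=(-1)^nk_n\int u(x,t)\varphi^{(n)}(x)\,dx$ for all $t>0$. For $t>0$ and $j=1,\dots,m-1$ put $$p_{G_j(t)}(w)=\frac{1}{m^{\frac{j}{m-1}-1}\,t^{\frac{j}{m(m-1)}}\,\Gamma(\frac jm)}\exp\Big(-\frac{w^m}{\sqrt[m-1]{m^mt}}\Big)w^{j-1}\quad(w>0),\qquad p_{G_j(t)}(w)=0\quad(w\le0).$$ (a) These are probability densities and, for $w_1,\dots,w_{m-1}>0$, $$\prod_{j=1}^{m-1}p_{G_j(t)}(w_j)=\Big(\frac m{2\pi}\Big)^{\frac{m-1}2}\frac1{\sqrt t}\exp\Big(-\frac{\sum_{j=1}^{m-1}w_j^m}{\sqrt[m-1]{m^mt}}\Big)\prod_{j=1}^{m-1}w_j^{j-1}.$$ Hence a random vector has the right-hand side (extended by $0$ off the positive orthant) as its joint density if and only if its components are independent with the densities $p_{G_1(t)},\dots,p_{G_{m-1}(t)}$. There is a probability space carrying, for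 all $t>0$, such independent random variables $G_1(t),\dots,G_{m-1}(t)$. (b) Let, for each $t>0$, $G_1(t),\dots,G_{m-1}(t)$ be independent random variables with these densities and $G(t)=\prod_{j=1}^{m-1}G_j(t)$. Then $G(t)>0$ almost surely, $G(t)$ has a probability density $p_{G(t)}$, and the problem above has exactly one solution, namely $$u_{1/m}(x,t)=\int_0^\infty p_n(x,s)\,p_{G(t)}(s)\,ds,\qquad x\in\mathbb R,\ t>0,$$ where the integral converges absolutely. Consequently $u_{1/m}(\cdot,t)$ is the (pseudo-)density of $\Psi_n(G(t))$, with $\Psi_n$ started at $0$ and independent of $G(t)$: for every $f\in L^1(\mathbb R)$, $$\mathbb E\Big[\Big(\int_{\mathbb R} f(x)p_n(x,s)\,dx\Big)_{s=G(t)}\Big]=\int_{\mathbb R} f(x)\,u_{1/m}(x,t)\,dx ,$$ all the integrals and the expectation being absolutely convergent. -/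

import Mathlib

open MeasureTheory ProbabilityTheory Filter Topology Set

noncomputable section

/-- The sign convention of the `n`-th order heat-type equation: `k = (-1)^(q+1)` if `n = 2q`,
and `k = 1` or `k = -1` if `n` is odd. -/
def IsHeatSign (n : ℕ) (k : ℝ) : Prop :=
  (∀ q : ℕ, n = 2 * q → k = (-1) ^ (q + 1)) ∧ (Odd n → k = 1 ∨ k = -1)

/-- `(1 / 2π) ∫_{-a}^{b} exp (i x z + k s (i z)^n) dz`. -/
def truncKernel (n : ℕ) (k x s : ℝ) (ab : ℝ × ℝ) : ℂ :=
  (1 / (2 * (Real.pi : ℂ))) *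
    ∫ z in (-ab.1)..ab.2,
      Complex.exp (Complex.I * x * z + k * s * (Complex.I * z) ^ n)

/-- The kernel `p_n(x, s) = (1 / 2π) ∫_{-∞}^{∞} exp (i x z + k s (i z)^n) dz`, the integral being
improper (for odd `n` it converges only conditionally). -/
def heatKernel (n : ℕ) (k x s : ℝ) : ℂ :=
  limUnder (atTop ×ˢ atTop) (truncKernel n k x s)

/-- The Dzherbashyan-Caputo derivative of order `0 < α < 1`. -/
def caputoDeriv (α : ℝ) (f : ℝ → ℂ) (t : ℝ) : ℂ :=
  (1 / (Real.Gamma (1 - α) : ℂ)) * ∫ z in (0 : ℝ)..t, deriv f z * (((t - z) ^ (-α) : ℝ) : ℂ)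

/-- The pairing `∫ u(x, t) φ(x) dx`. -/
def spacePairing (u : ℝ → ℝ → ℂ) (φ : ℝ → ℂ) (t : ℝ) : ℂ := ∫ x, u x t * φ x

/-- `u = u(x, t)`, `t > 0`, is a solution of `∂^α u / ∂t^α = k ∂^n u / ∂x^n`, `u(x, 0) = δ(x)`
(`0 < α < 1`): the derivative in `x` and the initial condition are taken in the sense of tempered
distributions, the time derivative is the Caputo derivative. -/
structure IsFundamentalSolution (α : ℝ) (n : ℕ) (k : ℝ) (u : ℝ → ℝ → ℂ) : Prop where
  continuous_space : ∀ t : ℝ, 0 < t → Continuous fun x => u x t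
  /-- At most polynomial growth in `x`, with a factor that is integrable in time up to `0`. -/
  growth : ∀ T : ℝ, 0 < T → ∃ (N : ℕ) (g : ℝ → ℝ), IntegrableOn g (Ioc 0 T) ∧
    ∀ t ∈ Ioc 0 T, ∀ x : ℝ, ‖u x t‖ ≤ g t * (1 + |x|) ^ N
  /-- The pairings are absolutely continuous up to `t = 0`, so that their Caputo derivative is
  defined. -/
  contDiff_time : ∀ φ : SchwartzMap ℝ ℂ, ContDiffOn ℝ 1 (spacePairing u φ) (Ioi 0)
  deriv_integrable : ∀ φ : SchwartzMap ℝ ℂ, ∀ T : ℝ, 0 < T →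
    IntegrableOn (deriv (spacePairing u φ)) (Ioc 0 T)
  equation : ∀ φ : SchwartzMap ℝ ℂ, ∀ t : ℝ, 0 < t →
    caputoDeriv α (spacePairing u φ) t =
      k * (-1) ^ n * spacePairing u (iteratedDeriv n (φ : ℝ → ℂ)) t
  initial : ∀ φ : SchwartzMap ℝ ℂ, Tendsto (spacePairing u φ) (𝓝[>] 0) (𝓝 (φ 0))

/-- The density of the `j`-th factor `G_j(t)`, `1 ≤ j ≤ m - 1`. -/
def factorDensity (m j : ℕ) (t w : ℝ) : ℝ :=
  if 0 < w then
    1 / ((m : ℝ) ^ ((j : ℝ) / ((m : ℝ) - 1) - 1) * t ^ ((j : ℝ) / ((m : ℝ) * ((m : ℝ) - 1))) *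
        Real.Gamma ((j : ℝ) / m)) *
      Real.exp (-(w ^ m / ((m : ℝ) ^ m * t) ^ (1 / ((m : ℝ) - 1)))) * w ^ (j - 1)
  else 0

/-- The law of the `j`-th factor. -/
def factorLaw (m j : ℕ) (t : ℝ) : Measure ℝ :=
  volume.withDensity fun w => ENNReal.ofReal (factorDensity m j t w)

open Classical in
/-- The joint density of `(G_1(t), …, G_{m-1}(t))`; the index `j : Fin (m - 1)` stands for the
factor with number `j + 1`. -/
def jointDensity (m : ℕ) (t : ℝ) (w : Fin (m - 1) → ℝ) : ℝ :=
  if ∀ j, 0 < w j then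
    ((m : ℝ) / (2 * Real.pi)) ^ (((m : ℝ) - 1) / 2) * (1 / Real.sqrt t) *
      Real.exp (-((∑ j, w j ^ m) / ((m : ℝ) ^ m * t) ^ (1 / ((m : ℝ) - 1)))) *
      ∏ j, w j ^ (j : ℕ)
  else 0

/-- For every `t > 0` the random variables `G_1(t), …, G_{m-1}(t)` are independent and `G_j(t)`
has the density `factorDensity m j t`. -/
def IsFactorFamily {Ω : Type*} [MeasurableSpace Ω] (m : ℕ) (P : Measure Ω)
    (G : Fin (m - 1) → ℝ → Ω → ℝ) : Prop :=
  ∀ t : ℝ, 0 < t →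
    iIndepFun (fun j => G j t) P ∧ ∀ j, HasLaw (G j t) (factorLaw m ((j : ℕ) + 1) t) P

/-- The random time `G(t) = ∏_j G_j(t)`. -/
def timeProduct {Ω : Type*} {m : ℕ} (G : Fin (m - 1) → ℝ → Ω → ℝ) (t : ℝ) (ω : Ω) : ℝ :=
  ∏ j, G j t ω

/-- `∫_0^∞ p_n(x, s) p_T(s) ds`, where `p_T` is the probability density of the random time `T`. -/
def subordinatedKernel {Ω : Type*} [MeasurableSpace Ω] (n : ℕ) (k : ℝ) (P : Measure Ω)
    (T : Ω → ℝ) (x : ℝ) : ℂ :=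
  ∫ s in Ioi (0 : ℝ), heatKernel n k x s * ((pdf T P volume s).toReal : ℂ)

/-- The pseudo-expectation `E f(Ψ_n(s)) = ∫ f(x) p_n(x, s) dx` of the pseudoprocess `Ψ_n` with
transition function `p_n`, started at `0`, at the fixed time `s`. -/
def pseudoExpectation (n : ℕ) (k : ℝ) (f : ℝ → ℂ) (s : ℝ) : ℂ := ∫ x, f x * heatKernel n k x s

/-- `v` is the density of `Ψ_n(T)`, for a random time `T` independent of `Ψ_n`: for integrable `f`
(in particular the indicator of a Borel set of finite measure), `E f(Ψ_n(T))`, which is the mean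
of `E f(Ψ_n(s))` over the law of `T`, is `∫ f(x) v(x) dx`. -/
def IsPseudoDensityAt {Ω : Type*} [MeasurableSpace Ω] (n : ℕ) (k : ℝ) (P : Measure Ω)
    (T : Ω → ℝ) (v : ℝ → ℂ) : Prop :=
  ∀ f : ℝ → ℂ, Integrable f →
    (∀ᵐ ω ∂P, Integrable fun x => f x * heatKernel n k x (T ω)) ∧
    Integrable (fun ω => pseudoExpectation n k f (T ω)) P ∧
    Integrable (fun x => f x * v x) ∧
    ∫ ω, pseudoExpectation n k f (T ω) ∂P = ∫ x, f x * v x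

end

noncomputable section

/-! ### The Gamma function at rational points -/

/-! Put `μ(z) = k (iz)^n`, so that `Re μ ≤ 0`. In Fourier variables the pseudoprocess at time `s` is
the multiplier `exp(s μ)`, hence at the independent random time `G(t)` it is `E exp(μ G(t))`. Each
factor of `G(t)` is a generalized gamma variable, so its moments are quotients of Gamma values. In
their product the Gauss multiplication formula telescopes these into `E G(t)^r = t^(r/m) r! / Γ(r/m
+ 1)` (`momentConst_natCast`). Summing the exponential series gives the Mittag-Leffler function of
order `1/m` at `μ t^(1/m)` (`integral_cexp_productLaw`), and integrating that series termwise
against the Caputo kernel shows that every mode solves the fractional relaxation equation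
(`integral_mittagLefflerDeriv`).

For odd `n` the kernel is only conditionally convergent. Van der Corput's tests supply the bound `C
s^(-1/n)`, uniform in `x` (`norm_heatKernel_le`). Since `-1/n > -1`, the corresponding moment of
`G(t)` is finite, which justifies the exchanges of integrals over `x` and `s` and yields continuity
and growth of the mean kernel.

For uniqueness, Abel inversion turns the equation into `D_φ = ± I^α D_(φ^(n))`, where `D_φ` is the
difference of the pairings of two solutions with `φ` and `I^α` is fractional integration. In `L^1`
with weight `exp(-l t)` the operator `I^α` has norm at most `l^(-α)`
(`weightedNorm_le_of_fractional_integral`). If `φ` is band-limited, its derivatives of order `j` are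
bounded by multiples of `A^j`, so for `l^α > A^n` iteration forces `D_φ = 0`
(`pairingDiff_eq_zero`). Band-limited approximate identities then recover the values of a continuous
solution. -/

theorem prod_two_mul_sin (n : ℕ) :
    ∏ k ∈ Finset.range n, (2 * Real.sin (Real.pi * ((k : ℝ) + 1) / ((n : ℝ) + 1))) = n + 1 := by
  -- The product of `1 - ζ^k` over the nontrivial roots of unity of order `n + 1` equals `n + 1`;
  -- the sines appear on taking norms, as `|1 - exp(2iθ)| = 2 sin θ` on `[0, π]`.
  have h := (Complex.isPrimitiveRoot_exp (n + 1) n.succ_ne_zero).prod_one_sub_pow_eq_order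
  have h2 := congrArg norm h
  rw [norm_prod] at h2
  have h3 : ‖((n : ℂ) + 1)‖ = (n : ℝ) + 1 := by
    rw [← Nat.cast_succ, Complex.norm_natCast]; push_cast; rfl
  rw [h3] at h2
  refine Eq.trans ?_ h2
  refine Finset.prod_congr rfl fun k hk => ?_
  have hk : k < n := Finset.mem_range.mp hk
  rw [← Complex.exp_nat_mul, ← norm_neg, neg_sub]
  have h4 : (((k + 1 : ℕ) : ℂ) * (2 * Real.pi * Complex.I / ((n + 1 : ℕ) : ℂ))) =
      Complex.I * ((2 * (Real.pi * ((k : ℝ) + 1) / ((n : ℝ) + 1)) : ℝ) : ℂ) := by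
    push_cast; ring
  rw [h4, Complex.norm_exp_I_mul_ofReal_sub_one]
  rw [mul_div_cancel_left₀ _ two_ne_zero, Real.norm_eq_abs, abs_of_nonneg]
  have hkn : ((k : ℝ) + 1) / ((n : ℝ) + 1) ≤ 1 := by
    rw [div_le_one (by positivity)]
    have : (k : ℝ) < n := by exact_mod_cast hk
    linarith
  have hpi : (0 : ℝ) ≤ Real.pi * ((k : ℝ) + 1) / ((n : ℝ) + 1) := by positivity
  refine mul_nonneg zero_le_two (Real.sin_nonneg_of_nonneg_of_le_pi hpi ?_)
  rw [mul_div_assoc]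
  exact mul_le_of_le_one_right Real.pi_pos.le hkn

/-- `∏ Γ(j/m) = (2π)^((m-1)/2) m^(-1/2)`, with `m = n + 1`. -/
theorem prod_Gamma_div (n : ℕ) :
    ∏ k ∈ Finset.range n, Real.Gamma (((k : ℝ) + 1) / ((n : ℝ) + 1)) =
      (2 * Real.pi) ^ ((n : ℝ) / 2) * ((n : ℝ) + 1) ^ (-(1 / 2) : ℝ) := by
  set P := ∏ k ∈ Finset.range n, Real.Gamma (((k : ℝ) + 1) / ((n : ℝ) + 1)) with hP
  have hpos : 0 < P := Finset.prod_pos fun k _ => Real.Gamma_pos_of_pos (by positivity)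
  have hn : (0 : ℝ) < (n : ℝ) + 1 := by positivity
  -- Reversing the order of the factors pairs `Γ(x)` with `Γ(1 - x)`, so the reflection formula
  -- expresses `P * P` through the product of sines.
  have hrefl : P = ∏ k ∈ Finset.range n, Real.Gamma (1 - ((k : ℝ) + 1) / ((n : ℝ) + 1)) := by
    rw [hP, ← Finset.prod_range_reflect]
    refine Finset.prod_congr rfl fun k hk => ?_
    have hk : k < n := Finset.mem_range.mp hk
    congr 1
    rw [Nat.sub_sub, Nat.cast_sub (by omega)]
    push_cast
    field_simp
    ring
  have hsq : P * P * (n + 1) = (2 * Real.pi) ^ n := by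
    nth_rewrite 2 [hrefl]
    rw [hP, ← Finset.prod_mul_distrib]
    refine (congrArg _ (prod_two_mul_sin n).symm).trans ?_
    rw [← Finset.prod_mul_distrib]
    rw [Finset.prod_congr rfl (g := fun _ => 2 * Real.pi), Finset.prod_const, Finset.card_range]
    intro k hk
    have hk : k < n := Finset.mem_range.mp hk
    rw [Real.Gamma_mul_Gamma_one_sub, mul_div_assoc Real.pi]
    have hs : Real.sin (Real.pi * (((k : ℝ) + 1) / ((n : ℝ) + 1))) ≠ 0 := by
      refine (Real.sin_pos_of_pos_of_lt_pi (by positivity) ?_).ne'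
      refine mul_lt_of_lt_one_right Real.pi_pos ?_
      rw [div_lt_one hn]
      have : (k : ℝ) < n := by exact_mod_cast hk
      linarith
    field_simp
    exact div_self (by rwa [mul_div_assoc])
  have h1 : P ^ 2 = ((2 * Real.pi) ^ ((n : ℝ) / 2) * ((n : ℝ) + 1) ^ (-(1 / 2) : ℝ)) ^ 2 := by
    rw [mul_pow, ← Real.rpow_natCast, ← Real.rpow_natCast, ← Real.rpow_natCast, ← Real.rpow_mul
      (by positivity), ← Real.rpow_mul hn.le]
    rw [show (n : ℝ) / 2 * ((2 : ℕ) : ℝ) = n by push_cast; ring,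
      show (-(1 / 2) : ℝ) * ((2 : ℕ) : ℝ) = -1 by push_cast; ring, Real.rpow_neg_one,
      Real.rpow_natCast, Real.rpow_natCast, ← hsq]
    field_simp
  exact (pow_left_inj₀ hpos.le (by positivity) two_ne_zero).mp h1

/-! ### The laws of the factors -/

/-- The scale `(m^m t)^(1/(m-1))` of the `m`-th power in the densities of the factors. -/
def factorScale (m : ℕ) (t : ℝ) : ℝ := ((m : ℝ) ^ m * t) ^ (1 / ((m : ℝ) - 1))

theorem factorScale_pos {m : ℕ} (hm : 2 < m) {t : ℝ} (ht : 0 < t) : 0 < factorScale m t := by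
  have : (0 : ℝ) < m := by positivity
  unfold factorScale; positivity

theorem factorScale_rpow {m : ℕ} (hm : 2 < m) {t : ℝ} (ht : 0 < t) (r : ℝ) :
    factorScale m t ^ (r / m) =
      (m : ℝ) ^ (r / ((m : ℝ) - 1)) * t ^ (r / ((m : ℝ) * ((m : ℝ) - 1))) := by
  have h0 : (0 : ℝ) < m := by positivity
  have h1 : (0 : ℝ) < (m : ℝ) - 1 := by
    have : (2 : ℝ) < m := by exact_mod_cast hm
    linarith
  unfold factorScale
  rw [← Real.rpow_mul (by positivity), Real.mul_rpow (by positivity) ht.le,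
    ← Real.rpow_natCast, ← Real.rpow_mul h0.le]
  congr 2 <;> field_simp

/-- The separate powers of `m` and `t` in the normalization are one power of the scale, which
exhibits a generalized gamma density and makes the standard Gamma integral applicable. -/
theorem factorDensity_of_pos {m j : ℕ} (hm : 2 < m) (hj : 1 ≤ j) {t w : ℝ} (ht : 0 < t)
    (hw : 0 < w) :
    factorDensity m j t w = m * factorScale m t ^ (-((j : ℝ) / m)) / Real.Gamma (j / m) *
      (w ^ ((j : ℝ) - 1) * Real.exp (-(factorScale m t)⁻¹ * w ^ (m : ℝ))) := by
  have h0 : (0 : ℝ) < m := by positivity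
  have hG : 0 < Real.Gamma ((j : ℝ) / m) := Real.Gamma_pos_of_pos (by positivity)
  rw [factorDensity, if_pos hw, Real.rpow_neg (factorScale_pos hm ht).le, factorScale_rpow hm ht,
    ← factorScale, ← Real.rpow_natCast w (j - 1), Nat.cast_sub hj, Nat.cast_one,
    Real.rpow_natCast w m, Real.rpow_sub_one h0.ne']
  rw [show -(factorScale m t)⁻¹ * w ^ m = -(w ^ m / factorScale m t) by
    rw [div_eq_mul_inv]; ring]
  have := Real.rpow_pos_of_pos h0 ((j : ℝ) / ((m : ℝ) - 1))
  have := Real.rpow_pos_of_pos ht ((j : ℝ) / ((m : ℝ) * ((m : ℝ) - 1)))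
  field_simp

theorem factorDensity_of_nonpos {m j : ℕ} {t w : ℝ} (hw : w ≤ 0) : factorDensity m j t w = 0 := by
  rw [factorDensity, if_neg hw.not_gt]

theorem factorDensity_nonneg {m j : ℕ} (hm : 2 < m) (hj : 1 ≤ j) {t : ℝ} (ht : 0 < t) (w : ℝ) :
    0 ≤ factorDensity m j t w := by
  rcases le_or_gt w 0 with hw | hw
  · rw [factorDensity_of_nonpos hw]
  · rw [factorDensity_of_pos hm hj ht hw]
    have h0 : (0 : ℝ) < m := by positivity
    have := factorScale_pos hm ht
    have hG : 0 < Real.Gamma ((j : ℝ) / m) := Real.Gamma_pos_of_pos (by positivity)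
    positivity

theorem measurable_factorDensity (m j : ℕ) (t : ℝ) : Measurable (factorDensity m j t) := by
  unfold factorDensity
  refine Measurable.ite measurableSet_Ioi ?_ measurable_const
  fun_prop

theorem rpow_mul_factorDensity {m j : ℕ} (hm : 2 < m) (hj : 1 ≤ j) {t w : ℝ} (ht : 0 < t)
    (r : ℝ) (hw : 0 < w) :
    w ^ r * factorDensity m j t w = m * factorScale m t ^ (-((j : ℝ) / m)) / Real.Gamma (j / m) *
      (w ^ ((j : ℝ) - 1 + r) * Real.exp (-(factorScale m t)⁻¹ * w ^ (m : ℝ))) := by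
  rw [factorDensity_of_pos hm hj ht hw, Real.rpow_add hw]
  ring

/-- A Gamma integral in the variable `w^m`. Negative orders are kept because the moment of order
`-1/n` is needed for the kernel bound; the factor `j = 1` is the most restrictive one. -/
theorem integral_rpow_mul_factorDensity {m j : ℕ} (hm : 2 < m) (hj : 1 ≤ j) {t : ℝ} (ht : 0 < t)
    {r : ℝ} (hr : -(j : ℝ) < r) :
    IntegrableOn (fun w => w ^ r * factorDensity m j t w) (Ioi 0) ∧
    ∫ w in Ioi (0 : ℝ), w ^ r * factorDensity m j t w =
      factorScale m t ^ (r / m) * Real.Gamma ((j + r) / m) / Real.Gamma (j / m) := by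
  have h0 : (0 : ℝ) < m := by positivity
  have hc := factorScale_pos hm ht
  have hG : 0 < Real.Gamma ((j : ℝ) / m) := Real.Gamma_pos_of_pos (by positivity)
  have hq : -1 < (j : ℝ) - 1 + r := by linarith
  constructor
  · refine IntegrableOn.congr_fun (Integrable.const_mul
      (integrableOn_rpow_mul_exp_neg_mul_rpow hq h0 (inv_pos.mpr hc)) _)
      (fun w hw => (rpow_mul_factorDensity hm hj ht r hw).symm) measurableSet_Ioi
  · rw [setIntegral_congr_fun measurableSet_Ioi
      (fun w hw => rpow_mul_factorDensity hm hj ht r hw), integral_const_mul,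
      integral_rpow_mul_exp_neg_mul_rpow h0 hq (inv_pos.mpr hc)]
    rw [Real.inv_rpow hc.le, ← Real.rpow_neg hc.le,
      show (j : ℝ) - 1 + r + 1 = j + r by ring,
      show -(-((j : ℝ) + r) / (m : ℝ)) = (j : ℝ) / m + r / m by ring, Real.rpow_add hc,
      Real.rpow_neg hc.le]
    have := Real.rpow_pos_of_pos hc ((j : ℝ) / m)
    field_simp

theorem factorLaw_eq_restrict (m j : ℕ) (t : ℝ) :
    factorLaw m j t =
      (volume.restrict (Ioi 0)).withDensity fun w => ENNReal.ofReal (factorDensity m j t w) := by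
  rw [factorLaw, ← withDensity_indicator measurableSet_Ioi]
  congr 1
  ext w
  by_cases hw : w ∈ Ioi (0 : ℝ)
  · rw [indicator_of_mem hw]
  · rw [indicator_of_notMem hw, factorDensity_of_nonpos (not_lt.mp hw), ENNReal.ofReal_zero]

theorem integrable_factorDensity {m j : ℕ} (hm : 2 < m) (hj : 1 ≤ j) {t : ℝ} (ht : 0 < t) :
    Integrable (factorDensity m j t) := by
  have h := (integral_rpow_mul_factorDensity hm hj ht (r := 0)
    (neg_lt_zero.mpr (by positivity))).1
  simp only [Real.rpow_zero, one_mul] at h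
  rw [← integrableOn_iff_integrable_of_support_subset (s := Ioi 0)]
  · exact h
  · intro w hw
    by_contra hw'
    exact hw (factorDensity_of_nonpos (not_lt.mp hw'))

theorem isProbabilityMeasure_factorLaw {m j : ℕ} (hm : 2 < m) (hj : 1 ≤ j) {t : ℝ} (ht : 0 < t) :
    IsProbabilityMeasure (factorLaw m j t) := by
  have h := integral_rpow_mul_factorDensity hm hj ht (r := 0)
    (neg_lt_zero.mpr (by positivity))
  simp only [Real.rpow_zero, one_mul, zero_div, add_zero] at h
  constructor
  rw [factorLaw_eq_restrict, withDensity_apply _ MeasurableSet.univ, Measure.restrict_univ,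
    ← ofReal_integral_eq_lintegral_ofReal h.1
      (ae_of_all _ (factorDensity_nonneg hm hj ht)), h.2, div_self, ENNReal.ofReal_one]
  exact (Real.Gamma_pos_of_pos (by positivity)).ne'

theorem ae_pos_factorLaw (m j : ℕ) (t : ℝ) : ∀ᵐ w ∂factorLaw m j t, 0 < w := by
  rw [factorLaw_eq_restrict]
  exact (withDensity_absolutelyContinuous _ _).ae_le (ae_restrict_mem measurableSet_Ioi)

/-- The moments of the factors. -/
theorem integral_rpow_factorLaw {m j : ℕ} (hm : 2 < m) (hj : 1 ≤ j) {t : ℝ} (ht : 0 < t)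
    {r : ℝ} (hr : -(j : ℝ) < r) :
    Integrable (fun w => w ^ r) (factorLaw m j t) ∧
    ∫ w, w ^ r ∂factorLaw m j t =
      factorScale m t ^ (r / m) * Real.Gamma ((j + r) / m) / Real.Gamma (j / m) := by
  have h := integral_rpow_mul_factorDensity hm hj ht hr
  have hm1 : Measurable fun w => ENNReal.ofReal (factorDensity m j t w) :=
    (measurable_factorDensity m j t).ennreal_ofReal
  rw [factorLaw_eq_restrict]
  constructor
  · rw [integrable_withDensity_iff hm1 (ae_of_all _ fun _ => ENNReal.ofReal_lt_top)]
    simpa only [ENNReal.toReal_ofReal (factorDensity_nonneg hm hj ht _), IntegrableOn] using h.1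
  · rw [integral_withDensity_eq_integral_toReal_smul hm1
      (ae_of_all _ fun _ => ENNReal.ofReal_lt_top), ← h.2]
    simp only [ENNReal.toReal_ofReal (factorDensity_nonneg hm hj ht _), smul_eq_mul, mul_comm]

/-- In the denominators the exponents of `m` add up to `-(m - 1)/2 + 1/2` and those of `t` to `1/2`;
the Gamma values are collected by `prod_Gamma_div`. -/
theorem prod_factorDensity {m : ℕ} (hm : 2 < m) {t : ℝ} (ht : 0 < t) (w : Fin (m - 1) → ℝ) :
    ∏ j : Fin (m - 1), factorDensity m ((j : ℕ) + 1) t (w j) = jointDensity m t w := by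
  unfold jointDensity
  split_ifs with hw
  · obtain ⟨n, rfl⟩ : ∃ n, m = n + 1 := ⟨m - 1, by omega⟩
    simp only [factorDensity, if_pos (hw _), Nat.add_sub_cancel]
    rw [Finset.prod_mul_distrib, Finset.prod_mul_distrib, ← Real.exp_sum, Finset.sum_neg_distrib,
      ← Finset.sum_div]
    congr 2
    rw [Fin.prod_univ_eq_prod_range (fun j => 1 / (((n + 1 : ℕ) : ℝ) ^
      (((j + 1 : ℕ) : ℝ) / (((n + 1 : ℕ) : ℝ) - 1) - 1) * t ^ (((j + 1 : ℕ) : ℝ) /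
      (((n + 1 : ℕ) : ℝ) * (((n + 1 : ℕ) : ℝ) - 1))) *
      Real.Gamma (((j + 1 : ℕ) : ℝ) / ((n + 1 : ℕ) : ℝ)))) (n + 1 - 1),
      Nat.add_sub_cancel]
    have hn : (0 : ℝ) < n := by exact_mod_cast (by omega : 0 < n)
    have hn1 : (0 : ℝ) < (n : ℝ) + 1 := by positivity
    push_cast
    simp only [one_div, Finset.prod_inv_distrib, Finset.prod_mul_distrib, add_sub_cancel_right]
    have hs : ∑ k ∈ Finset.range n, ((k : ℝ) + 1) = n * (n + 1) / 2 := by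
      clear * -
      induction n with
      | zero => simp
      | succ n ih => rw [Finset.sum_range_succ, ih]; push_cast; ring
    rw [prod_Gamma_div, ← Real.rpow_sum_of_pos hn1, ← Real.rpow_sum_of_pos ht,
      Finset.sum_sub_distrib, ← Finset.sum_div, ← Finset.sum_div, hs, Finset.sum_const,
      Finset.card_range, Real.sqrt_eq_rpow, Real.div_rpow hn1.le (by positivity)]
    rw [show (n : ℝ) * (n + 1) / 2 / n - n • (1 : ℝ) = -(n / 2) + 1 / 2 by
      simp only [nsmul_eq_mul, mul_one]; field_simp; ring,
      show (n : ℝ) * (n + 1) / 2 / ((n + 1) * n) = 1 / 2 by field_simp,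
      Real.rpow_add hn1, Real.rpow_neg hn1.le, Real.rpow_neg hn1.le]
    have := Real.rpow_pos_of_pos hn1 ((n : ℝ) / 2)
    have := Real.rpow_pos_of_pos hn1 (1 / 2)
    have := Real.rpow_pos_of_pos ht (1 / 2)
    have := Real.rpow_pos_of_pos (by positivity : 0 < 2 * Real.pi) ((n : ℝ) / 2)
    field_simp
  · push Not at hw
    obtain ⟨j, hj⟩ := hw
    exact Finset.prod_eq_zero (Finset.mem_univ j) (factorDensity_of_nonpos hj)

/-! ### Products of measures with densities -/

theorem pi_withDensity_ofReal {ι : Type*} [Fintype ι] {f : ι → ℝ → ℝ}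
    (hf : ∀ i, Integrable (f i)) (h0 : ∀ i x, 0 ≤ f i x) :
    Measure.pi (fun i => volume.withDensity fun x => ENNReal.ofReal (f i x)) =
      volume.withDensity fun x : ι → ℝ => ENNReal.ofReal (∏ i, f i (x i)) := by
  have hσ : ∀ i, SigmaFinite (volume.withDensity fun x => ENNReal.ofReal (f i x)) := fun i =>
    SigmaFinite.withDensity_ofReal _
  refine Measure.pi_eq fun s hs => ?_
  rw [withDensity_apply _ (MeasurableSet.univ_pi hs), volume_pi, Measure.restrict_pi_pi,
    ← ofReal_integral_eq_lintegral_ofReal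
      (Integrable.fintype_prod_dep fun i => (hf i).restrict)
      (ae_of_all _ fun x => Finset.prod_nonneg fun i _ => h0 i _),
    integral_fintype_prod_eq_prod,
    ENNReal.ofReal_prod_of_nonneg fun i _ => integral_nonneg (h0 i)]
  refine Finset.prod_congr rfl fun i _ => ?_
  rw [withDensity_apply _ (hs i), ofReal_integral_eq_lintegral_ofReal (hf i).restrict
    (ae_of_all _ (h0 i))]

theorem pi_factorLaw {m : ℕ} (hm : 2 < m) {t : ℝ} (ht : 0 < t) :
    Measure.pi (fun j : Fin (m - 1) => factorLaw m ((j : ℕ) + 1) t) =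
      volume.withDensity fun w => ENNReal.ofReal (jointDensity m t w) := by
  simp_rw [← prod_factorDensity hm ht]
  exact pi_withDensity_ofReal (fun j => integrable_factorDensity hm (Nat.le_add_left _ _) ht)
    (fun j => factorDensity_nonneg hm (Nat.le_add_left _ _) ht)

/-- The measure with the joint density is the product of the factor laws, so its marginals are read
off from the coordinate projections and independence is the product form of the law. -/
theorem hasLaw_jointDensity_iff {Ω : Type*} [MeasurableSpace Ω] {P : Measure Ω}
    [IsProbabilityMeasure P] {m : ℕ} (hm : 2 < m) {t : ℝ} (ht : 0 < t)
    (X : Fin (m - 1) → Ω → ℝ) :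
    HasLaw (fun ω j => X j ω)
        (volume.withDensity fun w => ENNReal.ofReal (jointDensity m t w)) P ↔
      iIndepFun X P ∧ ∀ j, HasLaw (X j) (factorLaw m ((j : ℕ) + 1) t) P := by
  have hp : ∀ j : Fin (m - 1), IsProbabilityMeasure (factorLaw m ((j : ℕ) + 1) t) := fun j =>
    isProbabilityMeasure_factorLaw hm (Nat.le_add_left _ _) ht
  rw [← pi_factorLaw hm ht]
  constructor
  · intro h
    have hX : ∀ j, HasLaw (X j) (factorLaw m ((j : ℕ) + 1) t) P := fun j => by
      have := (measurePreserving_eval (fun j : Fin (m - 1) => factorLaw m ((j : ℕ) + 1) t) j)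
      exact this.hasLaw.comp h
    exact ⟨(iIndepFun_iff_hasLaw_pi_pi hX).mpr h, hX⟩
  · rintro ⟨h1, h2⟩
    exact (iIndepFun_iff_hasLaw_pi_pi h2).mp h1

-- Independence is asked only within a fixed time, so a single infinite product indexed by all pairs
-- `(t, j)` serves every time at once.
open Classical in
theorem exists_isFactorFamily {m : ℕ} (hm : 2 < m) :
    ∃ (Ω : Type) (_ : MeasurableSpace Ω) (P : Measure Ω) (_ : IsProbabilityMeasure P)
      (G : Fin (m - 1) → ℝ → Ω → ℝ), IsFactorFamily m P G := by
  let μ : ℝ × Fin (m - 1) → Measure ℝ := fun q =>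
    if 0 < q.1 then factorLaw m ((q.2 : ℕ) + 1) q.1 else Measure.dirac 0
  have hμ : ∀ q, IsProbabilityMeasure (μ q) := fun q => by
    by_cases h : 0 < q.1
    · simp only [μ, if_pos h]
      exact isProbabilityMeasure_factorLaw hm (Nat.le_add_left _ _) h
    · simp only [μ, if_neg h]
      infer_instance
  refine ⟨ℝ × Fin (m - 1) → ℝ, inferInstance, Measure.infinitePi μ, inferInstance,
    fun j t ω => ω (t, j), fun t ht => ⟨?_, fun j => ?_⟩⟩
  · have h := iIndepFun_infinitePi (P := μ) (X := fun _ x => x) (fun _ => measurable_id)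
    exact h.precomp (g := fun j : Fin (m - 1) => (t, j)) (fun i j h => (Prod.mk.inj h).2)
  · refine ⟨(measurable_pi_apply _).aemeasurable, ?_⟩
    have := Measure.infinitePi_map_eval μ (t, j)
    simpa only [μ, if_pos ht] using this

/-! ### The law of the product of the factors -/

/-- The joint law of the factors at time `t`. -/
def factorsLaw (m : ℕ) (t : ℝ) : Measure (Fin (m - 1) → ℝ) :=
  Measure.pi fun j : Fin (m - 1) => factorLaw m ((j : ℕ) + 1) t

/-- The law of the product of the factors at time `t`. -/
def productLaw (m : ℕ) (t : ℝ) : Measure ℝ :=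
  (factorsLaw m t).map fun w => ∏ j, w j

theorem isProbabilityMeasure_factorsLaw {m : ℕ} (hm : 2 < m) {t : ℝ} (ht : 0 < t) :
    IsProbabilityMeasure (factorsLaw m t) := by
  have hp : ∀ j : Fin (m - 1), IsProbabilityMeasure (factorLaw m ((j : ℕ) + 1) t) := fun j =>
    isProbabilityMeasure_factorLaw hm (Nat.le_add_left _ _) ht
  unfold factorsLaw
  infer_instance

theorem measurable_prod_coord (m : ℕ) : Measurable fun w : Fin (m - 1) → ℝ => ∏ j, w j := by
  fun_prop

theorem isProbabilityMeasure_productLaw {m : ℕ} (hm : 2 < m) {t : ℝ} (ht : 0 < t) :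
    IsProbabilityMeasure (productLaw m t) := by
  have := isProbabilityMeasure_factorsLaw hm ht
  exact Measure.isProbabilityMeasure_map (measurable_prod_coord m).aemeasurable

theorem ae_pos_factorsLaw {m : ℕ} (hm : 2 < m) {t : ℝ} (ht : 0 < t) :
    ∀ᵐ w ∂factorsLaw m t, ∀ j, 0 < w j := by
  have hp : ∀ j : Fin (m - 1), IsProbabilityMeasure (factorLaw m ((j : ℕ) + 1) t) := fun j =>
    isProbabilityMeasure_factorLaw hm (Nat.le_add_left _ _) ht
  rw [ae_all_iff]
  exact fun j => (Measure.quasiMeasurePreserving_eval _ j).ae (ae_pos_factorLaw m _ t)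

theorem ae_pos_productLaw {m : ℕ} (hm : 2 < m) {t : ℝ} (ht : 0 < t) :
    ∀ᵐ s ∂productLaw m t, 0 < s := by
  unfold productLaw
  rw [ae_map_iff (measurable_prod_coord m).aemeasurable measurableSet_Ioi]
  filter_upwards [ae_pos_factorsLaw hm ht] with w hw
  exact Finset.prod_pos fun j _ => hw j

/-- With all coordinates but the first frozen at positive values, the product is a nonzero dilation
of the first coordinate, which pulls null sets back to null sets. Fubini concludes, and only the
first factor needs a density. -/
theorem map_prod_pi_absolutelyContinuous {n : ℕ} (μ : Fin (n + 1) → Measure ℝ)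
    [∀ i, IsProbabilityMeasure (μ i)] (hμ : μ 0 ≪ volume) (h0 : ∀ i, ∀ᵐ x ∂μ i, 0 < x) :
    (Measure.pi μ).map (fun w => ∏ j, w j) ≪ volume := by
  refine Measure.AbsolutelyContinuous.mk fun s hs h => ?_
  have hpos : ∀ᵐ y ∂Measure.pi (fun j => μ ((0 : Fin (n + 1)).succAbove j)), ∀ j, 0 < y j := by
    rw [ae_all_iff]
    exact fun j => (Measure.quasiMeasurePreserving_eval _ j).ae (h0 _)
  have hmap := (measurePreserving_piFinSuccAbove μ 0).map_eq
  have hcomp : (fun w : Fin (n + 1) → ℝ => ∏ j, w j) =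
      (fun q : ℝ × (Fin n → ℝ) => q.1 * ∏ j, q.2 j) ∘
        MeasurableEquiv.piFinSuccAbove (fun _ => ℝ) 0 := by
    ext w
    rw [Fin.prod_univ_succ]
    rfl
  have hmeas : Measurable fun q : ℝ × (Fin n → ℝ) => q.1 * ∏ j, q.2 j := by fun_prop
  rw [hcomp, ← Measure.map_map hmeas (MeasurableEquiv.measurable _), hmap,
    Measure.map_apply hmeas hs, Measure.prod_apply_symm (hmeas hs), lintegral_eq_zero_iff'
      (measurable_measure_prodMk_right (hmeas hs)).aemeasurable]
  filter_upwards [hpos] with y hy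
  refine hμ ?_
  have : (fun x => (x, y)) ⁻¹' ((fun q : ℝ × (Fin n → ℝ) => q.1 * ∏ j, q.2 j) ⁻¹' s) =
      (fun x => x * ∏ j, y j) ⁻¹' s := rfl
  rw [this, Real.volume_preimage_mul_right (Finset.prod_pos fun j _ => hy j).ne', h, mul_zero]

theorem productLaw_absolutelyContinuous {m : ℕ} (hm : 2 < m) {t : ℝ} (ht : 0 < t) :
    productLaw m t ≪ volume := by
  obtain ⟨n, rfl⟩ : ∃ n, m = n + 1 + 1 := ⟨m - 2, by omega⟩
  have hp : ∀ j : Fin (n + 1), IsProbabilityMeasure (factorLaw (n + 1 + 1) ((j : ℕ) + 1) t) :=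
    fun j => isProbabilityMeasure_factorLaw hm (Nat.le_add_left _ _) ht
  exact map_prod_pi_absolutelyContinuous
    (fun j : Fin (n + 1) => factorLaw (n + 1 + 1) ((j : ℕ) + 1) t)
    (withDensity_absolutelyContinuous _ _) (fun j => ae_pos_factorLaw _ _ t)

/-- The law of `timeProduct`. -/
theorem hasLaw_timeProduct {Ω : Type*} [MeasurableSpace Ω] {P : Measure Ω}
    {m : ℕ} {G : Fin (m - 1) → ℝ → Ω → ℝ} (hG : IsFactorFamily m P G)
    {t : ℝ} (ht : 0 < t) : HasLaw (timeProduct G t) (productLaw m t) P := by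
  have h := (hG t ht).1.hasLaw_pi (hG t ht).2
  exact HasLaw.comp ⟨(measurable_prod_coord m).aemeasurable, rfl⟩ h

/-- The time-independent factor of the moment of order `r` of the product of the factors. -/
def momentConst (m : ℕ) (r : ℝ) : ℝ :=
  (m : ℝ) ^ r * ∏ j : Fin (m - 1),
    (Real.Gamma ((((j : ℕ) + 1 : ℕ) + r) / m) / Real.Gamma ((((j : ℕ) + 1 : ℕ) : ℝ) / m))

/-- Moments of independent factors multiply, and `m - 1` copies of the scale to the power `r/m` make
`(m^m t)^(r/m) = m^r t^(r/m)`. -/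
theorem integral_rpow_productLaw {m : ℕ} (hm : 2 < m) {t : ℝ} (ht : 0 < t) {r : ℝ} (hr : -1 < r) :
    Integrable (fun s => s ^ r) (productLaw m t) ∧
    ∫ s, s ^ r ∂productLaw m t = t ^ (r / m) * momentConst m r := by
  have hp : ∀ j : Fin (m - 1), IsProbabilityMeasure (factorLaw m ((j : ℕ) + 1) t) := fun j =>
    isProbabilityMeasure_factorLaw hm (Nat.le_add_left _ _) ht
  have hj : ∀ j : Fin (m - 1), -((((j : ℕ) + 1 : ℕ)) : ℝ) < r := fun j => by
    have : (0 : ℝ) ≤ (j : ℕ) := Nat.cast_nonneg _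
    push_cast
    linarith
  have hmom := fun j : Fin (m - 1) =>
    integral_rpow_factorLaw hm (Nat.le_add_left 1 (j : ℕ)) ht (hj j)
  have hae : (fun w : Fin (m - 1) → ℝ => ∏ j, w j ^ r) =ᵐ[factorsLaw m t]
      fun w => (∏ j, w j) ^ r := by
    filter_upwards [ae_pos_factorsLaw hm ht] with w hw
    exact Real.finsetProd_rpow _ _ (fun j _ => (hw j).le) r
  have hmeas : AEStronglyMeasurable (fun s : ℝ => s ^ r)
      ((factorsLaw m t).map fun w => ∏ j, w j) :=
    (Measurable.pow_const measurable_id r).aestronglyMeasurable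
  constructor
  · rw [productLaw, integrable_map_measure hmeas (measurable_prod_coord m).aemeasurable]
    exact (Integrable.fintype_prod_dep fun j => (hmom j).1).congr hae
  · rw [productLaw, integral_map (measurable_prod_coord m).aemeasurable hmeas,
      ← integral_congr_ae hae, factorsLaw, integral_fintype_prod_eq_prod (fun _ x => x ^ r)]
    have h0 : (0 : ℝ) < m := by positivity
    have h1 : (0 : ℝ) < (m : ℝ) - 1 := by
      have : (2 : ℝ) < m := by exact_mod_cast hm
      linarith
    simp only [fun j => (hmom j).2, mul_div_assoc]
    rw [Finset.prod_mul_distrib, Finset.prod_const, Finset.card_univ, Fintype.card_fin,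
      ← Real.rpow_natCast, ← Real.rpow_mul (factorScale_pos hm ht).le,
      Nat.cast_sub (by omega), Nat.cast_one,
      show r / (m : ℝ) * ((m : ℝ) - 1) = r * ((m : ℝ) - 1) / m by ring, factorScale_rpow hm ht,
      momentConst]
    rw [show r * ((m : ℝ) - 1) / ((m : ℝ) - 1) = r by field_simp,
      show r * ((m : ℝ) - 1) / ((m : ℝ) * ((m : ℝ) - 1)) = r / m by field_simp]
    ring

/-- An instance of the Gauss multiplication formula, by induction: raising `r` by one shifts every
Gamma argument by `1/m`, so the product telescopes up to its end factors, and `Γ(x + 1) = x Γ(x)`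
supplies the factor `(r + 1)/m`. -/
theorem momentConst_natCast {m : ℕ} (hm : 2 < m) (r : ℕ) :
    momentConst m r = r.factorial / Real.Gamma ((r : ℝ) / m + 1) := by
  have h0 : (0 : ℝ) < m := by positivity
  have hG : ∀ x : ℝ, 0 < x → 0 < Real.Gamma (x / m) := fun x hx =>
    Real.Gamma_pos_of_pos (by positivity)
  have hden : 0 < ∏ j : Fin (m - 1), Real.Gamma ((((j : ℕ) + 1 : ℕ) : ℝ) / m) :=
    Finset.prod_pos fun j _ => hG _ (by positivity)
  obtain ⟨n, rfl⟩ : ∃ n, m = n + 1 := ⟨m - 1, by omega⟩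
  have key : ∀ r : ℕ, ((n + 1 : ℕ) : ℝ) ^ r *
      (∏ j ∈ Finset.range n, Real.Gamma ((((j + 1 : ℕ) : ℝ) + r) / (n + 1 : ℕ))) *
        Real.Gamma ((r : ℝ) / (n + 1 : ℕ) + 1) =
      r.factorial * ∏ j ∈ Finset.range n, Real.Gamma (((j + 1 : ℕ) : ℝ) / (n + 1 : ℕ)) := by
    intro r
    induction r with
    | zero => simp
    | succ r ih =>
      -- Both sides are the same product of `m` Gamma values with arguments in steps of `1/m`, with
      -- the first and the last factor split off respectively.
      have e1 : (∏ j ∈ Finset.range n,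
          Real.Gamma ((((j + 1 : ℕ) : ℝ) + (r + 1 : ℕ)) / (n + 1 : ℕ))) *
          Real.Gamma (((1 : ℝ) + r) / (n + 1 : ℕ)) =
          (∏ j ∈ Finset.range n, Real.Gamma ((((j + 1 : ℕ) : ℝ) + r) / (n + 1 : ℕ))) *
          Real.Gamma ((r : ℝ) / (n + 1 : ℕ) + 1) := by
        have := Finset.prod_range_succ
          (fun j => Real.Gamma ((((j + 1 : ℕ) : ℝ) + r) / (n + 1 : ℕ))) n
        rw [show (r : ℝ) / (n + 1 : ℕ) + 1 = (((n + 1 : ℕ) : ℝ) + r) / (n + 1 : ℕ) by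
          field_simp; ring, ← this, Finset.prod_range_succ']
        push_cast
        congr 1
        refine Finset.prod_congr rfl fun j _ => ?_
        ring_nf
      have e2 : Real.Gamma (((r + 1 : ℕ) : ℝ) / (n + 1 : ℕ) + 1) =
          ((r : ℝ) + 1) / (n + 1 : ℕ) * Real.Gamma (((1 : ℝ) + r) / (n + 1 : ℕ)) := by
        rw [Real.Gamma_add_one (by positivity)]
        push_cast
        ring_nf
      rw [e2, Nat.factorial_succ, Nat.cast_mul, mul_assoc, mul_assoc, ← ih, pow_succ]
      rw [show ∀ a b c d e : ℝ, a * b * (c * (d * e)) = a * b * d * (c * e) by intros; ring, e1]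
      push_cast
      field_simp
  rw [momentConst, Finset.prod_div_distrib, Real.rpow_natCast]
  have hGr : 0 < Real.Gamma ((r : ℝ) / (n + 1 : ℕ) + 1) := Real.Gamma_pos_of_pos (by positivity)
  rw [mul_div_assoc', div_eq_div_iff hden.ne' hGr.ne']
  rw [Fin.prod_univ_eq_prod_range
    (fun j => Real.Gamma ((((j + 1 : ℕ) : ℝ) + r) / (n + 1 : ℕ))) (n + 1 - 1),
    Fin.prod_univ_eq_prod_range
    (fun j => Real.Gamma (((j + 1 : ℕ) : ℝ) / (n + 1 : ℕ))) (n + 1 - 1), Nat.add_sub_cancel]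
  exact key r

theorem integral_pow_productLaw {m : ℕ} (hm : 2 < m) {t : ℝ} (ht : 0 < t) (r : ℕ) :
    Integrable (fun s => s ^ r) (productLaw m t) ∧
    ∫ s, s ^ r ∂productLaw m t =
      t ^ ((r : ℝ) / m) * (r.factorial / Real.Gamma ((r : ℝ) / m + 1)) := by
  have h := integral_rpow_productLaw hm ht (r := r)
    (lt_of_lt_of_le (by norm_num) (Nat.cast_nonneg r))
  rw [momentConst_natCast hm] at h
  simpa only [Real.rpow_natCast] using h

/-! ### The Mittag-Leffler function -/

/-- Keep only the part of the Gamma integral over `(B, ∞)`, where `x^y ≥ B^y`. With `B` free, this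
shows superexponential growth of Gamma without Stirling's formula. -/
theorem rpow_mul_exp_neg_le_Gamma {B y : ℝ} (hB : 0 < B) (hy : 0 ≤ y) :
    B ^ y * Real.exp (-B) ≤ Real.Gamma (y + 1) := by
  rw [Real.Gamma_eq_integral (by linarith), ← integral_exp_neg_Ioi, ← integral_const_mul]
  have hint := Real.GammaIntegral_convergent (s := y + 1) (by linarith)
  calc ∫ x in Ioi B, B ^ y * Real.exp (-x)
      ≤ ∫ x in Ioi B, Real.exp (-x) * x ^ (y + 1 - 1) := by
        refine setIntegral_mono_on ?_ (hint.mono_set (Ioi_subset_Ioi hB.le)) measurableSet_Ioi ?_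
        · exact (exp_neg_integrableOn_Ioi B one_pos |>.congr_fun (fun x _ => by simp)
            measurableSet_Ioi).const_mul _
        · intro x hx
          rw [add_sub_cancel_right, mul_comm]
          gcongr
          exact (mem_Ioi.mp hx).le
    _ ≤ _ := by
        refine setIntegral_mono_set hint ?_ (LE.le.eventuallyLE (Ioi_subset_Ioi hB.le))
        filter_upwards [ae_restrict_mem measurableSet_Ioi] with x hx
        have : (0 : ℝ) < x := hx
        positivity

theorem summable_pow_div_Gamma {m : ℕ} (hm : 0 < m) {a : ℝ} (ha : 0 ≤ a) :
    Summable fun r : ℕ => a ^ r / Real.Gamma ((r : ℝ) / m + 1) := by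
  -- Taking `B = c^m` and `y = r/m` gives `Γ(r/m + 1) ≥ c^r exp(-c^m)`; any `c > a` then yields a
  -- geometric majorant.
  set c : ℝ := 2 * a + 1 with hc
  have hc0 : 0 < c := by positivity
  have hB : 0 < c ^ m := by positivity
  have hr : a / c < 1 := by rw [div_lt_one hc0]; linarith
  refine Summable.of_nonneg_of_le (fun r => ?_) (fun r => ?_)
    ((summable_geometric_of_lt_one (by positivity) hr).mul_left (Real.exp (c ^ m)))
  · have : 0 < Real.Gamma ((r : ℝ) / m + 1) := Real.Gamma_pos_of_pos (by positivity)
    positivity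
  · have h := rpow_mul_exp_neg_le_Gamma hB (y := (r : ℝ) / m) (by positivity)
    rw [← Real.rpow_natCast c m, ← Real.rpow_mul hc0.le, mul_div_cancel₀ _ (by positivity),
      Real.rpow_natCast, Real.rpow_natCast] at h
    rw [div_le_iff₀ (Real.Gamma_pos_of_pos (by positivity))]
    calc a ^ r = Real.exp (c ^ m) * (a / c) ^ r * (c ^ r * Real.exp (-c ^ m)) := by
          rw [div_pow, Real.exp_neg]
          field_simp
      _ ≤ _ := by gcongr

/-- The terms of the exponential series are nonnegative almost everywhere, so Tonelli integrates it
termwise before integrability is known. -/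
theorem integrable_exp_mul_of_summable {ρ : Measure ℝ} (h0 : ∀ᵐ s ∂ρ, 0 < s)
    (hint : ∀ r : ℕ, Integrable (fun s => s ^ r) ρ) {a : ℝ} (ha : 0 ≤ a)
    (hs : Summable fun r : ℕ => a ^ r / r.factorial * ∫ s, s ^ r ∂ρ) :
    Integrable (fun s => Real.exp (a * s)) ρ := by
  refine ⟨by fun_prop, ?_⟩
  rw [hasFiniteIntegral_iff_ofReal (ae_of_all _ fun s => (Real.exp_pos _).le)]
  have hnn : ∀ r : ℕ, ∀ᵐ s ∂ρ, 0 ≤ a ^ r / r.factorial * s ^ r := fun r => by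
    filter_upwards [h0] with s hs
    positivity
  have e : ∫⁻ s, ENNReal.ofReal (Real.exp (a * s)) ∂ρ =
      ∫⁻ s, ∑' r : ℕ, ENNReal.ofReal (a ^ r / r.factorial * s ^ r) ∂ρ := by
    refine lintegral_congr_ae ?_
    filter_upwards [h0] with s hs
    have hsum := NormedSpace.expSeries_div_hasSum_exp (a * s)
    rw [← Real.exp_eq_exp_ℝ] at hsum
    have hsum' : HasSum (fun r : ℕ => a ^ r / r.factorial * s ^ r) (Real.exp (a * s)) := by
      have hfun : (fun r : ℕ => a ^ r / r.factorial * s ^ r) =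
          fun r : ℕ => (a * s) ^ r / r.factorial := by
        ext r
        rw [mul_pow]; ring
      rwa [hfun]
    rw [← hsum'.tsum_eq, ENNReal.ofReal_tsum_of_nonneg (fun r => by positivity) hsum'.summable]
  rw [e, lintegral_tsum fun r => by fun_prop]
  have e2 : ∀ r : ℕ, ∫⁻ s, ENNReal.ofReal (a ^ r / r.factorial * s ^ r) ∂ρ =
      ENNReal.ofReal (a ^ r / r.factorial * ∫ s, s ^ r ∂ρ) := fun r => by
    rw [← integral_const_mul, ofReal_integral_eq_lintegral_ofReal ((hint r).const_mul _) (hnn r)]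
  simp_rw [e2]
  exact hs.tsum_ofReal_lt_top

/-- The generating function `z ↦ ∑ z ^ r / Γ(r / m + 1)` (Mittag-Leffler function of order
`1 / m`). -/
def mittagLeffler (m : ℕ) (z : ℂ) : ℂ :=
  ∑' r : ℕ, z ^ r / (Real.Gamma ((r : ℝ) / m + 1) : ℂ)

theorem integrable_exp_productLaw {m : ℕ} (hm : 2 < m) {t : ℝ} (ht : 0 < t) (a : ℝ) :
    Integrable (fun s => Real.exp (a * s)) (productLaw m t) := by
  have hpos := ae_pos_productLaw hm ht
  have hm0 : (0 : ℝ) < m := by positivity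
  have h : Integrable (fun s => Real.exp (|a| * s)) (productLaw m t) := by
    refine integrable_exp_mul_of_summable hpos (fun r => (integral_pow_productLaw hm ht r).1)
      (abs_nonneg a) ?_
    refine (summable_pow_div_Gamma (m := m) (by omega) (a := |a| * t ^ (1 / (m : ℝ)))
      (by positivity)).congr fun r => ?_
    rw [(integral_pow_productLaw hm ht r).2, mul_pow, ← Real.rpow_natCast (t ^ (1 / (m : ℝ))),
      ← Real.rpow_mul ht.le, one_div_mul_eq_div]
    have : (r.factorial : ℝ) ≠ 0 := by positivity
    field_simp
  refine h.mono' (by fun_prop) ?_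
  filter_upwards [hpos] with s hs
  rw [Real.norm_eq_abs, Real.abs_exp]
  gcongr
  exact le_abs_self a

/-- The exponential transform of the random time is a Mittag-Leffler function. -/
theorem integral_cexp_productLaw {m : ℕ} (hm : 2 < m) {t : ℝ} (ht : 0 < t) (z : ℂ) :
    ∫ s, Complex.exp (z * s) ∂productLaw m t =
      mittagLeffler m (z * ((t ^ (1 / (m : ℝ)) : ℝ) : ℂ)) := by
  have hpos := ae_pos_productLaw hm ht
  have hmom := integral_pow_productLaw hm ht
  have hn : ∀ r : ℕ, (fun s : ℝ => ‖z ^ r / (r.factorial : ℂ) * (s : ℂ) ^ r‖)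
      =ᵐ[productLaw m t] fun s => ‖z‖ ^ r / r.factorial * s ^ r := fun r => by
    filter_upwards [hpos] with s hs
    simp [abs_of_pos hs]
  have hI : ∀ r : ℕ, Integrable (fun s : ℝ => z ^ r / (r.factorial : ℂ) * (s : ℂ) ^ r)
      (productLaw m t) := fun r => by
    refine Integrable.const_mul ?_ _
    simpa using (hmom r).1.ofReal (𝕜 := ℂ)
  have hsplit : ∀ r : ℕ, (t ^ (1 / (m : ℝ))) ^ r = t ^ ((r : ℝ) / m) := fun r => by
    rw [← Real.rpow_natCast (t ^ (1 / (m : ℝ))), ← Real.rpow_mul ht.le, one_div_mul_eq_div]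
  have hS : Summable fun r : ℕ =>
      ∫ s : ℝ, ‖z ^ r / (r.factorial : ℂ) * (s : ℂ) ^ r‖ ∂productLaw m t := by
    refine (summable_pow_div_Gamma (m := m) (by omega) (a := ‖z‖ * t ^ (1 / (m : ℝ)))
      (by positivity)).congr fun r => ?_
    rw [integral_congr_ae (hn r), integral_const_mul, (hmom r).2, mul_pow, hsplit]
    have : (r.factorial : ℝ) ≠ 0 := by positivity
    field_simp
  have h := integral_tsum_of_summable_integral_norm hI hS
  have e : ∀ s : ℝ, ∑' r : ℕ, z ^ r / (r.factorial : ℂ) * (s : ℂ) ^ r = Complex.exp (z * s) := by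
    intro s
    have hsum := NormedSpace.expSeries_div_hasSum_exp (z * (s : ℂ))
    rw [← Complex.exp_eq_exp_ℂ] at hsum
    rw [← hsum.tsum_eq]
    congr 1; ext r
    rw [mul_pow]; ring
  simp_rw [e] at h
  rw [← h, mittagLeffler]
  congr 1; ext r
  rw [integral_const_mul]
  have : ∫ s : ℝ, (s : ℂ) ^ r ∂productLaw m t = ((∫ s, s ^ r ∂productLaw m t : ℝ) : ℂ) := by
    rw [← integral_complex_ofReal]
    simp
  rw [this, (hmom r).2, mul_pow, ← Complex.ofReal_pow, hsplit]
  have : (r.factorial : ℂ) ≠ 0 := by exact_mod_cast r.factorial_ne_zero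
  push_cast
  field_simp

/-! ### Van der Corput estimates -/

theorem _root_.HasDerivAt.reflect {f : ℝ → ℝ} {f' z : ℝ} (h : HasDerivAt f f' (-z)) :
    HasDerivAt (fun z => f (-z)) (-f') z := by
  have h := h.comp z (hasDerivAt_neg z)
  rw [mul_neg_one] at h
  exact h

theorem norm_integral_exp_I_le_length (ψ : ℝ → ℝ) {a b : ℝ} (hab : a ≤ b) :
    ‖∫ z in a..b, Complex.exp (Complex.I * (ψ z : ℂ))‖ ≤ b - a := by
  have h := intervalIntegral.norm_integral_le_of_norm_le_const (a := a) (b := b) (C := 1)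
    (f := fun z => Complex.exp (Complex.I * (ψ z : ℂ))) (fun z _ => by
      rw [mul_comm, Complex.norm_exp_ofReal_mul_I])
  rwa [one_mul, abs_of_nonneg (sub_nonneg.mpr hab)] at h

/-- The first derivative test: integrate by parts after writing `exp(iψ) = (-i/ψ') (exp(iψ))'`. As
`ψ'` increases, the remaining integral is at most `1/d a - 1/d b`, which with the boundary terms
adds up to `2/d a`. -/
theorem norm_integral_exp_I_le_of_deriv_ge {ψ d d' : ℝ → ℝ} (hψ : ∀ z, HasDerivAt ψ (d z) z)
    (hd : ∀ z, HasDerivAt d (d' z) z) (hc : Continuous d') {a b ρ : ℝ} (hab : a ≤ b)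
    (hρ : 0 < ρ) (ha : ρ ≤ d a) (hd' : ∀ z ∈ Icc a b, 0 ≤ d' z) :
    ‖∫ z in a..b, Complex.exp (Complex.I * (ψ z : ℂ))‖ ≤ 2 / ρ := by
  have hdc : Continuous d := continuous_iff_continuousAt.mpr fun z => (hd z).continuousAt
  have hψc : Continuous ψ := continuous_iff_continuousAt.mpr fun z => (hψ z).continuousAt
  have hmono : ∀ z ∈ Icc a b, d a ≤ d z := by
    have := monotoneOn_of_deriv_nonneg (convex_Icc a b) hdc.continuousOn
      (fun z _ => (hd z).differentiableAt.differentiableWithinAt)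
      (fun z hz => by rw [(hd z).deriv]; exact hd' z (interior_subset hz))
    exact fun z hz => this (left_mem_Icc.mpr hab) hz hz.1
  have hpos : ∀ z ∈ Icc a b, 0 < d z := fun z hz => hρ.trans_le (ha.trans (hmono z hz))
  have hu : ∀ z ∈ uIcc a b, HasDerivAt (fun z => -Complex.I * ((d z)⁻¹ : ℝ))
      (-Complex.I * ((-(d' z) / (d z) ^ 2 : ℝ) : ℂ)) z := fun z hz => by
    rw [uIcc_of_le hab] at hz
    exact (((hd z).inv (hpos z hz).ne').ofReal_comp).const_mul _
  have hv : ∀ z ∈ uIcc a b, HasDerivAt (fun z => Complex.exp (Complex.I * (ψ z : ℂ)))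
      (Complex.exp (Complex.I * (ψ z : ℂ)) * (Complex.I * (d z : ℂ))) z := fun z _ =>
    (((hψ z).ofReal_comp).const_mul Complex.I).cexp
  have hqc : ContinuousOn (fun z => -(d' z) / (d z) ^ 2) (uIcc a b) := by
    refine hc.neg.continuousOn.div (hdc.pow 2).continuousOn fun z hz => ?_
    rw [uIcc_of_le hab] at hz
    exact pow_ne_zero 2 (hpos z hz).ne'
  have hparts := intervalIntegral.integral_mul_deriv_eq_deriv_mul hu hv
    (ContinuousOn.intervalIntegrable
      (continuousOn_const.mul (Complex.continuous_ofReal.comp_continuousOn hqc)))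
    (Continuous.intervalIntegrable (by fun_prop) _ _)
  have hl : ∫ z in a..b, -Complex.I * (((d z)⁻¹ : ℝ) : ℂ) *
      (Complex.exp (Complex.I * (ψ z : ℂ)) * (Complex.I * (d z : ℂ))) =
      ∫ z in a..b, Complex.exp (Complex.I * (ψ z : ℂ)) := by
    refine intervalIntegral.integral_congr fun z hz => ?_
    rw [uIcc_of_le hab] at hz
    have : (d z : ℂ) ≠ 0 := by exact_mod_cast (hpos z hz).ne'
    push_cast
    field_simp
    rw [Complex.I_sq]
    ring
  rw [hl] at hparts
  rw [hparts]
  have hn : ∀ z ∈ Icc a b, ‖-Complex.I * (((d z)⁻¹ : ℝ) : ℂ) *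
      Complex.exp (Complex.I * (ψ z : ℂ))‖ = (d z)⁻¹ := fun z hz => by
    rw [norm_mul, mul_comm Complex.I (ψ z : ℂ), Complex.norm_exp_ofReal_mul_I, norm_mul, norm_neg,
      Complex.norm_I, Complex.norm_real, Real.norm_eq_abs, abs_of_pos (inv_pos.mpr (hpos z hz))]
    ring
  have hint : ‖∫ z in a..b, -Complex.I * ((-(d' z) / (d z) ^ 2 : ℝ) : ℂ) *
      Complex.exp (Complex.I * (ψ z : ℂ))‖ ≤ (d a)⁻¹ - (d b)⁻¹ := by
    have hftc := intervalIntegral.integral_eq_sub_of_hasDerivAt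
      (f := fun z => -(d z)⁻¹) (f' := fun z => -(-(d' z) / (d z) ^ 2)) (a := a) (b := b)
      (fun z hz => by
        rw [uIcc_of_le hab] at hz
        exact ((hd z).inv (hpos z hz).ne').neg) hqc.neg.intervalIntegrable
    rw [show (d a)⁻¹ - (d b)⁻¹ = -(d b)⁻¹ - -(d a)⁻¹ by ring, ← hftc]
    refine intervalIntegral.norm_integral_le_of_norm_le hab ?_ hqc.neg.intervalIntegrable
    refine ae_of_all _ fun z hz => ?_
    have hz' := Ioc_subset_Icc_self hz
    rw [norm_mul, mul_comm Complex.I (ψ z : ℂ), Complex.norm_exp_ofReal_mul_I, norm_mul, norm_neg,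
      Complex.norm_I, Complex.norm_real, Real.norm_eq_abs, one_mul, mul_one, ← abs_neg, abs_of_nonneg]
    rw [neg_div, neg_neg]
    exact div_nonneg (hd' z hz') (sq_nonneg _)
  have ha' := left_mem_Icc.mpr hab
  have hb' := right_mem_Icc.mpr hab
  calc _ ≤ (d b)⁻¹ + (d a)⁻¹ + ((d a)⁻¹ - (d b)⁻¹) := by
        refine (norm_sub_le _ _).trans (add_le_add ((norm_sub_le _ _).trans ?_) hint)
        rw [hn a ha', hn b hb']
    _ = 2 * (d a)⁻¹ := by ring
    _ ≤ 2 / ρ := by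
        rw [div_eq_mul_inv]
        gcongr

/-- An initial interval of length `1/ρ` costs at most its length; beyond it `ψ'' ≥ ρ^2` has raised
`ψ'` to at least `ρ`, and the first derivative test costs `2/ρ`. -/
theorem norm_integral_exp_I_le_of_zero_left {ψ d d' : ℝ → ℝ} (hψ : ∀ z, HasDerivAt ψ (d z) z)
    (hd : ∀ z, HasDerivAt d (d' z) z) (hc : Continuous d') {a b ρ : ℝ} (hab : a ≤ b)
    (hρ : 0 < ρ) (ha : 0 ≤ d a) (hd' : ∀ z ∈ Icc a b, ρ ^ 2 ≤ d' z) :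
    ‖∫ z in a..b, Complex.exp (Complex.I * (ψ z : ℂ))‖ ≤ 3 / ρ := by
  have hψc : Continuous ψ := continuous_iff_continuousAt.mpr fun z => (hψ z).continuousAt
  have hρ' : 0 < 1 / ρ := by positivity
  have h3 : 3 / ρ = 1 / ρ + 2 / ρ := by ring
  rcases le_or_gt b (a + 1 / ρ) with hb | hb
  · refine (norm_integral_exp_I_le_length ψ hab).trans ?_
    have : 0 ≤ 2 / ρ := by positivity
    linarith
  · have hac : a ≤ a + 1 / ρ := by linarith
    have hI : ∀ u v, IntervalIntegrable (fun z => Complex.exp (Complex.I * (ψ z : ℂ))) volume u v :=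
      fun u v => Continuous.intervalIntegrable (by fun_prop) _ _
    rw [← intervalIntegral.integral_add_adjacent_intervals (hI a (a + 1 / ρ)) (hI _ b), h3]
    refine (norm_add_le _ _).trans (add_le_add ?_ ?_)
    · exact (norm_integral_exp_I_le_length ψ hac).trans (by linarith)
    · refine norm_integral_exp_I_le_of_deriv_ge hψ hd hc hb.le hρ ?_ fun z hz =>
        (sq_nonneg ρ).trans (hd' z ⟨hac.trans hz.1, hz.2⟩)
      have := (convex_Icc a b).mul_sub_le_image_sub_of_le_deriv (f := d) (C := ρ ^ 2)
        (fun z _ => (hd z).continuousAt.continuousWithinAt)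
        (fun z _ => (hd z).differentiableAt.differentiableWithinAt)
        (fun z hz => by rw [(hd z).deriv]; exact hd' z (interior_subset hz))
        a (left_mem_Icc.mpr hab) (a + 1 / ρ) ⟨hac, hb.le⟩ hac
      have e : ρ ^ 2 * (a + 1 / ρ - a) = ρ := by field_simp; ring
      linarith

/-- The second derivative test of van der Corput. -/
theorem norm_integral_exp_I_le_of_second_deriv {ψ d d' : ℝ → ℝ}
    (hψ : ∀ z, HasDerivAt ψ (d z) z)
    (hd : ∀ z, HasDerivAt d (d' z) z) (hc : Continuous d') {a b ρ : ℝ} (hab : a ≤ b)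
    (hρ : 0 < ρ) (hd' : ∀ z ∈ Icc a b, ρ ^ 2 ≤ d' z) :
    ‖∫ z in a..b, Complex.exp (Complex.I * (ψ z : ℂ))‖ ≤ 6 / ρ := by
  have hψc : Continuous ψ := continuous_iff_continuousAt.mpr fun z => (hψ z).continuousAt
  have hdc : Continuous d := continuous_iff_continuousAt.mpr fun z => (hd z).continuousAt
  have h36 : 3 / ρ ≤ 6 / ρ := by gcongr; norm_num
  -- The reflection `z ↦ -z` reduces the part where `ψ'` is negative to the one-sided estimate.
  have hleft : ∀ c ∈ Icc a b, d c ≤ 0 →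
      ‖∫ z in a..c, Complex.exp (Complex.I * (ψ z : ℂ))‖ ≤ 3 / ρ := fun c hcm hcd => by
    have h1 : ∀ z, HasDerivAt (fun z => ψ (-z)) (-d (-z)) z := fun z => (hψ (-z)).reflect
    have h2 : ∀ z, HasDerivAt (fun z => -d (-z)) (d' (-z)) z := fun z => by
      have h := (hd (-z)).reflect.neg
      rwa [neg_neg] at h
    have h := norm_integral_exp_I_le_of_zero_left h1 h2 (hc.comp continuous_neg)
      (neg_le_neg hcm.1) hρ (by rw [neg_neg]; linarith)
      (fun z hz => hd' (-z) ⟨by linarith [hz.2], by linarith [hz.1, hcm.2]⟩)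
    rwa [intervalIntegral.integral_comp_neg (fun z => Complex.exp (Complex.I * (ψ z : ℂ))), neg_neg,
      neg_neg] at h
  have hright : ∀ c ∈ Icc a b, 0 ≤ d c →
      ‖∫ z in c..b, Complex.exp (Complex.I * (ψ z : ℂ))‖ ≤ 3 / ρ := fun c hcm hcd =>
    norm_integral_exp_I_le_of_zero_left hψ hd hc hcm.2 hρ hcd
      (fun z hz => hd' z ⟨hcm.1.trans hz.1, hz.2⟩)
  rcases le_or_gt 0 (d a) with ha | ha
  · exact (hright a (left_mem_Icc.mpr hab) ha).trans h36
  rcases le_or_gt (d b) 0 with hb | hb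
  · exact (hleft b (right_mem_Icc.mpr hab) hb).trans h36
  obtain ⟨c, hcm, hc0⟩ := intermediate_value_Icc hab hdc.continuousOn ⟨ha.le, hb.le⟩
  have hI : ∀ u v, IntervalIntegrable (fun z => Complex.exp (Complex.I * (ψ z : ℂ))) volume u v :=
    fun u v => Continuous.intervalIntegrable (by fun_prop) _ _
  rw [← intervalIntegral.integral_add_adjacent_intervals (hI a c) (hI c b),
    show 6 / ρ = 3 / ρ + 3 / ρ by ring]
  exact (norm_add_le _ _).trans (add_le_add (hleft c hcm hc0.le) (hright c hcm hc0.ge))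

/-! ### The phase `x z + s z ^ n` -/

theorem hasDerivAt_phase (n : ℕ) (x s z : ℝ) :
    HasDerivAt (fun z => x * z + s * z ^ n) (x + s * (n * z ^ (n - 1))) z := by
  have h := ((hasDerivAt_id z).const_mul x).add ((hasDerivAt_pow n z).const_mul s)
  rw [mul_one] at h
  exact h

theorem hasDerivAt_phase_deriv (n : ℕ) (x s z : ℝ) :
    HasDerivAt (fun z => x + s * (n * z ^ (n - 1)))
      (s * (n * (((n - 1 : ℕ) : ℝ) * z ^ (n - 1 - 1)))) z := by
  simpa using (((hasDerivAt_pow (n - 1) z).const_mul (n : ℝ)).const_mul s).const_add x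

/-- The natural length is `δ = s^(-1/n)`. Up to `δ` the trivial bound suffices; beyond it the second
derivative of the phase is at least `s δ^(n-2) = δ^(-2)`, so the second derivative test costs `6δ`.
The linear term does not enter the second derivative, whence uniformity in `x`. -/
theorem norm_integral_phase_le {n : ℕ} (hn : 2 ≤ n) (x : ℝ) {s b : ℝ} (hs : 0 < s) (hb : 0 ≤ b) :
    ‖∫ z in (0 : ℝ)..b, Complex.exp (Complex.I * ((x * z + s * z ^ n : ℝ) : ℂ))‖ ≤
      7 * s ^ (-(1 / (n : ℝ))) := by
  set δ : ℝ := s ^ (-(1 / (n : ℝ))) with hδ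
  have hδ0 : 0 < δ := Real.rpow_pos_of_pos hs _
  have hδn : s = (δ ^ n)⁻¹ := by
    rw [hδ, ← Real.rpow_natCast, ← Real.rpow_mul hs.le, ← Real.rpow_neg hs.le]
    rw [show -(-(1 / (n : ℝ)) * n) = 1 by field_simp, Real.rpow_one]
  rcases le_or_gt b δ with h | h
  · refine (norm_integral_exp_I_le_length _ hb).trans ?_
    linarith
  · have hI : ∀ u v, IntervalIntegrable
        (fun z : ℝ => Complex.exp (Complex.I * ((x * z + s * z ^ n : ℝ) : ℂ))) volume u v :=
      fun u v => Continuous.intervalIntegrable (by fun_prop) _ _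
    rw [← intervalIntegral.integral_add_adjacent_intervals (hI 0 δ) (hI δ b),
      show 7 * δ = δ + 6 / δ⁻¹ by rw [div_inv_eq_mul]; ring]
    refine (norm_add_le _ _).trans (add_le_add ?_ ?_)
    · simpa using norm_integral_exp_I_le_length (fun z => x * z + s * z ^ n) hδ0.le
    · refine norm_integral_exp_I_le_of_second_deriv (hasDerivAt_phase n x s)
        (hasDerivAt_phase_deriv n x s) (by fun_prop) h.le (inv_pos.mpr hδ0) fun z hz => ?_
      have h1 : δ⁻¹ ^ 2 = s * δ ^ (n - 1 - 1) := by
        obtain ⟨q, rfl⟩ : ∃ q, n = q + 2 := ⟨n - 2, by omega⟩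
        rw [hδn, show q + 2 - 1 - 1 = q by omega, pow_add]
        field_simp
      have h2 : δ ^ (n - 1 - 1) ≤ z ^ (n - 1 - 1) := pow_le_pow_left₀ hδ0.le hz.1 _
      have h3 : (1 : ℝ) ≤ n := by exact_mod_cast (by omega : 1 ≤ n)
      have h4 : (1 : ℝ) ≤ (n - 1 : ℕ) := by exact_mod_cast (by omega : 1 ≤ n - 1)
      have h5 : 0 ≤ z ^ (n - 1 - 1) := pow_nonneg (hδ0.le.trans hz.1) _
      rw [h1]
      refine mul_le_mul_of_nonneg_left (h2.trans ?_) hs.le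
      have h6 : z ^ (n - 1 - 1) ≤ ((n - 1 : ℕ) : ℝ) * z ^ (n - 1 - 1) :=
        le_mul_of_one_le_left h5 h4
      exact h6.trans (le_mul_of_one_le_left (h5.trans h6) h3)

/-- Far out, the derivative `x + s n z^(n-1)` of the phase exceeds `2/ε` for all `|x| ≤ R`
simultaneously, and the first derivative test applies. -/
theorem norm_integral_phase_tail_le {n : ℕ} (hn : 2 ≤ n) {R ε s : ℝ} (hε : 0 < ε) (hs : 0 < s) :
    ∃ B : ℝ, 0 ≤ B ∧ ∀ x, |x| ≤ R → ∀ b b', B ≤ b → b ≤ b' →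
      ‖∫ z in b..b', Complex.exp (Complex.I * ((x * z + s * z ^ n : ℝ) : ℂ))‖ ≤ ε := by
  refine ⟨max 1 ((R + 2 / ε) / s), by positivity, fun x hx b b' hb hbb => ?_⟩
  have h1 : 1 ≤ b := (le_max_left _ _).trans hb
  have h2 : (R + 2 / ε) / s ≤ b := (le_max_right _ _).trans hb
  rw [div_le_iff₀ hs] at h2
  have h := norm_integral_exp_I_le_of_deriv_ge (hasDerivAt_phase n x s)
    (hasDerivAt_phase_deriv n x s) (by fun_prop) hbb (ρ := 2 / ε) (by positivity) ?_ ?_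
  · rwa [div_div_cancel₀ two_ne_zero] at h
  · have h3 : b ≤ n * b ^ (n - 1) := by
      have h4 : b ≤ b ^ (n - 1) := le_self_pow₀ h1 (by omega)
      have h5 : (1 : ℝ) ≤ n := by exact_mod_cast (by omega : 1 ≤ n)
      exact h4.trans (le_mul_of_one_le_left (by positivity) h5)
    have h6 := mul_le_mul_of_nonneg_left h3 hs.le
    have h7 := (abs_le.mp hx).1
    linarith
  · intro z hz
    have : 0 ≤ z := by linarith [hz.1]
    positivity

/-! ### The symbol of the heat-type equation -/

/-- The Fourier symbol `k (i z) ^ n`. -/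
def heatSymbol (n : ℕ) (k : ℝ) (z : ℝ) : ℂ := k * (Complex.I * z) ^ n

theorem continuous_heatSymbol (n : ℕ) (k : ℝ) : Continuous (heatSymbol n k) := by
  unfold heatSymbol; fun_prop

theorem heatSymbol_of_even {n : ℕ} {k : ℝ} (hk : IsHeatSign n k) (hn : Even n) (z : ℝ) :
    heatSymbol n k z = ((-(z ^ n) : ℝ) : ℂ) := by
  obtain ⟨q, hq⟩ := hn
  have hq' : n = 2 * q := by omega
  rw [heatSymbol, hk.1 q hq', mul_pow]
  nth_rewrite 1 [hq']
  rw [pow_mul, Complex.I_sq]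
  push_cast
  rw [← mul_assoc, ← pow_add, show q + 1 + q = 2 * q + 1 by ring, pow_succ, pow_mul]
  norm_num

/-- For odd `n` the power `i^n` is `±i`: the multiplier is unimodular, there is no damping, and only
oscillation makes the kernel converge. -/
theorem heatSymbol_of_odd {n : ℕ} {k : ℝ} (hk : IsHeatSign n k) (hn : Odd n) :
    ∃ σ : ℝ, (σ = 1 ∨ σ = -1) ∧ ∀ z : ℝ, heatSymbol n k z = Complex.I * ((σ * z ^ n : ℝ) : ℂ) := by
  have hk2 := hk.2 hn
  obtain ⟨q, hq⟩ := hn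
  refine ⟨k * (-1) ^ q, ?_, fun z => ?_⟩
  · rcases hk2 with h | h <;> rcases neg_one_pow_eq_or ℝ q with h' | h' <;> rw [h, h'] <;> norm_num
  · rw [heatSymbol, mul_pow]
    have : Complex.I ^ n = Complex.I * (-1) ^ q := by
      rw [hq, pow_succ, pow_mul, Complex.I_sq, mul_comm]
    rw [this]
    push_cast
    ring

theorem heatSymbol_re_nonpos {n : ℕ} {k : ℝ} (hk : IsHeatSign n k) (z : ℝ) :
    (heatSymbol n k z).re ≤ 0 := by
  rcases Nat.even_or_odd n with hn | hn
  · rw [heatSymbol_of_even hk hn, Complex.ofReal_re]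
    have := hn.pow_nonneg z
    linarith
  · obtain ⟨σ, -, h⟩ := heatSymbol_of_odd hk hn
    rw [h, Complex.re_mul_ofReal, Complex.I_re, zero_mul]

theorem norm_heatSymbol {n : ℕ} {k : ℝ} (hk : IsHeatSign n k) (z : ℝ) :
    ‖heatSymbol n k z‖ = |z| ^ n := by
  rcases Nat.even_or_odd n with hn | hn
  · rw [heatSymbol_of_even hk hn, Complex.norm_real, norm_neg, norm_pow, Real.norm_eq_abs]
  · obtain ⟨σ, hσ, h⟩ := heatSymbol_of_odd hk hn
    rw [h, norm_mul, Complex.norm_I, Complex.norm_real, norm_mul, norm_pow, Real.norm_eq_abs,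
      Real.norm_eq_abs]
    rcases hσ with h | h <;> simp [h]

theorem norm_cexp_mul_le_one {ζ : ℂ} (h : ζ.re ≤ 0) {s : ℝ} (hs : 0 ≤ s) :
    ‖Complex.exp (ζ * s)‖ ≤ 1 := by
  rw [Complex.norm_exp, Real.exp_le_one_iff, Complex.re_mul_ofReal]
  exact mul_nonpos_of_nonpos_of_nonneg h hs

/-! ### The improper integral -/

/-- The oscillating integrand of the heat kernel. -/
def kernelIntegrand (n : ℕ) (k x s z : ℝ) : ℂ :=
  Complex.exp (Complex.I * x * z + k * s * (Complex.I * z) ^ n)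

theorem continuous_kernelIntegrand (n : ℕ) (k : ℝ) :
    Continuous fun p : ℝ × ℝ × ℝ => kernelIntegrand n k p.1 p.2.1 p.2.2 := by
  unfold kernelIntegrand; fun_prop

theorem kernelIntegrand_eq (n : ℕ) (k x s z : ℝ) :
    kernelIntegrand n k x s z =
      Complex.exp (Complex.I * x * z) * Complex.exp (heatSymbol n k z * s) := by
  rw [kernelIntegrand, ← Complex.exp_add, heatSymbol]
  ring_nf

theorem intervalIntegrable_kernelIntegrand (n : ℕ) (k x s a b : ℝ) :
    IntervalIntegrable (kernelIntegrand n k x s) volume a b :=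
  ((continuous_kernelIntegrand n k).comp (by fun_prop : Continuous fun z : ℝ =>
    (x, s, z))).intervalIntegrable _ _

/-- As `k`, `x`, `s` are real, the integrand is Hermitian, which reduces the two-sided improper
integral to the half line. -/
theorem kernelIntegrand_neg (n : ℕ) (k x s z : ℝ) :
    kernelIntegrand n k x s (-z) = (starRingEnd ℂ) (kernelIntegrand n k x s z) := by
  rw [kernelIntegrand, kernelIntegrand, ← Complex.exp_conj]
  simp

theorem norm_kernelIntegrand_of_even {n : ℕ} {k : ℝ} (hk : IsHeatSign n k) (hn : Even n)
    (x s z : ℝ) : ‖kernelIntegrand n k x s z‖ = Real.exp (-(s * z ^ n)) := by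
  rw [kernelIntegrand_eq, norm_mul, heatSymbol_of_even hk hn, Complex.norm_exp, Complex.norm_exp]
  have : (Complex.I * (x : ℂ) * z).re = 0 := by simp
  rw [this, Real.exp_zero, one_mul, Complex.re_mul_ofReal, Complex.ofReal_re]
  ring_nf

/-- When the symbol is `-i z^n`, complex conjugation restores the phase with positive leading
coefficient at the price of replacing `x` by `-x`, and norms do not change. -/
theorem norm_integral_kernelIntegrand_of_odd {n : ℕ} {k : ℝ} (hk : IsHeatSign n k) (hn : Odd n)
    (x s : ℝ) : ∃ y : ℝ, |y| = |x| ∧ ∀ a b : ℝ, ‖∫ z in a..b, kernelIntegrand n k x s z‖ =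
      ‖∫ z in a..b, Complex.exp (Complex.I * ((y * z + s * z ^ n : ℝ) : ℂ))‖ := by
  obtain ⟨σ, hσ, h⟩ := heatSymbol_of_odd hk hn
  rcases hσ with rfl | rfl
  · refine ⟨x, rfl, fun a b => ?_⟩
    congr 2
    ext z
    rw [kernelIntegrand_eq, ← Complex.exp_add, h]
    congr 1
    push_cast
    ring
  · refine ⟨-x, abs_neg x, fun a b => ?_⟩
    rw [← Complex.norm_conj (∫ z in a..b, kernelIntegrand n k x s z),
      ← intervalIntegral.intervalIntegral_conj]
    congr 2
    ext z
    rw [kernelIntegrand_eq, ← Complex.exp_add, h, ← Complex.exp_conj]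
    congr 1
    simp
    ring

theorem integrableOn_exp_neg_mul_pow {n : ℕ} (hn : 2 ≤ n) {s : ℝ} (hs : 0 < s) :
    IntegrableOn (fun z : ℝ => Real.exp (-(s * z ^ n))) (Ioi 0) := by
  have h := integrableOn_rpow_mul_exp_neg_mul_rpow (p := n) (s := 0) (b := s) (by norm_num)
    (by positivity) hs
  refine h.congr_fun (fun z _ => ?_) measurableSet_Ioi
  simp

theorem integral_exp_neg_mul_pow {n : ℕ} (hn : 2 ≤ n) {s : ℝ} (hs : 0 < s) :
    ∫ z in Ioi (0 : ℝ), Real.exp (-(s * z ^ n)) =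
      s ^ (-(1 / (n : ℝ))) * Real.Gamma (1 / n + 1) := by
  have h := integral_exp_neg_mul_rpow (p := n) (b := s) (by positivity) hs
  simp only [Real.rpow_natCast] at h
  rw [neg_div] at h
  rw [← h]
  simp

theorem norm_integral_kernelIntegrand_le {n : ℕ} (hn : 2 ≤ n) {k : ℝ} (hk : IsHeatSign n k) :
    ∃ C : ℝ, 0 < C ∧ ∀ x s b : ℝ, 0 < s → 0 ≤ b →
      ‖∫ z in (0 : ℝ)..b, kernelIntegrand n k x s z‖ ≤ C * s ^ (-(1 / (n : ℝ))) := by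
  rcases Nat.even_or_odd n with he | ho
  · refine ⟨Real.Gamma (1 / n + 1), Real.Gamma_pos_of_pos (by positivity), fun x s b hs hb => ?_⟩
    rw [mul_comm, ← integral_exp_neg_mul_pow hn hs]
    refine (intervalIntegral.norm_integral_le_integral_norm hb).trans ?_
    simp only [norm_kernelIntegrand_of_even hk he]
    rw [intervalIntegral.integral_of_le hb]
    exact setIntegral_mono_set (integrableOn_exp_neg_mul_pow hn hs)
      (ae_of_all _ fun z => (Real.exp_pos _).le) (LE.le.eventuallyLE Ioc_subset_Ioi_self)
  · refine ⟨7, by norm_num, fun x s b hs hb => ?_⟩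
    obtain ⟨y, -, h⟩ := norm_integral_kernelIntegrand_of_odd hk ho x s
    rw [h]
    exact norm_integral_phase_le hn y hs hb

theorem norm_integral_kernelIntegrand_tail_le {n : ℕ} (hn : 2 ≤ n) {k : ℝ} (hk : IsHeatSign n k)
    {s : ℝ} (hs : 0 < s) (R : ℝ) {ε : ℝ} (hε : 0 < ε) :
    ∃ B : ℝ, 0 ≤ B ∧ ∀ x, |x| ≤ R → ∀ b b', B ≤ b → b ≤ b' →
      ‖∫ z in b..b', kernelIntegrand n k x s z‖ ≤ ε := by
  rcases Nat.even_or_odd n with he | ho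
  · have hint := integrableOn_exp_neg_mul_pow hn hs
    have ht := intervalIntegral_tendsto_integral_Ioi 0 hint tendsto_id
    obtain ⟨B, hB⟩ := Metric.cauchySeq_iff.mp ht.cauchySeq ε hε
    refine ⟨max 0 B, le_max_left _ _, fun x _ b b' hb hbb => ?_⟩
    have hb0 : 0 ≤ b := (le_max_left _ _).trans hb
    have hbB : B ≤ b := (le_max_right _ _).trans hb
    have hc : ∀ u v, IntervalIntegrable (fun z : ℝ => Real.exp (-(s * z ^ n))) volume u v :=
      fun u v => Continuous.intervalIntegrable (by fun_prop) _ _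
    have h := hB b' (hbB.trans hbb) b hbB
    rw [Real.dist_eq, id, id, intervalIntegral.integral_interval_sub_left (hc _ _) (hc _ _)] at h
    refine (intervalIntegral.norm_integral_le_integral_norm hbb).trans ?_
    simp only [norm_kernelIntegrand_of_even hk he]
    exact (le_abs_self _).trans h.le
  · obtain ⟨B, hB0, hB⟩ := norm_integral_phase_tail_le (R := R) hn hε hs
    refine ⟨B, hB0, fun x hx b b' hb hbb => ?_⟩
    obtain ⟨y, hy, h⟩ := norm_integral_kernelIntegrand_of_odd hk ho x s
    rw [h]
    exact hB y (hy.trans_le hx) b b' hb hbb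

/-- `∫_0^∞ exp (i x z + k s (i z)^n) dz`. -/
def halfKernel (n : ℕ) (k x s : ℝ) : ℂ :=
  limUnder atTop fun b : ℝ => ∫ z in (0 : ℝ)..b, kernelIntegrand n k x s z

theorem tendsto_halfKernel {n : ℕ} (hn : 2 ≤ n) {k : ℝ} (hk : IsHeatSign n k) (x : ℝ) {s : ℝ}
    (hs : 0 < s) :
    Tendsto (fun b : ℝ => ∫ z in (0 : ℝ)..b, kernelIntegrand n k x s z) atTop
      (𝓝 (halfKernel n k x s)) := by
  refine CauchySeq.tendsto_limUnder ?_
  refine Metric.cauchySeq_iff'.mpr fun ε hε => ?_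
  obtain ⟨B, -, hB⟩ := norm_integral_kernelIntegrand_tail_le hn hk hs |x| (half_pos hε)
  refine ⟨B, fun b hb => ?_⟩
  rw [dist_eq_norm, intervalIntegral.integral_interval_sub_left
    (intervalIntegrable_kernelIntegrand n k x s _ _)
    (intervalIntegrable_kernelIntegrand n k x s _ _)]
  exact (hB x le_rfl B b le_rfl hb).trans_lt (half_lt_self hε)

theorem truncKernel_eq (n : ℕ) (k x s a b : ℝ) :
    truncKernel n k x s (a, b) = (1 / (2 * (Real.pi : ℂ))) *
      ((starRingEnd ℂ) (∫ z in (0 : ℝ)..a, kernelIntegrand n k x s z) +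
        ∫ z in (0 : ℝ)..b, kernelIntegrand n k x s z) := by
  have h := intervalIntegral.integral_comp_neg (a := 0) (b := a) (kernelIntegrand n k x s)
  simp only [kernelIntegrand_neg, neg_zero] at h
  rw [← intervalIntegral.intervalIntegral_conj, h, intervalIntegral.integral_add_adjacent_intervals
    (intervalIntegrable_kernelIntegrand n k x s _ _)
    (intervalIntegrable_kernelIntegrand n k x s _ _)]
  rfl

theorem tendsto_truncKernel {n : ℕ} (hn : 2 ≤ n) {k : ℝ} (hk : IsHeatSign n k) (x : ℝ) {s : ℝ}
    (hs : 0 < s) :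
    Tendsto (truncKernel n k x s) (atTop ×ˢ atTop) (𝓝 ((1 / (2 * (Real.pi : ℂ))) *
      ((starRingEnd ℂ) (halfKernel n k x s) + halfKernel n k x s))) := by
  have h := tendsto_halfKernel hn hk x hs
  have h1 := (Complex.continuous_conj.tendsto _).comp (h.comp (tendsto_fst (g := atTop (α := ℝ))))
  have h2 := h.comp (tendsto_snd (f := atTop (α := ℝ)))
  refine ((h1.add h2).const_mul _).congr fun q => ?_
  exact (truncKernel_eq n k x s q.1 q.2).symm

theorem heatKernel_eq {n : ℕ} (hn : 2 ≤ n) {k : ℝ} (hk : IsHeatSign n k) (x : ℝ) {s : ℝ}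
    (hs : 0 < s) :
    heatKernel n k x s = (1 / (2 * (Real.pi : ℂ))) *
      ((starRingEnd ℂ) (halfKernel n k x s) + halfKernel n k x s) :=
  (tendsto_truncKernel hn hk x hs).limUnder_eq

theorem tendsto_truncKernel_heatKernel {n : ℕ} (hn : 2 ≤ n) {k : ℝ} (hk : IsHeatSign n k) (x : ℝ)
    {s : ℝ} (hs : 0 < s) :
    Tendsto (truncKernel n k x s) (atTop ×ˢ atTop) (𝓝 (heatKernel n k x s)) := by
  rw [heatKernel_eq hn hk x hs]
  exact tendsto_truncKernel hn hk x hs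

theorem continuous_truncKernel (n : ℕ) (k a b : ℝ) :
    Continuous fun p : ℝ × ℝ => truncKernel n k p.1 p.2 (a, b) := by
  unfold truncKernel
  refine continuous_const.mul
    (intervalIntegral.continuous_parametric_intervalIntegral_of_continuous' ?_ _ _)
  fun_prop

theorem norm_truncKernel_le {n : ℕ} (hn : 2 ≤ n) {k : ℝ} (hk : IsHeatSign n k) :
    ∃ C : ℝ, 0 < C ∧ ∀ x s a b : ℝ, 0 < s → 0 ≤ a → 0 ≤ b →
      ‖truncKernel n k x s (a, b)‖ ≤ C * s ^ (-(1 / (n : ℝ))) := by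
  obtain ⟨C, hC, h⟩ := norm_integral_kernelIntegrand_le hn hk
  refine ⟨C, hC, fun x s a b hs ha hb => ?_⟩
  rw [truncKernel_eq, norm_mul]
  have h1 : ‖(1 / (2 * (Real.pi : ℂ)))‖ ≤ 1 / 2 := by
    rw [norm_div, norm_one, norm_mul, Complex.norm_two, Complex.norm_real, Real.norm_eq_abs,
      abs_of_pos Real.pi_pos]
    have := Real.pi_gt_three
    gcongr
    linarith
  have h2 : ‖(starRingEnd ℂ) (∫ z in (0 : ℝ)..a, kernelIntegrand n k x s z) +
      ∫ z in (0 : ℝ)..b, kernelIntegrand n k x s z‖ ≤ 2 * (C * s ^ (-(1 / (n : ℝ)))) := by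
    refine (norm_add_le _ _).trans ?_
    rw [Complex.norm_conj, two_mul]
    exact add_le_add (h x s a hs ha) (h x s b hs hb)
  calc _ ≤ 1 / 2 * (2 * (C * s ^ (-(1 / (n : ℝ))))) := by gcongr
    _ = _ := by ring

/-- The truncations obey this bound uniformly, so it passes to the limit. Its exponent exceeds `-1`,
so it is integrable against the law of the random time. -/
theorem norm_heatKernel_le {n : ℕ} (hn : 2 ≤ n) {k : ℝ} (hk : IsHeatSign n k) :
    ∃ C : ℝ, 0 < C ∧ ∀ x s : ℝ, 0 < s → ‖heatKernel n k x s‖ ≤ C * s ^ (-(1 / (n : ℝ))) := by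
  obtain ⟨C, hC, h⟩ := norm_truncKernel_le hn hk
  refine ⟨C, hC, fun x s hs => ?_⟩
  refine le_of_tendsto (tendsto_truncKernel_heatKernel hn hk x hs).norm ?_
  filter_upwards [prod_mem_prod (Ici_mem_atTop (0 : ℝ)) (Ici_mem_atTop (0 : ℝ))] with q hq
  exact h x s q.1 q.2 hs hq.1 hq.2

/-- The tails are small uniformly for bounded `x`, so the half kernel is a locally uniform limit of
continuous truncations. -/
theorem continuous_halfKernel {n : ℕ} (hn : 2 ≤ n) {k : ℝ} (hk : IsHeatSign n k) {s : ℝ}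
    (hs : 0 < s) : Continuous fun x => halfKernel n k x s := by
  refine continuous_of_locally_uniform_approx_of_continuousAt fun x u hu => ?_
  obtain ⟨ε, hε, hu⟩ := Metric.mem_uniformity_dist.mp hu
  obtain ⟨B, hB0, hB⟩ := norm_integral_kernelIntegrand_tail_le hn hk hs (|x| + 1) (half_pos hε)
  refine ⟨Metric.ball x 1, Metric.ball_mem_nhds x one_pos,
    fun y => ∫ z in (0 : ℝ)..B, kernelIntegrand n k y s z, Continuous.continuousAt ?_, fun y hy => hu ?_⟩
  · refine intervalIntegral.continuous_parametric_intervalIntegral_of_continuous' ?_ _ _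
    exact (continuous_kernelIntegrand n k).comp (by fun_prop : Continuous fun p : ℝ × ℝ =>
      (p.1, s, p.2))
  · have hy' : |y| ≤ |x| + 1 := by
      have h1 : |y - x| < 1 := by rwa [Metric.mem_ball, Real.dist_eq] at hy
      have h2 := abs_sub_abs_le_abs_sub y x
      linarith
    refine lt_of_le_of_lt ?_ (half_lt_self hε)
    refine le_of_tendsto ((tendsto_halfKernel hn hk y hs).dist tendsto_const_nhds) ?_
    filter_upwards [Ici_mem_atTop B] with b hb
    rw [dist_eq_norm, intervalIntegral.integral_interval_sub_left
      (intervalIntegrable_kernelIntegrand n k y s _ _)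
      (intervalIntegrable_kernelIntegrand n k y s _ _)]
    exact hB y hy' B b le_rfl hb

theorem continuous_heatKernel {n : ℕ} (hn : 2 ≤ n) {k : ℝ} (hk : IsHeatSign n k) {s : ℝ}
    (hs : 0 < s) : Continuous fun x => heatKernel n k x s := by
  simp only [heatKernel_eq hn hk _ hs]
  have h := continuous_halfKernel hn hk hs
  exact continuous_const.mul ((Complex.continuous_conj.comp h).add h)

theorem tendsto_truncKernel_natCast {n : ℕ} (hn : 2 ≤ n) {k : ℝ} (hk : IsHeatSign n k) (x : ℝ)
    {s : ℝ} (hs : 0 < s) :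
    Tendsto (fun N : ℕ => truncKernel n k x s ((N : ℝ), (N : ℝ))) atTop
      (𝓝 (heatKernel n k x s)) :=
  (tendsto_truncKernel_heatKernel hn hk x hs).comp
    (tendsto_natCast_atTop_atTop.prodMk tendsto_natCast_atTop_atTop)

open Classical in
/-- The heat kernel, extended by zero to nonpositive times. -/
def posKernel (n : ℕ) (k x s : ℝ) : ℂ := if 0 < s then heatKernel n k x s else 0

theorem posKernel_of_pos (n : ℕ) (k x : ℝ) {s : ℝ} (hs : 0 < s) :
    posKernel n k x s = heatKernel n k x s := if_pos hs

theorem measurable_posKernel {n : ℕ} (hn : 2 ≤ n) {k : ℝ} (hk : IsHeatSign n k) :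
    Measurable fun p : ℝ × ℝ => posKernel n k p.1 p.2 := by
  classical
  refine measurable_of_tendsto_metrizable
    (f := fun (N : ℕ) (p : ℝ × ℝ) =>
      if 0 < p.2 then truncKernel n k p.1 p.2 ((N : ℝ), (N : ℝ)) else 0) (fun N => ?_) ?_
  · exact Measurable.ite (measurableSet_lt measurable_const measurable_snd)
      (continuous_truncKernel n k N N).measurable measurable_const
  · refine tendsto_pi_nhds.mpr fun p => ?_
    by_cases hp : 0 < p.2
    · simp only [if_pos hp, posKernel]
      exact tendsto_truncKernel_natCast hn hk p.1 hp
    · simp only [if_neg hp, posKernel]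
      exact tendsto_const_nhds

/-! ### Pairing with Schwartz functions -/

/-- The Fourier transform in the normalization `Φ(z) = ∫ exp (i x z) φ(x) dx`. -/
def phaseTransform (φ : ℝ → ℂ) (z : ℝ) : ℂ := ∫ x : ℝ, Complex.exp (Complex.I * x * z) * φ x

open FourierTransform in
theorem phaseTransform_eq (φ : ℝ → ℂ) (z : ℝ) :
    phaseTransform φ z = 𝓕 φ (-(1 / (2 * Real.pi)) * z) := by
  rw [phaseTransform, Real.fourier_real_eq_integral_exp_smul]
  congr 1
  ext x
  rw [smul_eq_mul]
  congr 2
  have : (Real.pi : ℂ) ≠ 0 := by exact_mod_cast Real.pi_ne_zero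
  push_cast
  field_simp

open FourierTransform in
/-- The transform `phaseTransform φ` as a Schwartz function. -/
def phaseSchwartz (φ : SchwartzMap ℝ ℂ) : SchwartzMap ℝ ℂ :=
  SchwartzMap.compCLMOfContinuousLinearEquiv ℂ
    (ContinuousLinearEquiv.unitsEquivAut ℝ
      (Units.mk0 (-(1 / (2 * Real.pi))) (by simp [Real.pi_ne_zero]))) (𝓕 φ)

open FourierTransform in
theorem phaseSchwartz_apply (φ : SchwartzMap ℝ ℂ) (z : ℝ) :
    phaseSchwartz φ z = phaseTransform φ z := by
  rw [phaseTransform_eq, ← SchwartzMap.fourier_coe]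
  simp [phaseSchwartz, mul_comm]

theorem integrable_pow_mul_phaseTransform (φ : SchwartzMap ℝ ℂ) (j : ℕ) :
    Integrable fun z : ℝ => |z| ^ j * ‖phaseTransform φ z‖ := by
  have h := (phaseSchwartz φ).integrable_pow_mul volume j
  simpa only [phaseSchwartz_apply, Real.norm_eq_abs] using h

theorem continuous_phaseTransform (φ : SchwartzMap ℝ ℂ) : Continuous (phaseTransform φ) := by
  have h : ⇑(phaseSchwartz φ) = phaseTransform φ := funext (phaseSchwartz_apply φ)
  exact h ▸ (phaseSchwartz φ).continuous

theorem integrable_phaseTransform (φ : SchwartzMap ℝ ℂ) : Integrable (phaseTransform φ) := by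
  have h : ⇑(phaseSchwartz φ) = phaseTransform φ := funext (phaseSchwartz_apply φ)
  exact h ▸ (phaseSchwartz φ).integrable

/-- Fubini needs the cut-off in `z`: for odd symbols the integrand has modulus `|φ(x)|` at every
frequency, so the full double integral is not absolutely convergent. -/
theorem integral_truncKernel_mul (n : ℕ) (k : ℝ) {φ : ℝ → ℂ} (hφ : Integrable φ) (s : ℝ)
    {N : ℝ} (hN : 0 ≤ N) :
    ∫ x, truncKernel n k x s (N, N) * φ x = (1 / (2 * (Real.pi : ℂ))) *
      ∫ z in (-N)..N, Complex.exp (heatSymbol n k z * s) * phaseTransform φ z := by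
  have hNN : -N ≤ N := by linarith
  have hint : Integrable (Function.uncurry fun (x z : ℝ) => kernelIntegrand n k x s z * φ x)
      (volume.prod (volume.restrict (Ioc (-N) N))) := by
    have h1 : Integrable (fun p : ℝ × ℝ => φ p.1 * Complex.exp (heatSymbol n k p.2 * s))
        (volume.prod (volume.restrict (Ioc (-N) N))) := by
      refine Integrable.mul_prod (f := φ)
        (g := fun z : ℝ => Complex.exp (heatSymbol n k z * s)) hφ ?_
      have := continuous_heatSymbol n k
      exact (Continuous.integrableOn_Ioc (by fun_prop))
    have h2 : Continuous fun p : ℝ × ℝ => Complex.exp (Complex.I * p.1 * p.2) := by fun_prop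
    refine (h1.bdd_mul (c := 1) h2.aestronglyMeasurable (ae_of_all _ fun p => ?_)).congr
      (ae_of_all _ fun p => ?_)
    · rw [Complex.norm_exp]
      simp
    · simp only [Function.uncurry, kernelIntegrand_eq]
      ring
  calc ∫ x, truncKernel n k x s (N, N) * φ x
      = ∫ x, (1 / (2 * (Real.pi : ℂ))) *
          ∫ z in Ioc (-N) N, kernelIntegrand n k x s z * φ x := by
        congr 1
        ext x
        rw [integral_mul_const, ← intervalIntegral.integral_of_le hNN, ← mul_assoc]
        rfl
    _ = (1 / (2 * (Real.pi : ℂ))) *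
          ∫ z in Ioc (-N) N, ∫ x, kernelIntegrand n k x s z * φ x := by
        rw [integral_const_mul, integral_integral_swap hint]
    _ = _ := by
        rw [intervalIntegral.integral_of_le hNN]
        congr 2
        ext z
        rw [phaseTransform, ← integral_const_mul]
        congr 1
        ext x
        rw [kernelIntegrand_eq]
        ring

/-- The transition function acts as the Fourier multiplier `exp (k (i z)^n s)`. -/
theorem integral_heatKernel_mul {n : ℕ} (hn : 2 ≤ n) {k : ℝ} (hk : IsHeatSign n k)
    (φ : SchwartzMap ℝ ℂ) {s : ℝ} (hs : 0 < s) :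
    ∫ x, heatKernel n k x s * φ x = (1 / (2 * (Real.pi : ℂ))) *
      ∫ z, Complex.exp (heatSymbol n k z * s) * phaseTransform φ z := by
  obtain ⟨C, hC, hb⟩ := norm_truncKernel_le hn hk
  have h1 : Tendsto (fun N : ℕ => ∫ x, truncKernel n k x s ((N : ℝ), (N : ℝ)) * φ x) atTop
      (𝓝 (∫ x, heatKernel n k x s * φ x)) := by
    refine tendsto_integral_of_dominated_convergence
      (fun x => C * s ^ (-(1 / (n : ℝ))) * ‖φ x‖) (fun N => ?_)
      (φ.integrable.norm.const_mul _) (fun N => ae_of_all _ fun x => ?_)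
      (ae_of_all _ fun x => (tendsto_truncKernel_natCast hn hk x hs).mul_const _)
    · have h := (continuous_truncKernel n k N N).comp (by fun_prop : Continuous fun x : ℝ => (x, s))
      exact (h.mul φ.continuous).aestronglyMeasurable
    · rw [norm_mul]
      exact mul_le_mul_of_nonneg_right (hb x s N N hs (Nat.cast_nonneg N) (Nat.cast_nonneg N))
        (norm_nonneg _)
  have hint : Integrable fun z : ℝ => Complex.exp (heatSymbol n k z * s) * phaseTransform φ z := by
    have := continuous_heatSymbol n k
    exact (integrable_phaseTransform φ).bdd_mul (c := 1)
      (Continuous.aestronglyMeasurable (by fun_prop))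
      (ae_of_all _ fun z => norm_cexp_mul_le_one (heatSymbol_re_nonpos hk z) hs.le)
  have h2 := (intervalIntegral_tendsto_integral hint
    (tendsto_neg_atTop_atBot.comp tendsto_natCast_atTop_atTop) tendsto_natCast_atTop_atTop).const_mul
    (1 / (2 * (Real.pi : ℂ)))
  refine tendsto_nhds_unique h1 (h2.congr fun N => ?_)
  exact (integral_truncKernel_mul n k φ.integrable s (Nat.cast_nonneg N)).symm

/-! ### Caputo derivative of the Mittag-Leffler function -/

theorem integral_rpow_mul_sub_rpow {a b t : ℝ} (ha : 0 < a) (hb : 0 < b) (ht : 0 < t) :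
    IntervalIntegrable (fun z => z ^ (a - 1) * (t - z) ^ (b - 1)) volume 0 t ∧
    ∫ z in (0 : ℝ)..t, z ^ (a - 1) * (t - z) ^ (b - 1) =
      t ^ (a + b - 1) * (Real.Gamma a * Real.Gamma b / Real.Gamma (a + b)) := by
  have hG : 0 < Real.Gamma (a + b) := Real.Gamma_pos_of_pos (by linarith)
  have hval : ∫ z in (0 : ℝ)..t, z ^ (a - 1) * (t - z) ^ (b - 1) =
      t ^ (a + b - 1) * (Real.Gamma a * Real.Gamma b / Real.Gamma (a + b)) := by
    have h := Complex.betaIntegral_scaled a b ht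
    have hB := Complex.Gamma_mul_Gamma_eq_betaIntegral (s := a) (t := b) (by simpa) (by simpa)
    have hB' : Complex.betaIntegral a b =
        ((Real.Gamma a * Real.Gamma b / Real.Gamma (a + b) : ℝ) : ℂ) := by
      rw [← Complex.ofReal_add, Complex.Gamma_ofReal, Complex.Gamma_ofReal,
        Complex.Gamma_ofReal] at hB
      have : (Real.Gamma (a + b) : ℂ) ≠ 0 := by exact_mod_cast hG.ne'
      push_cast
      rw [hB]
      field_simp
    rw [hB'] at h
    apply Complex.ofReal_injective
    rw [← intervalIntegral.integral_ofReal]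
    refine Eq.trans ?_ (h.trans ?_)
    · refine intervalIntegral.integral_congr fun z hz => ?_
      rw [uIcc_of_le ht.le] at hz
      rw [Complex.ofReal_mul, Complex.ofReal_cpow hz.1, Complex.ofReal_cpow (sub_nonneg.mpr hz.2)]
      push_cast
      rfl
    · rw [Complex.ofReal_mul, Complex.ofReal_cpow ht.le]
      push_cast
      rfl
  refine ⟨?_, hval⟩
  rw [intervalIntegrable_iff_integrableOn_Ioc_of_le ht.le]
  -- A nonintegrable function has Bochner integral `0`, so the positive value just computed already
  -- proves integrability.
  refine Integrable.of_integral_ne_zero ?_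
  rw [← intervalIntegral.integral_of_le ht.le, hval]
  have := Real.Gamma_pos_of_pos ha
  have := Real.Gamma_pos_of_pos hb
  positivity

/-- The random time at `t = 1` represents the Mittag-Leffler function as a moment generating
function. Differentiability, and bounds for the function and its derivative on `Re z ≤ 0`, then
follow without asymptotics of the series. -/
theorem mittagLeffler_eq_integral {m : ℕ} (hm : 2 < m) (z : ℂ) :
    mittagLeffler m z = ∫ s, Complex.exp (z * s) ∂productLaw m 1 := by
  rw [integral_cexp_productLaw hm one_pos z, Real.one_rpow, Complex.ofReal_one, mul_one]

/-- The derivative of the Mittag-Leffler function. -/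
def mittagLefflerDeriv (m : ℕ) (z : ℂ) : ℂ :=
  ∫ s, (s : ℂ) * Complex.exp (z * s) ∂productLaw m 1

theorem hasDerivAt_mittagLeffler {m : ℕ} (hm : 2 < m) (z : ℂ) :
    HasDerivAt (mittagLeffler m) (mittagLefflerDeriv m z) z := by
  have h1 : mittagLeffler m = complexMGF id (productLaw m 1) := by
    ext z
    rw [mittagLeffler_eq_integral hm]
    rfl
  have h2 : integrableExpSet id (productLaw m 1) = univ := by
    ext a
    simpa [integrableExpSet] using integrable_exp_productLaw hm one_pos a
  rw [h1]
  exact hasDerivAt_complexMGF (by rw [h2, interior_univ]; trivial)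

theorem continuous_mittagLeffler {m : ℕ} (hm : 2 < m) : Continuous (mittagLeffler m) :=
  continuous_iff_continuousAt.mpr fun z => (hasDerivAt_mittagLeffler hm z).continuousAt

theorem continuous_mittagLefflerDeriv {m : ℕ} (hm : 2 < m) :
    Continuous (mittagLefflerDeriv m) := by
  have hd : Differentiable ℂ (mittagLeffler m) := fun z =>
    (hasDerivAt_mittagLeffler hm z).differentiableAt
  have : mittagLefflerDeriv m = deriv (mittagLeffler m) := by
    ext z
    rw [(hasDerivAt_mittagLeffler hm z).deriv]
  rw [this]
  exact (hd.contDiff (n := 1)).continuous_deriv le_rfl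

theorem mittagLeffler_zero {m : ℕ} (hm : 2 < m) : mittagLeffler m 0 = 1 := by
  have := isProbabilityMeasure_productLaw hm one_pos
  rw [mittagLeffler_eq_integral hm]
  simp

theorem norm_mittagLeffler_le_one {m : ℕ} (hm : 2 < m) {z : ℂ} (hz : z.re ≤ 0) :
    ‖mittagLeffler m z‖ ≤ 1 := by
  have := isProbabilityMeasure_productLaw hm one_pos
  rw [mittagLeffler_eq_integral hm]
  refine (norm_integral_le_of_norm_le (integrable_const (1 : ℝ)) ?_).trans (by simp)
  filter_upwards [ae_pos_productLaw hm one_pos] with s hs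
  exact norm_cexp_mul_le_one hz hs.le

theorem norm_mittagLefflerDeriv_le {m : ℕ} (hm : 2 < m) {z : ℂ} (hz : z.re ≤ 0) :
    ‖mittagLefflerDeriv m z‖ ≤ ∫ s, s ∂productLaw m 1 := by
  have hint := (integral_pow_productLaw hm one_pos 1).1
  simp only [pow_one] at hint
  refine norm_integral_le_of_norm_le hint ?_
  filter_upwards [ae_pos_productLaw hm one_pos] with s hs
  rw [norm_mul, Complex.norm_real, Real.norm_eq_abs, abs_of_pos hs]
  exact mul_le_of_le_one_right hs.le (norm_cexp_mul_le_one hz hs.le)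

theorem mittagLefflerDeriv_eq_tsum {m : ℕ} (hm : 2 < m) (z : ℂ) :
    mittagLefflerDeriv m z =
      ∑' r : ℕ, ((r : ℂ) + 1) * z ^ r / (Real.Gamma (((r + 1 : ℕ) : ℝ) / m + 1) : ℂ) := by
  have hpos := ae_pos_productLaw hm one_pos
  have hmom := fun r => integral_pow_productLaw hm one_pos (r + 1)
  have hn : ∀ r : ℕ, (fun s : ℝ => ‖z ^ r / (r.factorial : ℂ) * (s : ℂ) ^ (r + 1)‖)
      =ᵐ[productLaw m 1] fun s => ‖z‖ ^ r / r.factorial * s ^ (r + 1) := fun r => by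
    filter_upwards [hpos] with s hs
    simp [abs_of_pos hs]
  have hI : ∀ r : ℕ, Integrable (fun s : ℝ => z ^ r / (r.factorial : ℂ) * (s : ℂ) ^ (r + 1))
      (productLaw m 1) := fun r => by
    refine Integrable.const_mul ?_ _
    simpa using (hmom r).1.ofReal (𝕜 := ℂ)
  have hS : Summable fun r : ℕ =>
      ∫ s : ℝ, ‖z ^ r / (r.factorial : ℂ) * (s : ℂ) ^ (r + 1)‖ ∂productLaw m 1 := by
    -- The factor `r + 1` produced by differentiation is absorbed into `2^(r+1)`, so the
    -- Mittag-Leffler series at `2 (‖z‖ + 1)` dominates.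
    have h := (summable_nat_add_iff 1).mpr
      (summable_pow_div_Gamma (m := m) (by omega) (a := 2 * (‖z‖ + 1)) (by positivity))
    refine Summable.of_nonneg_of_le (fun r => integral_nonneg fun s => norm_nonneg _)
      (fun r => ?_) h
    rw [integral_congr_ae (hn r), integral_const_mul, (hmom r).2, Real.one_rpow, one_mul,
      mul_div_assoc']
    have hG : 0 < Real.Gamma (((r + 1 : ℕ) : ℝ) / m + 1) := Real.Gamma_pos_of_pos (by positivity)
    refine div_le_div_of_nonneg_right ?_ hG.le
    rw [Nat.factorial_succ, Nat.cast_mul, mul_pow]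
    have hf : (0 : ℝ) < r.factorial := by positivity
    have h1 : ((r + 1 : ℕ) : ℝ) ≤ 2 ^ (r + 1) := by exact_mod_cast Nat.lt_two_pow_self.le
    have h2 : ‖z‖ ^ r ≤ (‖z‖ + 1) ^ (r + 1) := by
      calc ‖z‖ ^ r ≤ (‖z‖ + 1) ^ r := by gcongr; linarith
        _ ≤ (‖z‖ + 1) ^ (r + 1) := pow_le_pow_right₀ (by linarith [norm_nonneg z]) (Nat.le_succ r)
    calc ‖z‖ ^ r / r.factorial * (((r + 1 : ℕ) : ℝ) * r.factorial)
        = ((r + 1 : ℕ) : ℝ) * ‖z‖ ^ r := by field_simp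
      _ ≤ _ := by gcongr
  have h := integral_tsum_of_summable_integral_norm hI hS
  have e : ∀ s : ℝ, ∑' r : ℕ, z ^ r / (r.factorial : ℂ) * (s : ℂ) ^ (r + 1) =
      (s : ℂ) * Complex.exp (z * s) := by
    intro s
    have hsum := NormedSpace.expSeries_div_hasSum_exp (z * (s : ℂ))
    rw [← Complex.exp_eq_exp_ℂ] at hsum
    rw [← (hsum.mul_left (s : ℂ)).tsum_eq]
    congr 1; ext r
    rw [mul_pow]; ring
  simp_rw [e] at h
  rw [mittagLefflerDeriv, ← h]
  congr 1; ext r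
  rw [integral_const_mul]
  have : ∫ s : ℝ, (s : ℂ) ^ (r + 1) ∂productLaw m 1 =
      ((∫ s, s ^ (r + 1) ∂productLaw m 1 : ℝ) : ℂ) := by
    rw [← integral_complex_ofReal]
    simp
  rw [this, (hmom r).2, Real.one_rpow, one_mul, Nat.factorial_succ]
  have : (r.factorial : ℂ) ≠ 0 := by exact_mod_cast r.factorial_ne_zero
  push_cast
  field_simp

/-- The fractional relaxation equation, in integrated form. -/
theorem integral_mittagLefflerDeriv {m : ℕ} (hm : 2 < m) (ζ : ℂ) {t : ℝ} (ht : 0 < t) :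
    ∫ z in (0 : ℝ)..t, ζ * ((1 / (m : ℝ) * z ^ (1 / (m : ℝ) - 1) : ℝ) : ℂ) *
        mittagLefflerDeriv m (ζ * ((z ^ (1 / (m : ℝ)) : ℝ) : ℂ)) *
        (((t - z) ^ (-(1 / (m : ℝ))) : ℝ) : ℂ) =
      (Real.Gamma (1 - 1 / m) : ℂ) * (ζ * mittagLeffler m (ζ * ((t ^ (1 / (m : ℝ)) : ℝ) : ℂ))) := by
  have hm0 : (0 : ℝ) < m := by positivity
  set α : ℝ := 1 / (m : ℝ) with hα
  have hα0 : 0 < α := by positivity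
  have hα1 : α < 1 := by
    rw [hα, div_lt_one hm0]
    exact_mod_cast (by omega : 1 < m)
  have hr1 : ∀ r : ℕ, (0 : ℝ) < ((r + 1 : ℕ) : ℝ) / m := fun r => by positivity
  -- Differentiating term `r + 1` of the series in time leaves `z^((r+1)/m - 1)`; its beta integral
  -- against `(t - z)^(-α)` is a multiple of `t^(r/m)`, which gives back term `r`.
  let b : ℕ → ℝ → ℝ := fun r z =>
    z ^ (((r + 1 : ℕ) : ℝ) / m - 1) * (t - z) ^ (1 - α - 1)
  have hb := fun r => integral_rpow_mul_sub_rpow (hr1 r) (sub_pos.mpr hα1) ht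
  have hG : ∀ r : ℕ, 0 < Real.Gamma (((r + 1 : ℕ) : ℝ) / m) := fun r =>
    Real.Gamma_pos_of_pos (hr1 r)
  have hGs : ∀ r : ℕ, 0 < Real.Gamma ((r : ℝ) / m + 1) := fun r =>
    Real.Gamma_pos_of_pos (by positivity)
  have hval : ∀ r : ℕ, ∫ z in Ioc 0 t, b r z =
      (t ^ α) ^ r * (Real.Gamma (((r + 1 : ℕ) : ℝ) / m) * Real.Gamma (1 - α) /
        Real.Gamma ((r : ℝ) / m + 1)) := fun r => by
    rw [← intervalIntegral.integral_of_le ht.le, (hb r).2, ← Real.rpow_natCast, ← Real.rpow_mul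
      ht.le]
    congr 2
    · rw [hα]; push_cast; ring
    · congr 1
      rw [hα]; push_cast; ring
  have hbi : ∀ r : ℕ, Integrable (b r) (volume.restrict (Ioc 0 t)) := fun r =>
    (intervalIntegrable_iff_integrableOn_Ioc_of_le ht.le).mp (hb r).1
  let F : ℕ → ℝ → ℂ := fun r z =>
    ζ ^ (r + 1) / (Real.Gamma (((r + 1 : ℕ) : ℝ) / m) : ℂ) * ((b r z : ℝ) : ℂ)
  have hF : ∀ r, Integrable (F r) (volume.restrict (Ioc 0 t)) := fun r =>
    ((hbi r).ofReal (𝕜 := ℂ)).const_mul _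
  have hFn : ∀ r, ∫ z in Ioc 0 t, ‖F r z‖ =
      ‖ζ‖ * Real.Gamma (1 - α) * ((‖ζ‖ * t ^ α) ^ r / Real.Gamma ((r : ℝ) / m + 1)) := fun r => by
    have : ∀ z ∈ Ioc 0 t, ‖F r z‖ =
        ‖ζ‖ ^ (r + 1) / Real.Gamma (((r + 1 : ℕ) : ℝ) / m) * b r z := fun z hz => by
      have h1 : 0 ≤ b r z := mul_nonneg (Real.rpow_nonneg hz.1.le _)
        (Real.rpow_nonneg (sub_nonneg.mpr hz.2) _)
      simp only [F]
      rw [norm_mul, norm_div, norm_pow, Complex.norm_real, Complex.norm_real, Real.norm_eq_abs,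
        Real.norm_eq_abs, abs_of_pos (hG r), abs_of_nonneg h1]
    rw [setIntegral_congr_fun measurableSet_Ioc this, integral_const_mul, hval, mul_pow, pow_succ]
    have := (hG r).ne'
    have := (hGs r).ne'
    field_simp
  have hS : Summable fun r => ∫ z in Ioc 0 t, ‖F r z‖ := by
    simp_rw [hFn]
    exact (summable_pow_div_Gamma (by omega) (by positivity)).mul_left _
  have hmain := integral_tsum_of_summable_integral_norm hF hS
  rw [intervalIntegral.integral_of_le ht.le]
  refine Eq.trans ?_ (hmain.symm.trans ?_)
  · refine setIntegral_congr_fun measurableSet_Ioc fun z hz => ?_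
    have hz0 : 0 < z := hz.1
    rw [mittagLefflerDeriv_eq_tsum hm, ← tsum_mul_left, ← tsum_mul_right]
    congr 1
    ext r
    simp only [F, b]
    have e1 : z ^ (((r + 1 : ℕ) : ℝ) / m - 1) = z ^ (α - 1) * (z ^ α) ^ r := by
      rw [← Real.rpow_natCast (z ^ α), ← Real.rpow_mul hz0.le, ← Real.rpow_add hz0]
      congr 1
      rw [hα]; push_cast; ring
    have e2 : Real.Gamma (((r + 1 : ℕ) : ℝ) / m + 1) =
        ((r + 1 : ℕ) : ℝ) / m * Real.Gamma (((r + 1 : ℕ) : ℝ) / m) :=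
      Real.Gamma_add_one (hr1 r).ne'
    have e3 : (Real.Gamma (((r + 1 : ℕ) : ℝ) / m) : ℂ) ≠ 0 := by exact_mod_cast (hG r).ne'
    have e4 : (m : ℂ) ≠ 0 := by exact_mod_cast hm0.ne'
    have e5 : ((r : ℂ) + 1) ≠ 0 := by exact_mod_cast Nat.succ_ne_zero r
    rw [e1, e2, show 1 - α - 1 = -α by ring, hα]
    push_cast at e3 ⊢
    field_simp
    ring
  · rw [mittagLeffler, ← tsum_mul_left, ← tsum_mul_left]
    congr 1
    ext r
    simp only [F]
    rw [integral_const_mul, integral_complex_ofReal, hval, mul_pow, pow_succ]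
    have e3 : (Real.Gamma (((r + 1 : ℕ) : ℝ) / m) : ℂ) ≠ 0 := by exact_mod_cast (hG r).ne'
    have e4 : (Real.Gamma ((r : ℝ) / m + 1) : ℂ) ≠ 0 := by exact_mod_cast (hGs r).ne'
    push_cast at e3 e4 ⊢
    field_simp

/-! ### Existence of the solution -/

/-- The mean of the heat kernel over the law of the random time. -/
def meanKernel (m n : ℕ) (k x t : ℝ) : ℂ := ∫ s, posKernel n k x s ∂productLaw m t

theorem neg_one_lt_neg_one_div {n : ℕ} (hn : 2 ≤ n) : -1 < -(1 / (n : ℝ)) := by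
  have : (1 : ℝ) < n := by exact_mod_cast (by omega : 1 < n)
  rw [neg_lt_neg_iff, div_lt_one (by linarith)]
  exact this

theorem aestronglyMeasurable_posKernel {n : ℕ} (hn : 2 ≤ n) {k : ℝ} (hk : IsHeatSign n k) (x : ℝ)
    (ρ : Measure ℝ) : AEStronglyMeasurable (fun s => posKernel n k x s) ρ :=
  ((measurable_posKernel hn hk).comp measurable_prodMk_left).aestronglyMeasurable

theorem integrable_posKernel {m n : ℕ} (hm : 2 < m) (hn : 2 ≤ n) {k : ℝ} (hk : IsHeatSign n k)
    (x : ℝ) {t : ℝ} (ht : 0 < t) :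
    Integrable (fun s => posKernel n k x s) (productLaw m t) := by
  obtain ⟨C, hC, hb⟩ := norm_heatKernel_le hn hk
  refine ((integral_rpow_productLaw hm ht (neg_one_lt_neg_one_div hn)).1.const_mul C).mono'
    (aestronglyMeasurable_posKernel hn hk x _) ?_
  filter_upwards [ae_pos_productLaw hm ht] with s hs
  rw [posKernel_of_pos n k x hs]
  exact hb x s hs

theorem norm_meanKernel_le {m n : ℕ} (hm : 2 < m) (hn : 2 ≤ n) {k : ℝ} (hk : IsHeatSign n k) :
    ∃ C : ℝ, ∀ x t : ℝ, 0 < t → ‖meanKernel m n k x t‖ ≤ C * t ^ (-(1 / (n : ℝ)) / m) := by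
  obtain ⟨C, hC, hb⟩ := norm_heatKernel_le hn hk
  refine ⟨C * momentConst m (-(1 / (n : ℝ))), fun x t ht => ?_⟩
  have h := integral_rpow_productLaw hm ht (neg_one_lt_neg_one_div hn)
  refine (norm_integral_le_of_norm_le (h.1.const_mul C) ?_).trans (le_of_eq ?_)
  · filter_upwards [ae_pos_productLaw hm ht] with s hs
    rw [posKernel_of_pos n k x hs]
    exact hb x s hs
  · rw [integral_const_mul, h.2]
    ring

theorem continuous_meanKernel {m n : ℕ} (hm : 2 < m) (hn : 2 ≤ n) {k : ℝ} (hk : IsHeatSign n k)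
    {t : ℝ} (ht : 0 < t) : Continuous fun x => meanKernel m n k x t := by
  obtain ⟨C, hC, hb⟩ := norm_heatKernel_le hn hk
  refine continuous_of_dominated (bound := fun s => C * s ^ (-(1 / (n : ℝ))))
    (fun x => aestronglyMeasurable_posKernel hn hk x _) (fun x => ?_)
    ((integral_rpow_productLaw hm ht (neg_one_lt_neg_one_div hn)).1.const_mul C) ?_
  · filter_upwards [ae_pos_productLaw hm ht] with s hs
    rw [posKernel_of_pos n k x hs]
    exact hb x s hs
  · filter_upwards [ae_pos_productLaw hm ht] with s hs
    simpa only [posKernel_of_pos n k _ hs] using continuous_heatKernel hn hk hs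

theorem integrable_posKernel_mul {m n : ℕ} (hm : 2 < m) (hn : 2 ≤ n) {k : ℝ}
    (hk : IsHeatSign n k) {t : ℝ} (ht : 0 < t) {f : ℝ → ℂ} (hf : Integrable f) :
    Integrable (Function.uncurry fun x s => f x * posKernel n k x s)
      (volume.prod (productLaw m t)) := by
  have := isProbabilityMeasure_productLaw hm ht
  obtain ⟨C, hC, hb⟩ := norm_heatKernel_le hn hk
  have h := hf.norm.mul_prod
    ((integral_rpow_productLaw hm ht (neg_one_lt_neg_one_div hn)).1.const_mul C)
  refine h.mono' (hf.aestronglyMeasurable.comp_fst.mul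
    (measurable_posKernel hn hk).aestronglyMeasurable) ?_
  have hpos : ∀ᵐ p : ℝ × ℝ ∂volume.prod (productLaw m t), 0 < p.2 :=
    Measure.quasiMeasurePreserving_snd.ae (ae_pos_productLaw hm ht)
  filter_upwards [hpos] with p hp
  rw [Function.uncurry, norm_mul, posKernel_of_pos n k _ hp]
  exact mul_le_mul_of_nonneg_left (hb p.1 p.2 hp) (norm_nonneg _)

/-- Exchange of the space integral with the mean over the random time. -/
theorem integral_mul_meanKernel {m n : ℕ} (hm : 2 < m) (hn : 2 ≤ n) {k : ℝ}
    (hk : IsHeatSign n k) {t : ℝ} (ht : 0 < t) {f : ℝ → ℂ} (hf : Integrable f) :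
    ∫ x, f x * meanKernel m n k x t = ∫ s, (∫ x, f x * posKernel n k x s) ∂productLaw m t := by
  have := isProbabilityMeasure_productLaw hm ht
  rw [← integral_integral_swap (integrable_posKernel_mul hm hn hk ht hf)]
  congr 1
  ext x
  rw [integral_const_mul, meanKernel]

/-- `∫ Φ(z) E(k (i z)^n τ) dz`. -/
def relaxation (m n : ℕ) (k : ℝ) (Φ : ℝ → ℂ) (τ : ℝ) : ℂ :=
  ∫ z, Φ z * mittagLeffler m (heatSymbol n k z * τ)

/-- Averaging the multiplier `exp(s μ)` over the law of the random time produces the Mittag-Leffler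
multiplier; Fubini is allowed since `Re μ ≤ 0` bounds the exponential by `1` and the transform of
`φ` is integrable. -/
theorem integral_meanKernel_mul {m n : ℕ} (hm : 2 < m) (hn : 2 ≤ n) {k : ℝ}
    (hk : IsHeatSign n k) {t : ℝ} (ht : 0 < t) (φ : SchwartzMap ℝ ℂ) :
    ∫ x, meanKernel m n k x t * φ x =
      (1 / (2 * (Real.pi : ℂ))) * relaxation m n k (phaseTransform φ) (t ^ (1 / (m : ℝ))) := by
  have := isProbabilityMeasure_productLaw hm ht
  have hμ := continuous_heatSymbol n k
  have hΦ := continuous_phaseTransform φ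
  simp_rw [mul_comm (meanKernel m n k _ t)]
  rw [integral_mul_meanKernel hm hn hk ht φ.integrable]
  have h1 : ∀ᵐ s ∂productLaw m t, ∫ x, φ x * posKernel n k x s = (1 / (2 * (Real.pi : ℂ))) *
      ∫ z, Complex.exp (heatSymbol n k z * s) * phaseTransform φ z := by
    filter_upwards [ae_pos_productLaw hm ht] with s hs
    rw [← integral_heatKernel_mul hn hk φ hs]
    simp only [posKernel_of_pos n k _ hs, mul_comm]
  rw [integral_congr_ae h1, integral_const_mul]
  have hint : Integrable (Function.uncurry fun (s z : ℝ) =>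
      Complex.exp (heatSymbol n k z * s) * phaseTransform φ z)
      ((productLaw m t).prod volume) := by
    refine ((integrable_const (1 : ℝ)).mul_prod (integrable_phaseTransform φ).norm).mono'
      (Continuous.aestronglyMeasurable (by unfold Function.uncurry; fun_prop)) ?_
    have hpos : ∀ᵐ p : ℝ × ℝ ∂(productLaw m t).prod volume, 0 < p.1 :=
      Measure.quasiMeasurePreserving_fst.ae (ae_pos_productLaw hm ht)
    filter_upwards [hpos] with p hp
    rw [Function.uncurry, norm_mul]
    exact mul_le_mul_of_nonneg_right
      (norm_cexp_mul_le_one (heatSymbol_re_nonpos hk p.2) hp.le) (norm_nonneg _)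
  rw [integral_integral_swap hint]
  congr 1
  refine integral_congr_ae (ae_of_all _ fun z => ?_)
  dsimp only
  rw [integral_mul_const, integral_cexp_productLaw hm ht, mul_comm]

/-- The derivative of `relaxation`. -/
def relaxationDeriv (m n : ℕ) (k : ℝ) (Φ : ℝ → ℂ) (τ : ℝ) : ℂ :=
  ∫ z, Φ z * (heatSymbol n k z * mittagLefflerDeriv m (heatSymbol n k z * τ))

section relaxation

variable {m n : ℕ} {k : ℝ} {Φ : ℝ → ℂ}

theorem re_heatSymbol_mul_nonpos (hk : IsHeatSign n k) (z : ℝ) {τ : ℝ} (hτ : 0 ≤ τ) :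
    (heatSymbol n k z * τ).re ≤ 0 := by
  rw [Complex.re_mul_ofReal]
  exact mul_nonpos_of_nonpos_of_nonneg (heatSymbol_re_nonpos hk z) hτ

/-- A majorant independent of `τ`: the symbol has modulus `|z|^n`, and on the left half plane the
Mittag-Leffler derivative is bounded by the mean of the random time at `t = 1`. -/
theorem norm_relaxationDeriv_integrand_le (hm : 2 < m) (hk : IsHeatSign n k) (z : ℝ) {τ : ℝ}
    (hτ : 0 ≤ τ) :
    ‖Φ z * (heatSymbol n k z * mittagLefflerDeriv m (heatSymbol n k z * τ))‖ ≤
      (∫ s, s ∂productLaw m 1) * (|z| ^ n * ‖Φ z‖) := by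
  rw [norm_mul, norm_mul, norm_heatSymbol hk]
  have h := norm_mittagLefflerDeriv_le hm (re_heatSymbol_mul_nonpos hk z hτ)
  calc ‖Φ z‖ * (|z| ^ n * ‖mittagLefflerDeriv m (heatSymbol n k z * τ)‖)
      ≤ ‖Φ z‖ * (|z| ^ n * ∫ s, s ∂productLaw m 1) := by gcongr
    _ = _ := by ring

theorem continuousOn_relaxationDeriv (hm : 2 < m) (hk : IsHeatSign n k) (hΦ : Continuous Φ)
    (hint : Integrable fun z => |z| ^ n * ‖Φ z‖) :
    ContinuousOn (relaxationDeriv m n k Φ) (Ici 0) := by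
  have hμ := continuous_heatSymbol n k
  have hE := continuous_mittagLefflerDeriv hm
  refine continuousOn_of_dominated
    (bound := fun z => (∫ s, s ∂productLaw m 1) * (|z| ^ n * ‖Φ z‖))
    (fun τ _ => Continuous.aestronglyMeasurable (by fun_prop))
    (fun τ hτ => ae_of_all _ fun z => norm_relaxationDeriv_integrand_le hm hk z hτ)
    (hint.const_mul _) (ae_of_all _ fun z => Continuous.continuousOn (by fun_prop))

theorem continuousOn_relaxation (hm : 2 < m) (hk : IsHeatSign n k) (hΦ : Integrable Φ) :
    ContinuousOn (relaxation m n k Φ) (Ici 0) := by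
  have hμ := continuous_heatSymbol n k
  have hE := continuous_mittagLeffler hm
  refine continuousOn_of_dominated (bound := fun z => ‖Φ z‖)
    (fun τ _ => hΦ.aestronglyMeasurable.mul (Continuous.aestronglyMeasurable (by fun_prop)))
    (fun τ hτ => ae_of_all _ fun z => ?_)
    hΦ.norm (ae_of_all _ fun z => Continuous.continuousOn (by fun_prop))
  rw [norm_mul]
  exact mul_le_of_le_one_right (norm_nonneg _)
    (norm_mittagLeffler_le_one hm (re_heatSymbol_mul_nonpos hk z hτ))

theorem hasDerivAt_relaxation (hm : 2 < m) (hk : IsHeatSign n k) (hc : Continuous Φ)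
    (hΦ : Integrable Φ) (hint : Integrable fun z => |z| ^ n * ‖Φ z‖) {τ : ℝ} (hτ : 0 < τ) :
    HasDerivAt (relaxation m n k Φ) (relaxationDeriv m n k Φ τ) τ := by
  have hμ := continuous_heatSymbol n k
  have hE := continuous_mittagLeffler hm
  have hE' := continuous_mittagLefflerDeriv hm
  refine (hasDerivAt_integral_of_dominated_loc_of_deriv_le (Ioi_mem_nhds hτ)
    (bound := fun z => (∫ s, s ∂productLaw m 1) * (|z| ^ n * ‖Φ z‖))
    (F' := fun (τ : ℝ) z =>
      Φ z * (heatSymbol n k z * mittagLefflerDeriv m (heatSymbol n k z * τ)))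
    (Eventually.of_forall fun τ => Continuous.aestronglyMeasurable (by fun_prop)) ?_
    (Continuous.aestronglyMeasurable (by fun_prop))
    (ae_of_all _ fun z τ hτ => norm_relaxationDeriv_integrand_le hm hk z (le_of_lt hτ))
    (hint.const_mul _) (ae_of_all _ fun z τ _ => ?_)).2
  · refine hΦ.mul_bdd (c := 1) (Continuous.aestronglyMeasurable (by fun_prop))
      (ae_of_all _ fun z => norm_mittagLeffler_le_one hm (re_heatSymbol_mul_nonpos hk z hτ.le))
  · have h1 : HasDerivAt (fun τ : ℝ => heatSymbol n k z * (τ : ℂ)) (heatSymbol n k z) τ := by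
      simpa using (Complex.ofRealCLM.hasDerivAt (x := τ)).const_mul (heatSymbol n k z)
    have h2 := (hasDerivAt_mittagLeffler hm (heatSymbol n k z * (τ : ℂ))).comp τ h1
    rw [mul_comm (heatSymbol n k z) (mittagLefflerDeriv m _)]
    exact h2.const_mul (Φ z)

/-- The fractional relaxation equation for superpositions of modes. -/
theorem integral_deriv_relaxation (hm : 2 < m) (hk : IsHeatSign n k) (hc : Continuous Φ)
    (hint : Integrable fun z => |z| ^ n * ‖Φ z‖) {t : ℝ} (ht : 0 < t) :
    ∫ z in (0 : ℝ)..t, ((1 / (m : ℝ) * z ^ (1 / (m : ℝ) - 1) : ℝ) : ℂ) *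
        relaxationDeriv m n k Φ (z ^ (1 / (m : ℝ))) * (((t - z) ^ (-(1 / (m : ℝ))) : ℝ) : ℂ) =
      (Real.Gamma (1 - 1 / m) : ℂ) *
        relaxation m n k (fun z => heatSymbol n k z * Φ z) (t ^ (1 / (m : ℝ))) := by
  have hm0 : (0 : ℝ) < m := by positivity
  set α : ℝ := 1 / (m : ℝ) with hα
  have hα0 : 0 < α := by positivity
  have hα1 : α < 1 := by
    rw [hα, div_lt_one hm0]
    exact_mod_cast (by omega : 1 < m)
  have hμ := continuous_heatSymbol n k
  have hE' := continuous_mittagLefflerDeriv hm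
  let H : ℝ → ℝ → ℂ := fun z ξ => Φ ξ * (heatSymbol n k ξ * ((α * z ^ (α - 1) : ℝ) : ℂ) *
    mittagLefflerDeriv m (heatSymbol n k ξ * ((z ^ α : ℝ) : ℂ)) * (((t - z) ^ (-α) : ℝ) : ℂ))
  have hH : Integrable (Function.uncurry H) ((volume.restrict (Ioc 0 t)).prod volume) := by
    have hb := (integral_rpow_mul_sub_rpow hα0 (sub_pos.mpr hα1) ht).1
    rw [intervalIntegrable_iff_integrableOn_Ioc_of_le ht.le] at hb
    refine ((hb.const_mul α).mul_prod (hint.const_mul (∫ s, s ∂productLaw m 1))).mono' ?_ ?_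
    · refine Measurable.aestronglyMeasurable ?_
      have h1 := hc.measurable
      have h2 := hμ.measurable
      have h3 := hE'.measurable
      simp only [H]
      fun_prop
    · have hpos : ∀ᵐ p : ℝ × ℝ ∂(volume.restrict (Ioc 0 t)).prod volume, p.1 ∈ Ioc 0 t :=
        Measure.quasiMeasurePreserving_fst.ae (ae_restrict_mem measurableSet_Ioc)
      filter_upwards [hpos] with p hp
      have h1 := norm_relaxationDeriv_integrand_le (Φ := Φ) hm hk p.2
        (Real.rpow_nonneg hp.1.le α)
      have h2 : 0 ≤ α * (p.1 ^ (α - 1) * (t - p.1) ^ (1 - α - 1)) :=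
        mul_nonneg hα0.le (mul_nonneg (Real.rpow_nonneg hp.1.le _)
          (Real.rpow_nonneg (sub_nonneg.mpr hp.2) _))
      have h3 : Function.uncurry H p =
          ((α * (p.1 ^ (α - 1) * (t - p.1) ^ (1 - α - 1)) : ℝ) : ℂ) * (Φ p.2 *
            (heatSymbol n k p.2 *
              mittagLefflerDeriv m (heatSymbol n k p.2 * ((p.1 ^ α : ℝ) : ℂ)))) := by
        simp only [H, Function.uncurry]
        rw [show 1 - α - 1 = -α by ring]
        push_cast
        ring
      rw [h3, norm_mul, Complex.norm_real, Real.norm_eq_abs, abs_of_nonneg h2]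
      exact mul_le_mul_of_nonneg_left h1 h2
  have hswap := integral_integral_swap hH
  rw [intervalIntegral.integral_of_le ht.le]
  refine Eq.trans ?_ (hswap.trans ?_)
  · refine setIntegral_congr_fun measurableSet_Ioc fun z _ => ?_
    simp only [H, relaxationDeriv]
    rw [← integral_const_mul, ← integral_mul_const]
    congr 1
    ext ξ
    ring
  · rw [relaxation, ← integral_const_mul]
    congr 1
    ext ξ
    simp only [H]
    rw [integral_const_mul, ← intervalIntegral.integral_of_le ht.le,
      integral_mittagLefflerDeriv hm (heatSymbol n k ξ) ht]
    ring

end relaxation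

/-! ### Transforms of derivatives and inversion -/

open FourierTransform in
-- Fourier inversion at the origin; it produces the initial value, because the Mittag-Leffler
-- multiplier is `1` at time `0`.
theorem integral_phaseTransform (φ : SchwartzMap ℝ ℂ) :
    ∫ z, phaseTransform φ z = 2 * Real.pi * φ 0 := by
  simp_rw [phaseTransform_eq]
  rw [Measure.integral_comp_mul_left (fun z => 𝓕 (φ : ℝ → ℂ) z)]
  have h1 : ∫ y, 𝓕 (φ : ℝ → ℂ) y = φ 0 := by
    have h0 : 𝓕⁻ (𝓕 φ) = φ := FourierTransform.fourierInv_fourier_eq φ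
    have h := congrArg (fun f : SchwartzMap ℝ ℂ => f 0) h0
    rw [SchwartzMap.fourierInv_coe, Real.fourierInv_eq] at h
    simp only [inner_zero_right, AddChar.map_zero_eq_one, one_smul] at h
    exact h
  rw [h1, abs_inv, abs_neg, abs_of_pos (by positivity), one_div, inv_inv, Complex.real_smul]
  push_cast
  ring

/-- The `j`-th derivative of a Schwartz function. -/
def schwartzDeriv (j : ℕ) (φ : SchwartzMap ℝ ℂ) : SchwartzMap ℝ ℂ :=
  (SchwartzMap.derivCLM ℂ ℂ)^[j] φ

theorem coe_schwartzDeriv (j : ℕ) (φ : SchwartzMap ℝ ℂ) :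
    ⇑(schwartzDeriv j φ) = iteratedDeriv j (φ : ℝ → ℂ) := by
  induction j with
  | zero => ext x; simp [schwartzDeriv]
  | succ j ih =>
    ext x
    rw [iteratedDeriv_succ, ← ih, schwartzDeriv, Function.iterate_succ_apply',
      SchwartzMap.derivCLM_apply]
    rfl

theorem phaseTransform_iteratedDeriv (φ : SchwartzMap ℝ ℂ) (j : ℕ) (z : ℝ) :
    phaseTransform (iteratedDeriv j (φ : ℝ → ℂ)) z = (-(Complex.I * z)) ^ j * phaseTransform φ z := by
  rw [phaseTransform_eq, phaseTransform_eq, Real.fourier_iteratedDeriv (N := ⊤) (φ.smooth ⊤)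
    (fun j _ => coe_schwartzDeriv j φ ▸ (schwartzDeriv j φ).integrable) le_top]
  simp only [smul_eq_mul]
  congr 2
  have : (Real.pi : ℂ) ≠ 0 := by exact_mod_cast Real.pi_ne_zero
  push_cast
  field_simp

/-- The mean kernel solves the fractional problem. -/
theorem isFundamentalSolution_of_eq_meanKernel {m n : ℕ} (hm : 2 < m) (hn : 2 ≤ n) {k : ℝ}
    (hk : IsHeatSign n k) {u : ℝ → ℝ → ℂ}
    (hu : ∀ x t, 0 < t → u x t = meanKernel m n k x t) :
    IsFundamentalSolution (1 / (m : ℝ)) n k u := by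
  have hm0 : (0 : ℝ) < m := by positivity
  have hα0 : 0 < 1 / (m : ℝ) := by positivity
  have hα1 : 1 / (m : ℝ) < 1 := by
    rw [div_lt_one hm0]
    exact_mod_cast (by omega : 1 < m)
  have hpair : ∀ φ : SchwartzMap ℝ ℂ, ∀ t, 0 < t → spacePairing u φ t =
      (1 / (2 * (Real.pi : ℂ))) *
        relaxation m n k (phaseTransform φ) (t ^ (1 / (m : ℝ))) := fun φ t ht => by
    rw [← integral_meanKernel_mul hm hn hk ht φ, spacePairing]
    simp only [hu _ t ht]
  have hderiv : ∀ φ : SchwartzMap ℝ ℂ, ∀ t, 0 < t → HasDerivAt (spacePairing u φ)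
      ((1 / (2 * (Real.pi : ℂ))) * (((1 / (m : ℝ) * t ^ (1 / (m : ℝ) - 1) : ℝ) : ℂ) *
        relaxationDeriv m n k (phaseTransform φ) (t ^ (1 / (m : ℝ))))) t := fun φ t ht => by
    have h1 := (hasDerivAt_relaxation hm hk (continuous_phaseTransform φ)
      (integrable_phaseTransform φ) (integrable_pow_mul_phaseTransform φ n)
      (Real.rpow_pos_of_pos ht (1 / (m : ℝ))))
    have h2 := (h1.scomp t (Real.hasDerivAt_rpow_const (p := 1 / (m : ℝ))
      (Or.inl ht.ne'))).const_mul (1 / (2 * (Real.pi : ℂ)))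
    rw [Complex.real_smul] at h2
    refine h2.congr_of_eventuallyEq ?_
    filter_upwards [Ioi_mem_nhds ht] with s hs
    exact hpair φ s hs
  have hcont : ∀ φ : SchwartzMap ℝ ℂ, ContinuousOn
      (fun t : ℝ => relaxationDeriv m n k (phaseTransform φ) (t ^ (1 / (m : ℝ)))) (Ioi 0) :=
    fun φ => (continuousOn_relaxationDeriv hm hk (continuous_phaseTransform φ)
      (integrable_pow_mul_phaseTransform φ n)).comp
      (fun t ht => (Real.continuousAt_rpow_const t _ (Or.inr hα0.le)).continuousWithinAt)
      (fun t ht => Real.rpow_nonneg (le_of_lt ht) _)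
  have hcd : ∀ φ : SchwartzMap ℝ ℂ, ContinuousOn (deriv (spacePairing u φ)) (Ioi 0) := fun φ => by
    refine ContinuousOn.congr (f := fun t : ℝ => (1 / (2 * (Real.pi : ℂ))) *
      (((1 / (m : ℝ) * t ^ (1 / (m : ℝ) - 1) : ℝ) : ℂ) *
        relaxationDeriv m n k (phaseTransform φ) (t ^ (1 / (m : ℝ))))) ?_
      (fun t ht => (hderiv φ t ht).deriv)
    refine continuousOn_const.mul (ContinuousOn.mul ?_ (hcont φ))
    refine Complex.continuous_ofReal.comp_continuousOn (continuousOn_const.mul fun t ht => ?_)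
    exact (Real.continuousAt_rpow_const t _ (Or.inl (ne_of_gt ht))).continuousWithinAt
  constructor
  · intro t ht
    simpa only [hu _ t ht] using continuous_meanKernel hm hn hk ht
  · intro T hT
    obtain ⟨C, hC⟩ := norm_meanKernel_le hm hn hk
    -- The mean kernel is bounded in `x`, hence `N = 0`; the power of `t` is integrable at `0`
    -- because `-1/(n m) > -1`.
    refine ⟨0, fun t => C * t ^ (-(1 / (n : ℝ)) / m), ?_, fun t ht x => ?_⟩
    · refine Integrable.const_mul ?_ C
      have h : -1 < -(1 / (n : ℝ)) / m := by
        have h1 := neg_one_lt_neg_one_div hn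
        rw [lt_div_iff₀ hm0]
        have : (1 : ℝ) < m := by exact_mod_cast (by omega : 1 < m)
        linarith
      exact (intervalIntegrable_iff_integrableOn_Ioc_of_le hT.le).mp
        (intervalIntegral.intervalIntegrable_rpow' h)
    · rw [hu x t ht.1, pow_zero, mul_one]
      exact hC x t ht.1
  · intro φ
    have h := (contDiffOn_succ_iff_deriv_of_isOpen (𝕜 := ℝ) (n := 0) (f := spacePairing u φ)
      isOpen_Ioi).mpr ⟨fun t ht => (hderiv φ t ht).differentiableAt.differentiableWithinAt,
        fun h => by simp at h, contDiffOn_zero.mpr (hcd φ)⟩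
    simpa using h
  · intro φ T hT
    have h1 := (integrable_pow_mul_phaseTransform φ n).const_mul (∫ s, s ∂productLaw m 1)
    have hI : IntegrableOn (fun t : ℝ => ‖(1 / (2 * (Real.pi : ℂ)))‖ *
        ((1 / (m : ℝ) * t ^ (1 / (m : ℝ) - 1)) *
        ∫ z, (∫ s, s ∂productLaw m 1) * (|z| ^ n * ‖phaseTransform φ z‖))) (Ioc 0 T) := by
      refine Integrable.const_mul (Integrable.mul_const (Integrable.const_mul ?_ _) _) _
      exact (intervalIntegrable_iff_integrableOn_Ioc_of_le hT.le).mp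
        (intervalIntegral.intervalIntegrable_rpow' (by linarith))
    refine hI.mono' (((hcd φ).mono Ioc_subset_Ioi_self).aestronglyMeasurable measurableSet_Ioc) ?_
    filter_upwards [ae_restrict_mem measurableSet_Ioc] with t ht
    have ht0 : 0 < t := ht.1
    have h2 : 0 ≤ 1 / (m : ℝ) * t ^ (1 / (m : ℝ) - 1) := by positivity
    rw [(hderiv φ t ht0).deriv, norm_mul, norm_mul, Complex.norm_real, Real.norm_eq_abs,
      abs_of_nonneg h2]
    refine mul_le_mul_of_nonneg_left (mul_le_mul_of_nonneg_left ?_ h2) (norm_nonneg _)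
    exact norm_integral_le_of_norm_le h1 (ae_of_all _ fun z =>
      norm_relaxationDeriv_integrand_le hm hk z (Real.rpow_nonneg ht0.le _))
  · intro φ t ht
    have hΓ : (Real.Gamma (1 - 1 / m) : ℂ) ≠ 0 := by
      exact_mod_cast (Real.Gamma_pos_of_pos (by linarith)).ne'
    have h1 := integral_deriv_relaxation hm hk (continuous_phaseTransform φ)
      (integrable_pow_mul_phaseTransform φ n) ht
    have h2 : ∫ z in (0 : ℝ)..t, deriv (spacePairing u φ) z *
        (((t - z) ^ (-(1 / (m : ℝ))) : ℝ) : ℂ) = (1 / (2 * (Real.pi : ℂ))) *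
        ∫ z in (0 : ℝ)..t, ((1 / (m : ℝ) * z ^ (1 / (m : ℝ) - 1) : ℝ) : ℂ) *
        relaxationDeriv m n k (phaseTransform φ) (z ^ (1 / (m : ℝ))) *
          (((t - z) ^ (-(1 / (m : ℝ))) : ℝ) : ℂ) := by
      rw [← intervalIntegral.integral_const_mul, intervalIntegral.integral_of_le ht.le,
        intervalIntegral.integral_of_le ht.le]
      refine setIntegral_congr_fun measurableSet_Ioc fun z hz => ?_
      rw [(hderiv φ z hz.1).deriv]
      ring
    rw [caputoDeriv, h2, h1, ← coe_schwartzDeriv, hpair _ t ht, coe_schwartzDeriv]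
    -- Moving `n` derivatives onto the test function gives `(-iz)^n`; the sign `(-1)^n` of the weak
    -- formulation restores the symbol `k (iz)^n`.
    have h3 : relaxation m n k (phaseTransform (iteratedDeriv n (φ : ℝ → ℂ)))
        (t ^ (1 / (m : ℝ))) * (k * (-1) ^ n) =
        relaxation m n k (fun z => heatSymbol n k z * phaseTransform φ z) (t ^ (1 / (m : ℝ))) := by
      rw [relaxation, ← integral_mul_const, relaxation]
      congr 1
      ext z
      rw [phaseTransform_iteratedDeriv]
      have : (k : ℂ) * (-1) ^ n * (-(Complex.I * z)) ^ n = heatSymbol n k z := by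
        rw [heatSymbol, mul_assoc, ← mul_pow]
        congr 2
        ring
      rw [← this]
      ring
    rw [← h3]
    generalize (Real.Gamma (1 - 1 / (m : ℝ)) : ℂ) = g at hΓ ⊢
    field_simp
  · intro φ
    have h0 : relaxation m n k (phaseTransform φ) 0 = 2 * Real.pi * φ 0 := by
      rw [relaxation, ← integral_phaseTransform]
      simp [mittagLeffler_zero hm]
    have h1 : Tendsto (fun t : ℝ => t ^ (1 / (m : ℝ))) (𝓝[>] 0) (𝓝[≥] 0) := by
      refine tendsto_nhdsWithin_iff.mpr ⟨?_, ?_⟩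
      · have h := (Real.continuousAt_rpow_const 0 (1 / (m : ℝ)) (Or.inr hα0.le)).tendsto
        rw [Real.zero_rpow hα0.ne'] at h
        exact h.mono_left nhdsWithin_le_nhds
      · filter_upwards [self_mem_nhdsWithin] with t ht
        exact Real.rpow_nonneg (le_of_lt ht) _
    have h2 := ((continuousOn_relaxation hm hk (integrable_phaseTransform φ)) 0
      self_mem_Ici).tendsto.comp h1
    have h3 := h2.const_mul (1 / (2 * (Real.pi : ℂ)))
    rw [h0] at h3
    have hpi : (Real.pi : ℂ) ≠ 0 := by exact_mod_cast Real.pi_ne_zero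
    rw [show (1 / (2 * (Real.pi : ℂ))) * (2 * Real.pi * φ 0) = φ 0 by field_simp] at h3
    refine h3.congr' ?_
    filter_upwards [self_mem_nhdsWithin] with t ht
    exact (hpair φ t ht).symm

/-! ### Inversion of the Caputo derivative -/

/-- The two exponents add up to `-1`, so the beta integral is scale invariant; a value independent
of `z` and `t` is what makes Abel's inversion work. -/
theorem integral_abel_kernel {α z t : ℝ} (h0 : 0 < α) (h1 : α < 1) (hzt : z < t) :
    IntegrableOn (fun s => (s - z) ^ (-α) * (t - s) ^ (α - 1)) (Ioc z t) ∧
    ∫ s in Ioc z t, (s - z) ^ (-α) * (t - s) ^ (α - 1) = Real.Gamma (1 - α) * Real.Gamma α := by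
  have h := integral_rpow_mul_sub_rpow (sub_pos.mpr h1) h0 (sub_pos.mpr hzt)
  have hval : ∫ s in Ioc z t, (s - z) ^ (-α) * (t - s) ^ (α - 1) =
      Real.Gamma (1 - α) * Real.Gamma α := by
    have h2 := intervalIntegral.integral_comp_sub_right (a := z) (b := t)
      (fun y : ℝ => y ^ (1 - α - 1) * (t - z - y) ^ (α - 1)) z
    rw [sub_self, h.2] at h2
    rw [← intervalIntegral.integral_of_le hzt.le]
    refine Eq.trans ?_ (h2.trans ?_)
    · congr 1
      ext s
      rw [show 1 - α - 1 = -α by ring, show t - z - (s - z) = t - s by ring]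
    · rw [show 1 - α + α - 1 = 0 by ring, Real.rpow_zero, show 1 - α + α = 1 by ring,
        Real.Gamma_one]
      ring
  refine ⟨Integrable.of_integral_ne_zero ?_, hval⟩
  rw [hval]
  exact (mul_pos (Real.Gamma_pos_of_pos (by linarith)) (Real.Gamma_pos_of_pos h0)).ne'

/-- Exchanging the integrals over the triangle `0 < z < s < t` leaves the Abel constant times `∫
f'`. The limit `L` replaces the value at `0`, about which nothing is assumed. -/
theorem integral_caputoDeriv_mul_rpow {α : ℝ} (h0 : 0 < α) (h1 : α < 1) {f : ℝ → ℂ} {L : ℂ}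
    (hf : ContDiffOn ℝ 1 f (Ioi 0)) {t : ℝ} (ht : 0 < t)
    (hi : IntegrableOn (deriv f) (Ioc 0 t)) (hL : Tendsto f (𝓝[>] 0) (𝓝 L)) :
    IntegrableOn (fun s => caputoDeriv α f s * (((t - s) ^ (α - 1) : ℝ) : ℂ)) (Ioc 0 t) ∧
    ∫ s in Ioc 0 t, caputoDeriv α f s * (((t - s) ^ (α - 1) : ℝ) : ℂ) =
      (Real.Gamma α : ℂ) * (f t - L) := by
  set w := deriv f with hw
  have hG1 : 0 < Real.Gamma (1 - α) := Real.Gamma_pos_of_pos (by linarith)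
  have hG0 : 0 < Real.Gamma α := Real.Gamma_pos_of_pos h0
  have hG1' : (Real.Gamma (1 - α) : ℂ) ≠ 0 := by exact_mod_cast hG1.ne'
  have hdiff : ∀ s, 0 < s → HasDerivAt f (w s) s := fun s hs =>
    ((hf.differentiableOn one_ne_zero s hs).differentiableAt (Ioi_mem_nhds hs)).hasDerivAt
  have hftc : ∫ z in Ioc 0 t, w z = f t - L := by
    rw [← intervalIntegral.integral_of_le ht.le]
    exact intervalIntegral.integral_eq_sub_of_hasDerivAt_of_tendsto ht
      (fun s hs => hdiff s hs.1)
      ((intervalIntegrable_iff_integrableOn_Ioc_of_le ht.le).mpr hi) hL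
      ((hdiff t ht).continuousAt.tendsto.mono_left nhdsWithin_le_nhds)
  -- The indicator extends the integrand on the triangle to a square, where Fubini applies directly.
  let F : ℝ → ℝ → ℂ := fun z s => (Ioi z).indicator
    (fun s => w z * (((s - z) ^ (-α) * (t - s) ^ (α - 1) : ℝ) : ℂ)) s
  have hinter : ∀ z ∈ Ioc 0 t, Ioc 0 t ∩ Ioi z = Ioc z t := fun z hz => by
    ext s
    simp only [mem_inter_iff, mem_Ioc, mem_Ioi]
    have := hz.1
    constructor
    · rintro ⟨⟨_, h2⟩, h3⟩
      exact ⟨h3, h2⟩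
    · rintro ⟨h2, h3⟩
      exact ⟨⟨by linarith, h3⟩, h2⟩
  have hne : ∀ᵐ z ∂volume.restrict (Ioc 0 t), z ∈ Ioo 0 t := by
    rw [← restrict_Ioo_eq_restrict_Ioc]
    exact ae_restrict_mem measurableSet_Ioo
  have hF : Integrable (Function.uncurry F)
      ((volume.restrict (Ioc 0 t)).prod (volume.restrict (Ioc 0 t))) := by
    rw [integrable_prod_iff]
    · constructor
      · filter_upwards [hne] with z hz
        have h2 := ((integral_abel_kernel h0 h1 hz.2).1.ofReal (𝕜 := ℂ)).const_mul (w z)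
        have h3 : Integrable (F z) (volume.restrict (Ioc 0 t)) := by
          rw [integrable_indicator_iff measurableSet_Ioi, IntegrableOn,
            Measure.restrict_restrict measurableSet_Ioi, inter_comm,
            hinter z (Ioo_subset_Ioc_self hz)]
          exact h2
        exact h3
      · refine (hi.norm.mul_const (Real.Gamma (1 - α) * Real.Gamma α)).congr ?_
        filter_upwards [hne] with z hz
        have hz' := Ioo_subset_Ioc_self hz
        have h2 : ∀ s, ‖Function.uncurry F (z, s)‖ = (Ioi z).indicator
            (fun s => ‖w z * (((s - z) ^ (-α) * (t - s) ^ (α - 1) : ℝ) : ℂ)‖) s := fun s => by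
          simp only [F, Function.uncurry_apply_pair]
          exact norm_indicator_eq_indicator_norm _ _
        simp_rw [h2]
        rw [setIntegral_indicator measurableSet_Ioi, hinter z hz',
          ← (integral_abel_kernel h0 h1 hz.2).2, ← integral_const_mul]
        refine setIntegral_congr_fun measurableSet_Ioc fun s hs => ?_
        have h3 : 0 ≤ (s - z) ^ (-α) * (t - s) ^ (α - 1) :=
          mul_nonneg (Real.rpow_nonneg (sub_nonneg.mpr hs.1.le) _)
            (Real.rpow_nonneg (sub_nonneg.mpr hs.2) _)
        simp only [norm_mul, Complex.norm_real, Real.norm_eq_abs]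
        rw [← abs_mul, abs_of_nonneg h3]
    · have h2 : AEStronglyMeasurable
          (fun p : ℝ × ℝ => w p.1 * (((p.2 - p.1) ^ (-α) * (t - p.2) ^ (α - 1) : ℝ) : ℂ))
          ((volume.restrict (Ioc 0 t)).prod (volume.restrict (Ioc 0 t))) := by
        refine hi.aestronglyMeasurable.comp_fst.mul (Measurable.aestronglyMeasurable ?_)
        fun_prop
      have h3 := h2.indicator (measurableSet_lt measurable_fst measurable_snd)
      refine h3.congr (ae_of_all _ fun p => ?_)
      simp only [F, Function.uncurry, indicator, mem_ofPred_eq, mem_Ioi]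
  have hs : ∀ s ∈ Ioc 0 t, ∫ z in Ioc 0 t, F z s =
      (Real.Gamma (1 - α) : ℂ) * (caputoDeriv α f s * (((t - s) ^ (α - 1) : ℝ) : ℂ)) := by
    intro s hs
    have e1 : ∀ z, F z s = (Iio s).indicator
        (fun z => w z * (((s - z) ^ (-α) * (t - s) ^ (α - 1) : ℝ) : ℂ)) z := fun z => by
      simp only [F, indicator, mem_Ioi, mem_Iio]
    have e2 : Ioc 0 t ∩ Iio s = Ioo 0 s := by
      ext z
      simp only [mem_inter_iff, mem_Ioc, mem_Iio, mem_Ioo]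
      have := hs.2
      constructor
      · rintro ⟨⟨h2, _⟩, h3⟩
        exact ⟨h2, h3⟩
      · rintro ⟨h2, h3⟩
        exact ⟨⟨h2, by linarith⟩, h3⟩
    simp_rw [e1]
    rw [setIntegral_indicator measurableSet_Iio, e2, ← integral_Ioc_eq_integral_Ioo, caputoDeriv,
      intervalIntegral.integral_of_le hs.1.le, one_div, mul_assoc, mul_inv_cancel_left₀ hG1',
      ← integral_mul_const]
    congr 1
    ext z
    push_cast
    ring
  have hz : ∫ z in Ioc 0 t, ∫ s in Ioc 0 t, F z s =
      (Real.Gamma (1 - α) * Real.Gamma α : ℂ) * (f t - L) := by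
    rw [← hftc, ← integral_const_mul]
    refine integral_congr_ae ?_
    filter_upwards [hne] with z hz
    simp only [F]
    rw [setIntegral_indicator measurableSet_Ioi, hinter z (Ioo_subset_Ioc_self hz),
      integral_const_mul, integral_complex_ofReal, (integral_abel_kernel h0 h1 hz.2).2]
    push_cast
    ring
  constructor
  · have h2 := hF.integral_prod_right
    have h3 := h2.const_mul ((Real.Gamma (1 - α) : ℂ)⁻¹)
    refine h3.congr ?_
    filter_upwards [ae_restrict_mem measurableSet_Ioc] with s hs'
    have h4 := hs s hs'
    simp only [Function.uncurry_apply_pair]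
    rw [h4, inv_mul_cancel_left₀ hG1']
  · have h2 := integral_integral_swap hF
    rw [hz, setIntegral_congr_fun measurableSet_Ioc hs, integral_const_mul, mul_assoc] at h2
    exact (mul_left_cancel₀ hG1' h2).symm

/-! ### Exponentially weighted norms in time -/

/-- The norm of `f` in `L^1((0, T], exp (-l t) dt)`. -/
def weightedNorm (l T : ℝ) (f : ℝ → ℂ) : ENNReal :=
  ∫⁻ t in Ioc 0 T, ENNReal.ofReal (Real.exp (-l * t)) * ‖f t‖ₑ

/-- The substitution `y = t - s` splits off `exp(-l s)` and leaves the Laplace transform of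
`y^(α-1)` at `l`. -/
theorem lintegral_exp_abel {α l : ℝ} (h0 : 0 < α) (hl : 0 < l) (s : ℝ) :
    ∫⁻ t, (Ioi s).indicator
      (fun t => ENNReal.ofReal (Real.exp (-l * t)) * ENNReal.ofReal ((t - s) ^ (α - 1))) t =
    ENNReal.ofReal (Real.exp (-l * s)) * ENNReal.ofReal (Real.Gamma α * l ^ (-α)) := by
  have h1 : ∫⁻ y, (Ioi (0 : ℝ)).indicator
      (fun y => ENNReal.ofReal (y ^ (α - 1) * Real.exp (-l * y))) y =
      ENNReal.ofReal (Real.Gamma α * l ^ (-α)) := by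
    rw [lintegral_indicator measurableSet_Ioi, ← ofReal_integral_eq_lintegral_ofReal]
    · have h := integral_rpow_mul_exp_neg_mul_rpow (p := 1) (q := α - 1) one_pos
        (by linarith) hl
      simp only [Real.rpow_one] at h
      rw [h]
      congr 1
      rw [sub_add_cancel, div_one, div_one]
      ring_nf
    · have h := integrableOn_rpow_mul_exp_neg_mul_rpow (p := 1) (s := α - 1) (by linarith)
        one_pos hl
      simpa only [Real.rpow_one, IntegrableOn] using h
    · filter_upwards [ae_restrict_mem measurableSet_Ioi] with y hy
      exact mul_nonneg (Real.rpow_nonneg (le_of_lt hy) _) (Real.exp_pos _).le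
  rw [← h1, ← lintegral_sub_right_eq_self ((Ioi (0 : ℝ)).indicator
    fun y => ENNReal.ofReal (y ^ (α - 1) * Real.exp (-l * y))) s, ← lintegral_const_mul']
  · congr 1
    ext t
    by_cases ht : s < t
    · rw [indicator_of_mem (mem_Ioi.mpr ht), indicator_of_mem (mem_Ioi.mpr (sub_pos.mpr ht)),
        ← ENNReal.ofReal_mul (Real.exp_pos _).le, ← ENNReal.ofReal_mul (Real.exp_pos _).le,
        mul_left_comm, ← Real.exp_add, mul_comm]
      congr 3
      ring
    · rw [indicator_of_notMem (fun h => ht (mem_Ioi.mp h)),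
        indicator_of_notMem (fun h => ht (sub_pos.mp (mem_Ioi.mp h))), mul_zero]
  · exact ENNReal.ofReal_ne_top

/-- Fractional integration becomes as small as desired for large `l`. By Tonelli the cost is the
Laplace transform of the kernel; extended nonnegative norms spare any integrability hypothesis. -/
theorem weightedNorm_le_of_fractional_integral {α l T : ℝ} (h0 : 0 < α) (hl : 0 < l)
    {D h : ℝ → ℂ} (hm : AEStronglyMeasurable h (volume.restrict (Ioc 0 T)))
    (hD : ∀ t ∈ Ioc 0 T, (Real.Gamma α : ℂ) * D t =
      ∫ s in Ioc 0 t, h s * (((t - s) ^ (α - 1) : ℝ) : ℂ)) :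
    weightedNorm l T D ≤ ENNReal.ofReal (l ^ (-α)) * weightedNorm l T h := by
  have hG : 0 < Real.Gamma α := Real.Gamma_pos_of_pos h0
  let K : ℝ → ℝ → ENNReal := fun t s => (Ioi s).indicator
    (fun t => ENNReal.ofReal (Real.exp (-l * t)) * ENNReal.ofReal ((t - s) ^ (α - 1))) t
  have hK : Measurable (Function.uncurry K) := by
    have : Function.uncurry K = {p : ℝ × ℝ | p.2 < p.1}.indicator (fun p =>
        ENNReal.ofReal (Real.exp (-l * p.1)) * ENNReal.ofReal ((p.1 - p.2) ^ (α - 1))) := by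
      ext p
      simp only [K, Function.uncurry, indicator, mem_Ioi, mem_ofPred_eq]
    rw [this]
    refine Measurable.indicator ?_ (measurableSet_lt measurable_snd measurable_fst)
    fun_prop
  have hpt : ∀ t ∈ Ioc 0 T, ENNReal.ofReal (Real.exp (-l * t)) * ‖D t‖ₑ ≤
      ENNReal.ofReal (Real.Gamma α)⁻¹ * ∫⁻ s in Ioc 0 T, K t s * ‖h s‖ₑ := by
    intro t ht
    have e1 : D t = ((Real.Gamma α)⁻¹ : ℝ) * ∫ s in Ioc 0 t,
        h s * (((t - s) ^ (α - 1) : ℝ) : ℂ) := by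
      rw [← hD t ht]
      have : (Real.Gamma α : ℂ) ≠ 0 := by exact_mod_cast hG.ne'
      push_cast
      field_simp
    have e2 : ‖D t‖ₑ ≤ ENNReal.ofReal (Real.Gamma α)⁻¹ *
        ∫⁻ s in Ioc 0 t, ENNReal.ofReal ((t - s) ^ (α - 1)) * ‖h s‖ₑ := by
      rw [e1, enorm_mul, ← ofReal_norm (((Real.Gamma α)⁻¹ : ℝ) : ℂ), Complex.norm_real,
        Real.norm_eq_abs, abs_of_pos (inv_pos.mpr hG)]
      gcongr
      refine (enorm_integral_le_lintegral_enorm _).trans (le_of_eq ?_)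
      refine setLIntegral_congr_fun measurableSet_Ioc fun s hs => ?_
      rw [enorm_mul, mul_comm, ← ofReal_norm (((t - s) ^ (α - 1) : ℝ) : ℂ),
        Complex.norm_real, Real.norm_eq_abs,
        abs_of_nonneg (Real.rpow_nonneg (sub_nonneg.mpr hs.2) _)]
    calc ENNReal.ofReal (Real.exp (-l * t)) * ‖D t‖ₑ
        ≤ ENNReal.ofReal (Real.exp (-l * t)) * (ENNReal.ofReal (Real.Gamma α)⁻¹ *
          ∫⁻ s in Ioc 0 t, ENNReal.ofReal ((t - s) ^ (α - 1)) * ‖h s‖ₑ) := by gcongr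
      _ = ENNReal.ofReal (Real.Gamma α)⁻¹ * ∫⁻ s in Ioo 0 t, K t s * ‖h s‖ₑ := by
          rw [mul_left_comm, ← lintegral_const_mul' _ _ ENNReal.ofReal_ne_top,
            ← restrict_Ioo_eq_restrict_Ioc]
          congr 1
          refine setLIntegral_congr_fun measurableSet_Ioo fun s hs => ?_
          simp only [K]
          rw [indicator_of_mem (mem_Ioi.mpr hs.2), mul_assoc]
      _ ≤ _ := by
          gcongr
          exact fun s hs => ⟨hs.1, hs.2.le.trans ht.2⟩
  calc weightedNorm l T D
      ≤ ∫⁻ t in Ioc 0 T, ENNReal.ofReal (Real.Gamma α)⁻¹ * ∫⁻ s in Ioc 0 T, K t s * ‖h s‖ₑ :=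
        setLIntegral_mono' measurableSet_Ioc hpt
    _ = ENNReal.ofReal (Real.Gamma α)⁻¹ *
          ∫⁻ s in Ioc 0 T, ∫⁻ t in Ioc 0 T, K t s * ‖h s‖ₑ := by
        rw [lintegral_const_mul' _ _ ENNReal.ofReal_ne_top, lintegral_lintegral_swap]
        exact hK.aemeasurable.mul hm.enorm.comp_snd
    _ ≤ ENNReal.ofReal (Real.Gamma α)⁻¹ * ∫⁻ s in Ioc 0 T,
          (ENNReal.ofReal (Real.exp (-l * s)) * ENNReal.ofReal (Real.Gamma α * l ^ (-α))) *
            ‖h s‖ₑ := by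
        gcongr with s
        rw [lintegral_mul_const' _ _ enorm_ne_top, ← lintegral_exp_abel h0 hl s]
        gcongr
        exact Measure.restrict_le_self
    _ = _ := by
        have e3 : ∀ s, (ENNReal.ofReal (Real.exp (-l * s)) *
            ENNReal.ofReal (Real.Gamma α * l ^ (-α))) * ‖h s‖ₑ =
            ENNReal.ofReal (Real.Gamma α * l ^ (-α)) *
              (ENNReal.ofReal (Real.exp (-l * s)) * ‖h s‖ₑ) := fun s => by ring
        simp_rw [e3]
        rw [lintegral_const_mul' _ _ ENNReal.ofReal_ne_top, ← mul_assoc,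
          ← ENNReal.ofReal_mul (inv_pos.mpr hG).le, inv_mul_cancel_left₀ hG.ne', weightedNorm]

/-! ### Band-limited test functions -/

/-- All derivatives decay faster than any power, with constants that grow at most geometrically
with the order of the derivative; band-limited Schwartz functions have this property. -/
def HasGeometricDerivBounds (f : ℝ → ℂ) : Prop :=
  ∀ N : ℕ, ∃ C A : ℝ, 0 ≤ C ∧ 0 ≤ A ∧
    ∀ (j : ℕ) (x : ℝ), (1 + |x|) ^ N * ‖iteratedDeriv j f x‖ ≤ C * A ^ j

-- A derivative of the transform multiplies `χ` by `2πx` in modulus, at most `2π` on its support,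
-- while decay of order `N` costs at most `N` derivatives of `χ`. The resulting factors polynomial
-- in `j` are absorbed into powers of `2^j`.
open FourierTransform in
theorem hasGeometricDerivBounds_fourier (χ : SchwartzMap ℝ ℂ)
    (hχ : ∀ x, 1 < |x| → ∀ j, iteratedFDeriv ℝ j χ x = 0) :
    HasGeometricDerivBounds (𝓕 (χ : ℝ → ℂ)) := by
  have key : ∀ N : ℕ, ∃ C, 0 ≤ C ∧ ∀ (j : ℕ) (x : ℝ),
      |x| ^ N * ‖iteratedDeriv j (𝓕 (χ : ℝ → ℂ)) x‖ ≤ C * (4 * Real.pi * 2 ^ N) ^ j := by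
    intro N
    set c : ℕ → ℝ := fun i => ∫ v, ‖iteratedFDeriv ℝ i χ v‖ with hc
    have hc0 : ∀ i, 0 ≤ c i := fun i => integral_nonneg fun v => norm_nonneg _
    refine ⟨2 ^ N * ∑ i ∈ Finset.range (N + 1), c i, mul_nonneg (by positivity)
      (Finset.sum_nonneg fun i _ => hc0 i), fun j x => ?_⟩
    have h := Real.pow_mul_norm_iteratedFDeriv_fourier_le (K := ⊤) (N := ⊤)
      (χ.smooth ⊤) (fun k n _ _ => χ.integrable_pow_mul_iteratedFDeriv volume k n)
      (k := j) (n := N) le_top le_top x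
    rw [Real.norm_eq_abs, norm_iteratedFDeriv_eq_norm_iteratedDeriv] at h
    refine h.trans ?_
    have h1 : ∀ p ∈ Finset.range (j + 1) ×ˢ Finset.range (N + 1),
        ∫ v, ‖v‖ ^ p.1 * ‖iteratedFDeriv ℝ p.2 χ v‖ ≤ c p.2 := fun p _ => by
      refine integral_mono (χ.integrable_pow_mul_iteratedFDeriv volume p.1 p.2) ?_ fun v => ?_
      · simpa using χ.integrable_pow_mul_iteratedFDeriv volume 0 p.2
      · rcases le_or_gt |v| 1 with hv | hv
        · exact mul_le_of_le_one_left (norm_nonneg _) (pow_le_one₀ (norm_nonneg _) hv)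
        · simp [hχ v hv]
    have h2 := Finset.sum_le_sum h1
    have h4 : ∑ p ∈ Finset.range (j + 1) ×ˢ Finset.range (N + 1), c p.2 =
        ((j + 1 : ℕ) : ℝ) * ∑ i ∈ Finset.range (N + 1), c i := by
      rw [Finset.sum_product]
      simp
    rw [h4] at h2
    have h3 : ((j + 1 : ℕ) : ℝ) ≤ 2 ^ j := by exact_mod_cast Nat.lt_two_pow_self
    have hS : 0 ≤ ∑ i ∈ Finset.range (N + 1), c i := Finset.sum_nonneg fun i _ => hc0 i
    have hp := Real.pi_pos
    calc _ ≤ (2 * Real.pi) ^ j * (2 * j + 2) ^ N *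
          (((j + 1 : ℕ) : ℝ) * ∑ i ∈ Finset.range (N + 1), c i) :=
          mul_le_mul_of_nonneg_left h2 (by positivity)
      _ = (2 * Real.pi) ^ j * (2 ^ N * ((j + 1 : ℕ) : ℝ) ^ N) *
          (((j + 1 : ℕ) : ℝ) * ∑ i ∈ Finset.range (N + 1), c i) := by
          rw [← mul_pow]; push_cast; ring_nf
      _ ≤ (2 * Real.pi) ^ j * (2 ^ N * (2 ^ j) ^ N) *
          (2 ^ j * ∑ i ∈ Finset.range (N + 1), c i) := by gcongr
      _ = _ := by
          rw [show (4 : ℝ) * Real.pi * 2 ^ N = 2 * Real.pi * 2 * 2 ^ N by ring,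
            mul_pow (2 * Real.pi * 2) _ j, mul_pow (2 * Real.pi) _ j, ← pow_mul, ← pow_mul, mul_comm j N]
          ring
  intro N
  obtain ⟨C₀, hC₀, h₀⟩ := key 0
  obtain ⟨C, hC, h⟩ := key N
  refine ⟨2 ^ (N - 1) * (C₀ + C), 4 * Real.pi * 2 ^ N, by positivity, by positivity,
    fun j x => ?_⟩
  have h1 : (1 + |x|) ^ N ≤ 2 ^ (N - 1) * (1 + |x| ^ N) := by
    simpa using add_pow_le zero_le_one (abs_nonneg x) N
  have h2 := h₀ j x
  have h3 : C₀ * (4 * Real.pi * 2 ^ 0) ^ j ≤ C₀ * (4 * Real.pi * 2 ^ N) ^ j := by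
    have : (1 : ℝ) ≤ 2 ^ N := one_le_pow₀ one_le_two
    refine mul_le_mul_of_nonneg_left (pow_le_pow_left₀ (by positivity) ?_ j) hC₀
    simpa using mul_le_mul_of_nonneg_left this (by positivity : 0 ≤ 4 * Real.pi)
  calc _ ≤ 2 ^ (N - 1) * (1 + |x| ^ N) * ‖iteratedDeriv j (𝓕 (χ : ℝ → ℂ)) x‖ := by gcongr
    _ = 2 ^ (N - 1) * (|x| ^ 0 * ‖iteratedDeriv j (𝓕 (χ : ℝ → ℂ)) x‖ +
        |x| ^ N * ‖iteratedDeriv j (𝓕 (χ : ℝ → ℂ)) x‖) := by ring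
    _ ≤ 2 ^ (N - 1) * (C₀ * (4 * Real.pi * 2 ^ N) ^ j + C * (4 * Real.pi * 2 ^ N) ^ j) :=
        mul_le_mul_of_nonneg_left (add_le_add (h2.trans h3) (h j x)) (by positivity)
    _ = _ := by ring

theorem HasGeometricDerivBounds.comp_mul_sub {f : SchwartzMap ℝ ℂ}
    (h : HasGeometricDerivBounds f) {R : ℝ} (hR : 1 ≤ R) (y : ℝ) :
    HasGeometricDerivBounds fun x => f (R * (x - y)) := by
  intro N
  obtain ⟨C, A, hC, hA, hb⟩ := h N
  refine ⟨(1 + |y|) ^ N * C, R * A, by positivity, by positivity, fun j x => ?_⟩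
  have h1 : iteratedDeriv j (fun x => f (R * (x - y))) x =
      R ^ j • iteratedDeriv j f (R * (x - y)) := by
    rw [iteratedDeriv_comp_sub_const (f := fun x => f (R * x)),
      iteratedDeriv_comp_const_smul (f.smooth j)]
  have h2 : 1 + |x| ≤ (1 + |y|) * (1 + |R * (x - y)|) := by
    have h3 : |x| ≤ |x - y| + |y| := by simpa using abs_add_le (x - y) y
    have h4 : |x - y| ≤ |R * (x - y)| := by
      rw [abs_mul, abs_of_nonneg (by linarith : 0 ≤ R)]
      exact le_mul_of_one_le_left (abs_nonneg _) hR
    nlinarith [abs_nonneg y, abs_nonneg (R * (x - y))]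
  rw [h1, norm_smul, norm_pow, Real.norm_eq_abs, abs_of_nonneg (by linarith : 0 ≤ R)]
  calc _ ≤ ((1 + |y|) * (1 + |R * (x - y)|)) ^ N *
        (R ^ j * ‖iteratedDeriv j f (R * (x - y))‖) := by gcongr
    _ = (1 + |y|) ^ N * R ^ j *
        ((1 + |R * (x - y)|) ^ N * ‖iteratedDeriv j f (R * (x - y))‖) := by rw [mul_pow]; ring
    _ ≤ (1 + |y|) ^ N * R ^ j * (C * A ^ j) :=
        mul_le_mul_of_nonneg_left (hb _ _) (by positivity)
    _ = _ := by rw [mul_pow]; ring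

/-! ### Uniqueness of the solution -/

/-- Integrated form of the fractional problem, tested against a Schwartz function. -/
theorem IsFundamentalSolution.integral_equation {α k : ℝ} {n : ℕ} {u : ℝ → ℝ → ℂ} (h0 : 0 < α)
    (h1 : α < 1) (hu : IsFundamentalSolution α n k u) (φ : SchwartzMap ℝ ℂ) {t : ℝ} (ht : 0 < t) :
    IntegrableOn (fun s => k * (-1) ^ n * spacePairing u (schwartzDeriv n φ) s *
      (((t - s) ^ (α - 1) : ℝ) : ℂ)) (Ioc 0 t) ∧
    ∫ s in Ioc 0 t, k * (-1) ^ n * spacePairing u (schwartzDeriv n φ) s *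
      (((t - s) ^ (α - 1) : ℝ) : ℂ) = (Real.Gamma α : ℂ) * (spacePairing u φ t - φ 0) := by
  have h := integral_caputoDeriv_mul_rpow h0 h1 (hu.contDiff_time φ) ht
    (hu.deriv_integrable φ t ht) (hu.initial φ)
  have e : EqOn (fun s => caputoDeriv α (spacePairing u φ) s * (((t - s) ^ (α - 1) : ℝ) : ℂ))
      (fun s => k * (-1) ^ n * spacePairing u (schwartzDeriv n φ) s *
        (((t - s) ^ (α - 1) : ℝ) : ℂ)) (Ioc 0 t) := fun s hs => by
    simp only [hu.equation φ s hs.1, coe_schwartzDeriv]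
  exact ⟨h.1.congr_fun e measurableSet_Ioc, (setIntegral_congr_fun measurableSet_Ioc e) ▸ h.2⟩

/-- The difference of the pairings of two functions with a test function. -/
def pairingDiff (u v : ℝ → ℝ → ℂ) (φ : SchwartzMap ℝ ℂ) (t : ℝ) : ℂ :=
  spacePairing u φ t - spacePairing v φ t

theorem continuousOn_pairingDiff {α k : ℝ} {n : ℕ} {u v : ℝ → ℝ → ℂ}
    (hu : IsFundamentalSolution α n k u) (hv : IsFundamentalSolution α n k v)
    (φ : SchwartzMap ℝ ℂ) : ContinuousOn (pairingDiff u v φ) (Ioi 0) :=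
  (hu.contDiff_time φ).continuousOn.sub (hv.contDiff_time φ).continuousOn

theorem IsHeatSign.norm_eq_one {n : ℕ} {k : ℝ} (hk : IsHeatSign n k) : ‖(k : ℂ)‖ = 1 := by
  rcases Nat.even_or_odd n with ⟨q, hq⟩ | ho
  · rw [hk.1 q (by omega)]
    simp
  · rcases hk.2 ho with rfl | rfl <;> simp

/-- Subtracting the integrated equations cancels the common initial value. As `k (-1)^n` has modulus
`1`, each step gains `l^(-α)` in exchange for `n` derivatives of the test function. -/
theorem weightedNorm_pairingDiff_le {α k l T : ℝ} {n : ℕ} {u v : ℝ → ℝ → ℂ} (h0 : 0 < α)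
    (h1 : α < 1) (hk : IsHeatSign n k) (hl : 0 < l) (hu : IsFundamentalSolution α n k u)
    (hv : IsFundamentalSolution α n k v) (φ : SchwartzMap ℝ ℂ) :
    weightedNorm l T (pairingDiff u v φ) ≤
      ENNReal.ofReal (l ^ (-α)) * weightedNorm l T (pairingDiff u v (schwartzDeriv n φ)) := by
  have hc : ‖(k : ℂ) * (-1) ^ n‖ₑ = 1 := by
    rw [← ofReal_norm, norm_mul, hk.norm_eq_one]
    simp
  have h2 : weightedNorm l T (fun s => k * (-1) ^ n * pairingDiff u v (schwartzDeriv n φ) s) =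
      weightedNorm l T (pairingDiff u v (schwartzDeriv n φ)) := by
    simp only [weightedNorm, enorm_mul _ (pairingDiff u v _ _), hc, one_mul]
  rw [← h2]
  refine weightedNorm_le_of_fractional_integral h0 hl ?_ fun t ht => ?_
  · exact ((continuousOn_const.mul (continuousOn_pairingDiff hu hv _)).mono
      Ioc_subset_Ioi_self).aestronglyMeasurable measurableSet_Ioc
  · obtain ⟨hi, he⟩ := hu.integral_equation h0 h1 φ ht.1
    obtain ⟨hi', he'⟩ := hv.integral_equation h0 h1 φ ht.1
    have h3 := integral_sub hi hi'
    rw [he, he'] at h3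
    rw [show (Real.Gamma α : ℂ) * pairingDiff u v φ t =
      Real.Gamma α * (spacePairing u φ t - φ 0) - Real.Gamma α * (spacePairing v φ t - φ 0) by
        rw [pairingDiff]; ring, ← h3]
    refine setIntegral_congr_fun measurableSet_Ioc fun s _ => ?_
    simp only [pairingDiff]
    ring

theorem IsFundamentalSolution.norm_spacePairing_le {α k : ℝ} {n : ℕ} {u : ℝ → ℝ → ℂ}
    (hu : IsFundamentalSolution α n k u) {φ : SchwartzMap ℝ ℂ} (hφ : HasGeometricDerivBounds φ)
    {T : ℝ} (hT : 0 < T) :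
    ∃ (A : ℝ) (g : ℝ → ℝ), 0 ≤ A ∧ IntegrableOn g (Ioc 0 T) ∧ ∀ t ∈ Ioc 0 T, 0 ≤ g t ∧
      ∀ j, ‖spacePairing u (schwartzDeriv j φ) t‖ ≤ g t * A ^ j := by
  obtain ⟨N, g, hg, hug⟩ := hu.growth T hT
  -- `N` powers compensate the growth of `u`, and two more make the product integrable; `A` and the
  -- time factor do not depend on the order `j`.
  obtain ⟨C, A, hC, hA, hb⟩ := hφ (N + 2)
  have hI : Integrable fun x : ℝ => (1 + ‖x‖) ^ (-(2 : ℝ)) :=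
    integrable_one_add_norm (by simp)
  set I := ∫ x : ℝ, (1 + ‖x‖) ^ (-(2 : ℝ)) with hI'
  have hI0 : 0 ≤ I := integral_nonneg fun x => by positivity
  refine ⟨A, fun t => g t * (C * I), hA, hg.mul_const _, fun t ht => ?_⟩
  have hgt : 0 ≤ g t := by simpa using (norm_nonneg _).trans (hug t ht 0)
  refine ⟨by positivity, fun j => ?_⟩
  have hpt : ∀ x, ‖u x t * schwartzDeriv j φ x‖ ≤
      g t * (C * A ^ j) * (1 + ‖x‖) ^ (-(2 : ℝ)) := fun x => by
    have hx : 0 < 1 + |x| := by positivity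
    rw [Real.norm_eq_abs, Real.rpow_neg hx.le, Real.rpow_two, ← div_eq_mul_inv,
      le_div_iff₀ (by positivity), norm_mul, coe_schwartzDeriv]
    calc _ ≤ g t * (1 + |x|) ^ N * ‖iteratedDeriv j φ x‖ * (1 + |x|) ^ 2 := by
          gcongr
          exact hug t ht x
      _ = g t * ((1 + |x|) ^ (N + 2) * ‖iteratedDeriv j φ x‖) := by ring
      _ ≤ _ := mul_le_mul_of_nonneg_left (hb j x) hgt
  refine (norm_integral_le_of_norm_le (hI.const_mul _) (ae_of_all _ hpt)).trans (le_of_eq ?_)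
  rw [integral_const_mul]
  ring

theorem schwartzDeriv_add (i j : ℕ) (φ : SchwartzMap ℝ ℂ) :
    schwartzDeriv (i + j) φ = schwartzDeriv i (schwartzDeriv j φ) :=
  Function.iterate_add_apply _ _ _ _

/-- Solutions with the same initial value have the same pairings with band-limited functions. -/
theorem pairingDiff_eq_zero {α k : ℝ} {n : ℕ} {u v : ℝ → ℝ → ℂ} (h0 : 0 < α) (h1 : α < 1)
    (hk : IsHeatSign n k) (hu : IsFundamentalSolution α n k u)
    (hv : IsFundamentalSolution α n k v) {φ : SchwartzMap ℝ ℂ} (hφ : HasGeometricDerivBounds φ)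
    {t : ℝ} (ht : 0 < t) : pairingDiff u v φ t = 0 := by
  obtain ⟨A₁, g₁, hA₁, hg₁, hb₁⟩ := hu.norm_spacePairing_le hφ ht
  obtain ⟨A₂, g₂, hA₂, hg₂, hb₂⟩ := hv.norm_spacePairing_le hφ ht
  set A := max A₁ A₂ with hA
  have hA0 : 0 ≤ A := hA₁.trans (le_max_left _ _)
  -- With `l^(-α) = 1/B` each step multiplies by `A^n / B < 1`; the same `l` serves all steps, since
  -- `A` bounds the derivatives of every order.
  set B : ℝ := 2 * A ^ n + 1 with hB
  have hB0 : 0 < B := by positivity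
  set l : ℝ := B ^ (1 / α) with hl
  have hl0 : 0 < l := by positivity
  have hlα : l ^ (-α) = B⁻¹ := by
    rw [hl, ← Real.rpow_mul hB0.le, ← Real.rpow_neg_one]
    congr 1
    field_simp
  have hit : ∀ j, weightedNorm l t (pairingDiff u v φ) ≤
      ENNReal.ofReal B⁻¹ ^ j * weightedNorm l t (pairingDiff u v (schwartzDeriv (n * j) φ)) := by
    intro j
    induction j with
    | zero => simp [schwartzDeriv]
    | succ j ih =>
      refine ih.trans ?_
      rw [pow_succ, mul_assoc, Nat.mul_succ, add_comm, schwartzDeriv_add, ← hlα]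
      gcongr
      exact weightedNorm_pairingDiff_le h0 h1 hk hl0 hu hv _
  set G : ENNReal := ∫⁻ s in Ioc 0 t, ENNReal.ofReal (g₁ s + g₂ s) with hG
  have hGfin : G ≠ ⊤ := (hg₁.add hg₂).lintegral_lt_top.ne
  have hbd : ∀ j, weightedNorm l t (pairingDiff u v (schwartzDeriv j φ)) ≤
      ENNReal.ofReal A ^ j * G := by
    intro j
    rw [hG, ← lintegral_const_mul' _ _ (by finiteness)]
    refine setLIntegral_mono' measurableSet_Ioc fun s hs => ?_
    have e1 : ENNReal.ofReal (Real.exp (-l * s)) ≤ 1 :=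
      ENNReal.ofReal_le_one.mpr (Real.exp_le_one_iff.mpr
        (by nlinarith [mul_pos hl0 hs.1]))
    have e2 : ‖pairingDiff u v (schwartzDeriv j φ) s‖ₑ ≤
        ENNReal.ofReal A ^ j * ENNReal.ofReal (g₁ s + g₂ s) := by
      rw [← ofReal_norm, ← ENNReal.ofReal_pow hA0, ← ENNReal.ofReal_mul (by positivity)]
      refine ENNReal.ofReal_le_ofReal ((norm_sub_le _ _).trans ?_)
      obtain ⟨p1, q1⟩ := hb₁ s hs
      obtain ⟨p2, q2⟩ := hb₂ s hs
      have r1 : g₁ s * A₁ ^ j ≤ g₁ s * A ^ j := by gcongr; exact le_max_left _ _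
      have r2 : g₂ s * A₂ ^ j ≤ g₂ s * A ^ j := by gcongr; exact le_max_right _ _
      linarith [q1 j, q2 j]
    calc _ ≤ 1 * _ := mul_le_mul' e1 e2
      _ = _ := one_mul _
  have hzero : weightedNorm l t (pairingDiff u v φ) = 0 := by
    have hq : ENNReal.ofReal B⁻¹ * ENNReal.ofReal A ^ n < 1 := by
      rw [← ENNReal.ofReal_pow hA0, ← ENNReal.ofReal_mul (by positivity), ENNReal.ofReal_lt_one,
        inv_mul_lt_iff₀ hB0]
      have : 0 ≤ A ^ n := by positivity
      linarith
    have hlim := ENNReal.Tendsto.mul_const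
      (ENNReal.tendsto_pow_atTop_nhds_zero_of_lt_one hq) (Or.inr hGfin)
    rw [zero_mul] at hlim
    refine le_antisymm (ge_of_tendsto' hlim fun j => ?_) zero_le
    refine (hit j).trans ((mul_le_mul_right (hbd (n * j)) _).trans (le_of_eq ?_))
    rw [mul_pow, ← pow_mul, mul_assoc]
  have hcont := continuousOn_pairingDiff hu hv φ
  have hmeas : AEMeasurable (fun s => ENNReal.ofReal (Real.exp (-l * s)) *
      ‖pairingDiff u v φ s‖ₑ) (volume.restrict (Ioc 0 t)) :=
    (by fun_prop : Measurable fun s : ℝ => ENNReal.ofReal (Real.exp (-l * s))).aemeasurable.mul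
      ((hcont.mono Ioc_subset_Ioi_self).aestronglyMeasurable measurableSet_Ioc).enorm
  rw [weightedNorm, lintegral_eq_zero_iff' hmeas] at hzero
  have hae : pairingDiff u v φ =ᵐ[volume.restrict (Ioc 0 t)] fun _ => 0 := by
    filter_upwards [hzero] with s hs
    simpa [(Real.exp_pos _).not_ge] using hs
  -- The vanishing norm yields zero only almost everywhere; continuity in time extends it to the
  -- endpoint `t`.
  exact Measure.eqOn_Ioc_of_ae_eq volume hae (hcont.mono Ioc_subset_Ioi_self) continuousOn_const
    ⟨ht, le_rfl⟩

open FourierTransform in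
/-- A band-limited test function with integral `1`. -/
theorem exists_hasGeometricDerivBounds :
    ∃ η : SchwartzMap ℝ ℂ, HasGeometricDerivBounds η ∧ ∫ x, η x = 1 := by
  -- Outer radius `1` places the frequencies in `[-1, 1]`; the value `1` at the origin becomes the
  -- integral of the transform by inversion.
  let b : ContDiffBump (0 : ℝ) := ⟨1 / 2, 1, by norm_num, by norm_num⟩
  have hs : HasCompactSupport fun x => (b x : ℂ) :=
    b.hasCompactSupport.comp_left Complex.ofReal_zero
  let χ : SchwartzMap ℝ ℂ := hs.toSchwartzMap (Complex.ofRealCLM.contDiff.comp b.contDiff)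
  have hχ : ∀ x, χ x = b x := fun x => rfl
  refine ⟨𝓕 χ, ?_, ?_⟩
  · rw [SchwartzMap.fourier_coe]
    refine hasGeometricDerivBounds_fourier χ fun x hx j => ?_
    by_contra h
    have h1 : x ∈ tsupport χ := support_iteratedFDeriv_subset j h
    have h2 : tsupport χ ⊆ tsupport b := closure_mono fun y hy h => hy (by
      rw [hχ]
      simpa using h)
    have h3 := h2 h1
    rw [b.tsupport_eq] at h3
    simp only [Metric.mem_closedBall, dist_zero_right, Real.norm_eq_abs] at h3
    exact absurd hx (not_lt.mpr h3)
  · have h : (𝓕⁻ (𝓕 χ)) 0 = χ 0 := by rw [FourierTransform.fourierInv_fourier_eq]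
    rw [SchwartzMap.fourierInv_coe, Real.fourierInv_eq] at h
    simp only [inner_zero_right, AddChar.map_zero_eq_one, one_smul] at h
    rw [h, hχ, b.one_of_mem_closedBall (by simp [b])]
    simp

theorem exists_schwartzMap_comp_mul_sub (f : SchwartzMap ℝ ℂ) {R : ℝ} (hR : R ≠ 0) (y : ℝ) :
    ∃ g : SchwartzMap ℝ ℂ, (g : ℝ → ℂ) = fun x => f (R * (x - y)) :=
  ⟨SchwartzMap.compSubConstCLM ℂ y (SchwartzMap.compCLMOfContinuousLinearEquiv ℂ
    (ContinuousLinearEquiv.smulLeft (Units.mk0 R hR)) f), rfl⟩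

/-- A continuous function of polynomial growth is the limit of its smoothed versions. -/
theorem tendsto_integral_mul_comp_mul_sub {w : ℝ → ℂ} (hw : Continuous w) {K : ℝ} {N : ℕ}
    (hK : 0 ≤ K) (hb : ∀ x, ‖w x‖ ≤ K * (1 + |x|) ^ N) (η : SchwartzMap ℝ ℂ) (y : ℝ) :
    Tendsto (fun M : ℕ => (M + 1 : ℝ) • ∫ x, w x * η ((M + 1 : ℝ) * (x - y))) atTop
      (𝓝 (w y * ∫ x, η x)) := by
  have hsub : ∀ M : ℕ, (M + 1 : ℝ) • ∫ x, w x * η ((M + 1 : ℝ) * (x - y)) =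
      ∫ z, w (y + z / (M + 1 : ℝ)) * η z := by
    intro M
    have hM : (0 : ℝ) < M + 1 := by positivity
    set F : ℝ → ℂ := fun z => w (y + z / (M + 1 : ℝ)) * η z with hF
    have e1 : ∀ x, w x * η ((M + 1 : ℝ) * (x - y)) = F ((M + 1 : ℝ) * (x - y)) := fun x => by
      simp only [hF]
      rw [mul_div_cancel_left₀ _ hM.ne', add_sub_cancel]
    simp_rw [e1]
    rw [integral_sub_right_eq_self (fun x => F ((M + 1 : ℝ) * x)) y,
      Measure.integral_comp_mul_left, abs_of_pos (inv_pos.mpr hM), smul_smul,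
      mul_inv_cancel₀ hM.ne', one_smul]
  simp_rw [hsub]
  rw [← integral_const_mul]
  have hI : Integrable fun z => (1 + |z|) ^ N * ‖η z‖ := by
    have h : Integrable fun z => 2 ^ (N - 1) * (‖z‖ ^ 0 * ‖η z‖ + ‖z‖ ^ N * ‖η z‖) :=
      ((η.integrable_pow_mul volume 0).add (η.integrable_pow_mul volume N)).const_mul _
    refine h.mono' (by fun_prop) (ae_of_all _ fun z => ?_)
    have h1 : (1 + |z|) ^ N ≤ 2 ^ (N - 1) * (1 + |z| ^ N) := by
      simpa using add_pow_le zero_le_one (abs_nonneg z) N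
    rw [Real.norm_of_nonneg (by positivity), Real.norm_eq_abs]
    calc _ ≤ 2 ^ (N - 1) * (1 + |z| ^ N) * ‖η z‖ := by gcongr
      _ = _ := by ring
  refine tendsto_integral_of_dominated_convergence
    (fun z => K * (1 + |y|) ^ N * ((1 + |z|) ^ N * ‖η z‖)) (fun M => by fun_prop)
    (hI.const_mul _) (fun M => ae_of_all _ fun z => ?_) (ae_of_all _ fun z => ?_)
  · have h1 : |z / (M + 1 : ℝ)| ≤ |z| := by
      rw [abs_div, abs_of_pos (by positivity : (0 : ℝ) < M + 1)]
      exact div_le_self (abs_nonneg _) (by linarith [(Nat.cast_nonneg M : (0 : ℝ) ≤ M)])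
    have h2 : 1 + |y + z / (M + 1 : ℝ)| ≤ (1 + |y|) * (1 + |z|) := by
      nlinarith [abs_add_le y (z / (M + 1 : ℝ)), abs_nonneg y, abs_nonneg z]
    rw [norm_mul]
    calc _ ≤ K * (1 + |y + z / (M + 1 : ℝ)|) ^ N * ‖η z‖ := by gcongr; exact hb _
      _ ≤ K * ((1 + |y|) * (1 + |z|)) ^ N * ‖η z‖ := by gcongr
      _ = _ := by rw [mul_pow]; ring
  · have h1 : Tendsto (fun M : ℕ => y + z / (M + 1 : ℝ)) atTop (𝓝 (y + 0)) :=
      tendsto_const_nhds.add (tendsto_const_nhds.div_atTop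
        (tendsto_atTop_add_const_right _ _ tendsto_natCast_atTop_atTop))
    rw [add_zero] at h1
    exact ((hw.tendsto y).comp h1).mul_const _

/-- The fractional problem has at most one solution. -/
theorem IsFundamentalSolution.eq_of_pos {α k : ℝ} {n : ℕ} {u v : ℝ → ℝ → ℂ} (h0 : 0 < α)
    (h1 : α < 1) (hk : IsHeatSign n k) (hu : IsFundamentalSolution α n k u)
    (hv : IsFundamentalSolution α n k v) {t : ℝ} (ht : 0 < t) (x : ℝ) : u x t = v x t := by
  obtain ⟨η, hη, hη1⟩ := exists_hasGeometricDerivBounds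
  obtain ⟨N₁, g₁, -, hg₁⟩ := hu.growth t ht
  obtain ⟨N₂, g₂, -, hg₂⟩ := hv.growth t ht
  have lim : ∀ {w : ℝ → ℝ → ℂ} {N : ℕ} {g : ℝ → ℝ}, Continuous (fun x => w x t) →
      (∀ s ∈ Ioc 0 t, ∀ x : ℝ, ‖w x s‖ ≤ g s * (1 + |x|) ^ N) →
      Tendsto (fun M : ℕ => (M + 1 : ℝ) • ∫ y, w y t * η ((M + 1 : ℝ) * (y - x))) atTop
        (𝓝 (w x t)) := fun {w N g} hc hb => by
    have hg : 0 ≤ g t := by simpa using (norm_nonneg _).trans (hb t ⟨ht, le_rfl⟩ 0)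
    simpa [hη1] using tendsto_integral_mul_comp_mul_sub hc hg (hb t ⟨ht, le_rfl⟩) η x
  refine tendsto_nhds_unique (lim (hu.continuous_space t ht) hg₁)
    ((lim (hv.continuous_space t ht) hg₂).congr fun M => ?_)
  -- Dilation by `M + 1 ≥ 1` and translation preserve the geometric bounds, so both solutions have
  -- the same smoothed values at every scale.
  have hM : (1 : ℝ) ≤ M + 1 := by linarith [(Nat.cast_nonneg M : (0 : ℝ) ≤ M)]
  obtain ⟨φ, hφ⟩ := exists_schwartzMap_comp_mul_sub η (by positivity : (M + 1 : ℝ) ≠ 0) x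
  have h := pairingDiff_eq_zero h0 h1 hk hu hv
    (hφ ▸ hη.comp_mul_sub hM x : HasGeometricDerivBounds φ) ht
  rw [pairingDiff, spacePairing, spacePairing, sub_eq_zero, hφ] at h
  rw [h]

/-! ### The random time on an arbitrary probability space -/

theorem hasPDF_timeProduct {Ω : Type*} [MeasurableSpace Ω] {P : Measure Ω}
    [IsProbabilityMeasure P] {m : ℕ} (hm : 2 < m) {G : Fin (m - 1) → ℝ → Ω → ℝ}
    (hG : IsFactorFamily m P G) {t : ℝ} (ht : 0 < t) : HasPDF (timeProduct G t) P volume := by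
  have h := hasLaw_timeProduct hG ht
  have : IsProbabilityMeasure (P.map (timeProduct G t)) :=
    Measure.isProbabilityMeasure_map h.aemeasurable
  rw [hasPDF_iff_of_aemeasurable h.aemeasurable]
  exact ⟨inferInstance, h.map_eq ▸ productLaw_absolutelyContinuous hm ht⟩

theorem ae_pos_timeProduct {Ω : Type*} [MeasurableSpace Ω] {P : Measure Ω}
    {m : ℕ} (hm : 2 < m) {G : Fin (m - 1) → ℝ → Ω → ℝ} (hG : IsFactorFamily m P G) {t : ℝ}
    (ht : 0 < t) : ∀ᵐ ω ∂P, 0 < timeProduct G t ω := by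
  have h := hasLaw_timeProduct hG ht
  have h1 := ae_pos_productLaw hm ht
  rw [← h.map_eq] at h1
  exact ae_of_ae_map h.aemeasurable h1

theorem indicator_heatKernel_mul_pdf {Ω : Type*} [MeasurableSpace Ω] (P : Measure Ω) (T : Ω → ℝ)
    (n : ℕ) (k x : ℝ) :
    (Ioi (0 : ℝ)).indicator (fun s => heatKernel n k x s * ((pdf T P volume s).toReal : ℂ)) =
      fun s => (pdf T P volume s).toReal • posKernel n k x s := by
  ext s
  by_cases hs : 0 < s
  · rw [indicator_of_mem (mem_Ioi.mpr hs), posKernel_of_pos n k x hs, Complex.real_smul, mul_comm]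
  · rw [indicator_of_notMem (fun h => hs (mem_Ioi.mp h)), posKernel, if_neg hs, smul_zero]

theorem integrableOn_heatKernel_mul_pdf {Ω : Type*} [MeasurableSpace Ω] {P : Measure Ω}
    [IsProbabilityMeasure P] {m n : ℕ} (hm : 2 < m) (hn : 2 ≤ n) {k : ℝ} (hk : IsHeatSign n k)
    {G : Fin (m - 1) → ℝ → Ω → ℝ} (hG : IsFactorFamily m P G) {t : ℝ} (ht : 0 < t) (x : ℝ) :
    IntegrableOn (fun s => heatKernel n k x s *
      ((pdf (timeProduct G t) P volume s).toReal : ℂ)) (Ioi 0) := by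
  have := hasPDF_timeProduct hm hG ht
  have h := hasLaw_timeProduct hG ht
  rw [← integrable_indicator_iff measurableSet_Ioi, indicator_heatKernel_mul_pdf,
    pdf.integrable_pdf_smul_iff (aestronglyMeasurable_posKernel hn hk x _)]
  have h1 := integrable_posKernel hm hn hk x ht
  rw [← h.map_eq] at h1
  exact h1.comp_aemeasurable h.aemeasurable

/-- Only the law of the random time matters, and it is the same for every factor family, so results
for the mean kernel transfer to any probability space. -/
theorem subordinatedKernel_eq_meanKernel {Ω : Type*} [MeasurableSpace Ω] {P : Measure Ω}
    [IsProbabilityMeasure P] {m n : ℕ} (hm : 2 < m) (hn : 2 ≤ n) {k : ℝ} (hk : IsHeatSign n k)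
    {G : Fin (m - 1) → ℝ → Ω → ℝ} (hG : IsFactorFamily m P G) {t : ℝ} (ht : 0 < t) (x : ℝ) :
    subordinatedKernel n k P (timeProduct G t) x = meanKernel m n k x t := by
  have := hasPDF_timeProduct hm hG ht
  have h := hasLaw_timeProduct hG ht
  rw [subordinatedKernel, ← integral_indicator measurableSet_Ioi, indicator_heatKernel_mul_pdf,
    pdf.integral_pdf_smul (aestronglyMeasurable_posKernel hn hk x _), meanKernel, ← h.map_eq,
    integral_map h.aemeasurable (aestronglyMeasurable_posKernel hn hk x _)]

theorem isPseudoDensityAt_meanKernel {Ω : Type*} [MeasurableSpace Ω] {P : Measure Ω}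
    [IsProbabilityMeasure P] {m n : ℕ} (hm : 2 < m) (hn : 2 ≤ n) {k : ℝ} (hk : IsHeatSign n k)
    {G : Fin (m - 1) → ℝ → Ω → ℝ} (hG : IsFactorFamily m P G) {t : ℝ} (ht : 0 < t) :
    IsPseudoDensityAt n k P (timeProduct G t) fun x => meanKernel m n k x t := by
  intro f hf
  have := isProbabilityMeasure_productLaw hm ht
  have h := hasLaw_timeProduct hG ht
  have hpos := ae_pos_timeProduct hm hG ht
  have hI := integrable_posKernel_mul hm hn hk ht hf
  have hI' : Integrable (fun s => ∫ x, f x * posKernel n k x s) (P.map (timeProduct G t)) := by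
    rw [h.map_eq]
    exact hI.integral_prod_right
  have hae : (fun ω => pseudoExpectation n k f (timeProduct G t ω)) =ᵐ[P]
      fun ω => ∫ x, f x * posKernel n k x (timeProduct G t ω) := by
    filter_upwards [hpos] with ω hω
    simp only [pseudoExpectation, posKernel_of_pos n k _ hω]
  refine ⟨?_, (hI'.comp_aemeasurable h.aemeasurable).congr hae.symm, ?_, ?_⟩
  · obtain ⟨C, hC, hb⟩ := norm_heatKernel_le hn hk
    filter_upwards [hpos] with ω hω
    exact hf.mul_bdd (continuous_heatKernel hn hk hω).aestronglyMeasurable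
      (ae_of_all _ fun x => hb x _ hω)
  · simpa only [Function.uncurry, integral_const_mul, meanKernel] using hI.integral_prod_left
  · rw [integral_congr_ae hae, integral_mul_meanKernel hm hn hk ht hf, ← h.map_eq,
      integral_map h.aemeasurable hI'.aestronglyMeasurable]

theorem one_div_natCast_mem_Ioo {m : ℕ} (hm : 2 < m) : 1 / (m : ℝ) ∈ Ioo (0 : ℝ) 1 := by
  have hm0 : (0 : ℝ) < m := by positivity
  refine ⟨by positivity, ?_⟩
  rw [div_lt_one hm0]
  exact_mod_cast (by omega : 1 < m)

end

theorem mainTheorem8 (m n : ℕ) (hm : 2 < m) (hn : 2 ≤ n) (k : ℝ) (hk : IsHeatSign n k) :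
    -- the improper integral that defines `p_n` converges
    (∀ x s : ℝ, 0 < s →
      Tendsto (truncKernel n k x s) (atTop ×ˢ atTop) (𝓝 (heatKernel n k x s))) ∧
    -- the densities of the factors are probability densities
    (∀ t : ℝ, 0 < t → ∀ j : Fin (m - 1),
      IsProbabilityMeasure (factorLaw m ((j : ℕ) + 1) t)) ∧
    -- their product is the joint density
    (∀ t : ℝ, 0 < t → ∀ w : Fin (m - 1) → ℝ,
      ∏ j : Fin (m - 1), factorDensity m ((j : ℕ) + 1) t (w j) = jointDensity m t w) ∧
    -- having this joint density is the same as being independent with the given densities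
    (∀ (Ω : Type*) [MeasurableSpace Ω] (P : Measure Ω) [IsProbabilityMeasure P]
      (X : Fin (m - 1) → Ω → ℝ) (t : ℝ), 0 < t →
      (HasLaw (fun ω j => X j ω)
          (volume.withDensity fun w => ENNReal.ofReal (jointDensity m t w)) P ↔
        iIndepFun X P ∧ ∀ j, HasLaw (X j) (factorLaw m ((j : ℕ) + 1) t) P)) ∧
    -- such families of random variables exist
    (∃ (Ω : Type) (_ : MeasurableSpace Ω) (P : Measure Ω) (_ : IsProbabilityMeasure P)
      (G : Fin (m - 1) → ℝ → Ω → ℝ), IsFactorFamily m P G) ∧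
    -- for each of them, the solution is the density of `Ψ_n(G(t))`
    (∀ (Ω : Type*) [MeasurableSpace Ω] (P : Measure Ω) [IsProbabilityMeasure P]
      (G : Fin (m - 1) → ℝ → Ω → ℝ), IsFactorFamily m P G →
      (∀ t : ℝ, 0 < t →
        (∀ᵐ ω ∂P, 0 < timeProduct G t ω) ∧ HasPDF (timeProduct G t) P volume ∧
        ∀ x : ℝ, IntegrableOn
          (fun s => heatKernel n k x s * ((pdf (timeProduct G t) P volume s).toReal : ℂ))
          (Ioi 0)) ∧
      IsFundamentalSolution (1 / (m : ℝ)) n k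
        (fun x t => subordinatedKernel n k P (timeProduct G t) x) ∧
      (∀ u : ℝ → ℝ → ℂ, IsFundamentalSolution (1 / (m : ℝ)) n k u →
        ∀ t : ℝ, 0 < t →
          (∀ x : ℝ, u x t = subordinatedKernel n k P (timeProduct G t) x) ∧
          IsPseudoDensityAt n k P (timeProduct G t) (fun x => u x t))) := by
  refine ⟨fun x s hs => tendsto_truncKernel_heatKernel hn hk x hs,
    fun t ht j => isProbabilityMeasure_factorLaw hm (Nat.le_add_left _ _) ht,
    fun t ht w => prod_factorDensity hm ht w,
    fun Ω _ P _ X t ht => hasLaw_jointDensity_iff hm ht X, exists_isFactorFamily hm,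
    fun Ω _ P _ G hG => ?_⟩
  obtain ⟨h0, h1⟩ := one_div_natCast_mem_Ioo hm
  have hsol : IsFundamentalSolution (1 / (m : ℝ)) n k
      (fun x t => subordinatedKernel n k P (timeProduct G t) x) :=
    isFundamentalSolution_of_eq_meanKernel hm hn hk fun x t ht =>
      subordinatedKernel_eq_meanKernel hm hn hk hG ht x
  refine ⟨fun t ht => ⟨ae_pos_timeProduct hm hG ht, hasPDF_timeProduct hm hG ht,
    integrableOn_heatKernel_mul_pdf hm hn hk hG ht⟩, hsol, fun u hu t ht => ?_⟩
  have hu' : ∀ x, u x t = subordinatedKernel n k P (timeProduct G t) x :=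
    hu.eq_of_pos h0 h1 hk hsol ht
  refine ⟨hu', ?_⟩
  simpa only [hu', subordinatedKernel_eq_meanKernel hm hn hk hG ht] using
    isPseudoDensityAt_meanKernel hm hn hk hG ht
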